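/- Write $x_h=(x,y)\in\mathbb R^2$, $\nabla_h=(\partial_x,\partial_y)$, and let $Q=\mathbb R^2\times\,]-\pi,\pi[$. Fix $\varphi\in\mathcal S(\mathbb R^2)$ supported in $\{\tfrac34\le|\xi|\le\tfrac83\}$ with $\sum_{q\in\mathbb Z}\varphi(2^{-q}\xi)=1$ for all $\xi\ne0$. Let $\dot\Delta_q=\varphi(2^{-q}D)$, $D=-i\nabla_h$, acting on tempered distributions on $\mathbb R^2$, and on tempered distributions on $\mathbb R^3$ through the horizontal variables only; let $\dot S_0u=\sum_{j\le-1}\dot\Delta_ju$ (convergence in $\mathcal S'$). For a distribution $u$ that is $2\pi$-periodic in $z$, let $u_n=\frac1{2\pi}\int_{-\pi}^{\pi}u(\cdot,\cdot,z)e^{-inz}\,dz\in\mathcal S'(\mathbb R^2)$, $n\in\mathbb Z$, be its Fourier coefficients and $$\|u\|_{\mathscr{\dot B}^0_{\infty,1}}=\sum_{n\in\mathbb Z}\|u_n\|_{\dot B^0_{\infty,1}(\mathbb R^2)}=\sum_{n\in\mathbb Z}\sum_{q\in\mathbb Z}\|\dot\Delta_qu_n\|_{L^\infty(\mathbb R^2)}\in[0,\infty].$$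 An $L^p$ norm of a distribution is $\infty$ if the distribution is not a function in $L^p$; norms of vector and matrix fields are the sums of the norms of the components. **Lemma 3.6.** There is a constant $C$, depending only on $\varphi$, such that the following holds for every vector field $v=(v^1,v^2,v^3)$ of (complex) tempered distributions on $\mathbb R^3$ that are $2\pi$-periodic with respect to the third variable, with $\operatorname{div}v=0$ and $\Omega=\operatorname{curl}v$ in the sense of distributions. 1. $\|\nabla_hv\|_{\mathscr{\dot B}^0_{\infty,1}}\le C\,\|\Omega\|_{\mathscr{\dot B}^0_{\infty,1}}$. 2. For every integer $j\ge0$, $\|\dot\Delta_j\nabla_hv\|_{L^\infty(Q)}\le C\,2^{j/2}\,\|\dot\Delta_j\Omega\|_{L^\infty(Q)}$. 3. If $v\in L^2(Q)$, then the series $\dot S_0v$ converges in $\mathcal S'$. Moreover $\|\dot S_0v\|_{L^\infty(Q)}\le C\bigl(\|v\|_{L^2(Q)}+\|\Omega\|_{L^2(Q)}\bigr)$; this has content only if the right-hand side is finite. -/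

import Mathlib

open scoped SchwartzMap ENNReal NNReal LineDeriv
open MeasureTheory

namespace StripBesov

noncomputable section

/-- The horizontal plane `ℝ²`, variable `x_h = (x, y)`. -/
abbrev Plane : Type := EuclideanSpace ℝ (Fin 2)

/-- The space `ℝ³`, variable `(x, y, z)`; the coordinate `z` has index `2`. -/
abbrev Space : Type := EuclideanSpace ℝ (Fin 3)

/-- The horizontal projection `(x, y, z) ↦ (x, y)`. -/
def horiz : Space →L[ℝ] Plane :=
  LinearMap.toContinuousLinearMap
    { toFun := fun x => !₂[x 0, x 1]
      map_add' := fun x y => by ext i; fin_cases i <;> simp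
      map_smul' := fun c x => by ext i; fin_cases i <;> simp }

/-- The vertical projection `(x, y, z) ↦ z`. -/
def vert : Space →L[ℝ] ℝ := EuclideanSpace.proj (2 : Fin 3)

/-- The strip `ℝ² × ]-π, π[`, one period in `z`. -/
def strip : Set Space := {x | x 2 ∈ Set.Ioo (-Real.pi) Real.pi}

/-! ### Distributions that are functions, and their `L^p` norms -/

/-- The tempered distribution `u` is (integration against) the function `f`. -/
def RepresentedBy {E : Type} [NormedAddCommGroup E] [NormedSpace ℝ E] [MeasureSpace E]
    (u : 𝓢'(E, ℂ)) (f : E → ℂ) : Prop :=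
  AEStronglyMeasurable f volume ∧
    ∀ ψ : 𝓢(E, ℂ), Integrable (fun x => ψ x * f x) volume ∧ u ψ = ∫ x, ψ x * f x

/-- The `L^p(S)` norm of a tempered distribution on `E`: the `L^p(S)` norm of the function that
represents it, and `∞` if it is not a function. -/
def lpNormOn {E : Type} [NormedAddCommGroup E] [NormedSpace ℝ E] [MeasureSpace E]
    (S : Set E) (p : ℝ≥0∞) (u : 𝓢'(E, ℂ)) : ℝ≥0∞ :=
  ⨅ (f : E → ℂ) (_ : RepresentedBy u f), eLpNorm f p (volume.restrict S)

/-! ### Periodic distributions and their Fourier coefficients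

A distribution on `ℝ²` times the circle is the same thing as a tempered distribution on `ℝ³` that
is `2π`-periodic in `z`. -/

/-- `u` is `2π`-periodic with respect to the third variable. -/
def ZPeriodic (u : 𝓢'(Space, ℂ)) : Prop :=
  ∀ ψ : 𝓢(Space, ℂ),
    u (SchwartzMap.compSubConstCLM ℂ (EuclideanSpace.single (2 : Fin 3) (2 * Real.pi)) ψ) = u ψ

/-- The smooth function `ρ`, supported in `[-2π, 2π]`, whose `2π`-translates sum to `1`. -/
def periodCutoff (z : ℝ) : ℝ :=
  Real.smoothTransition (z / (2 * Real.pi) + 1) - Real.smoothTransition (z / (2 * Real.pi))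

/-- The function `z ↦ ρ(z) e^{-inz}`. -/
def modeFun (n : ℤ) (z : ℝ) : ℂ :=
  (periodCutoff z : ℂ) * Complex.exp (-(Complex.I * n * z))

theorem periodCutoff_eq_zero {z : ℝ} (hz : z ∉ Set.Icc (-(2 * Real.pi)) (2 * Real.pi)) :
    periodCutoff z = 0 := by
  have hp : 0 < 2 * Real.pi := by positivity
  rw [Set.mem_Icc, not_and_or, not_le, not_le] at hz
  unfold periodCutoff
  rcases hz with h | h
  · have h1 : z / (2 * Real.pi) < -1 := by rw [div_lt_iff₀ hp]; linarith
    rw [Real.smoothTransition.zero_of_nonpos (by linarith),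
      Real.smoothTransition.zero_of_nonpos (by linarith), sub_zero]
  · have h1 : 1 < z / (2 * Real.pi) := by rw [lt_div_iff₀ hp]; linarith
    rw [Real.smoothTransition.one_of_one_le (by linarith),
      Real.smoothTransition.one_of_one_le (by linarith), sub_self]

/-- The `2π`-translates of the cutoff form a partition of unity on `ℝ`. -/
theorem periodCutoff_hasSum (z : ℝ) :
    HasSum (fun k : ℤ => periodCutoff (z + 2 * Real.pi * k)) 1 := by
  have hp : 2 * Real.pi ≠ 0 := by positivity
  set t : ℝ := z / (2 * Real.pi) with ht
  have key : ∀ k : ℤ, periodCutoff (z + 2 * Real.pi * k)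
      = Real.smoothTransition (t + k + 1) - Real.smoothTransition (t + k) := by
    intro k
    have : (z + 2 * Real.pi * k) / (2 * Real.pi) = t + k := by rw [ht]; field_simp
    rw [periodCutoff, this]
  simp only [key]
  have h0 := Int.floor_le t
  have h1 := Int.lt_floor_add_one t
  have hsum : (1 : ℝ) = ∑ k ∈ ({-⌊t⌋ - 1, -⌊t⌋} : Finset ℤ),
      (Real.smoothTransition (t + k + 1) - Real.smoothTransition (t + k)) := by
    rw [Finset.sum_pair (by omega)]
    push_cast
    rw [Real.smoothTransition.zero_of_nonpos (x := t + (-(⌊t⌋ : ℝ) - 1)) (by linarith),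
      Real.smoothTransition.one_of_one_le (x := t + -(⌊t⌋ : ℝ) + 1) (by linarith),
      show t + (-(⌊t⌋ : ℝ) - 1) + 1 = t + -(⌊t⌋ : ℝ) by ring]
    ring
  suffices H : ∀ k ∉ ({-⌊t⌋ - 1, -⌊t⌋} : Finset ℤ),
      Real.smoothTransition (t + k + 1) - Real.smoothTransition (t + k) = 0 by
    have := hasSum_sum_of_ne_finset_zero (L := SummationFilter.unconditional ℤ) H
    rwa [← hsum] at this
  intro k hk
  simp only [Finset.mem_insert, Finset.mem_singleton, not_or] at hk
  rcases lt_or_ge k (-⌊t⌋) with h | h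
  · have : k + 2 ≤ -⌊t⌋ := by omega
    have : (k : ℝ) + 2 ≤ -(⌊t⌋ : ℝ) := by exact_mod_cast this
    rw [Real.smoothTransition.zero_of_nonpos (by linarith),
      Real.smoothTransition.zero_of_nonpos (by linarith), sub_zero]
  · have : -⌊t⌋ + 1 ≤ k := by omega
    have : -(⌊t⌋ : ℝ) + 1 ≤ k := by exact_mod_cast this
    rw [Real.smoothTransition.one_of_one_le (by linarith),
      Real.smoothTransition.one_of_one_le (by linarith), sub_self]

theorem modeFun_hasCompactSupport (n : ℤ) : HasCompactSupport (modeFun n) :=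
  HasCompactSupport.intro (K := Set.Icc (-(2 * Real.pi)) (2 * Real.pi)) isCompact_Icc fun z hz => by
    simp [modeFun, periodCutoff_eq_zero hz]

theorem modeFun_contDiff (n : ℤ) : ContDiff ℝ (⊤ : ℕ∞) (modeFun n) := by
  have h : ContDiff ℝ (⊤ : ℕ∞) periodCutoff :=
    (Real.smoothTransition.contDiff.comp (by fun_prop)).sub
      (Real.smoothTransition.contDiff.comp (by fun_prop))
  have h' : ContDiff ℝ (⊤ : ℕ∞) (fun z : ℝ => (periodCutoff z : ℂ)) :=
    Complex.ofRealCLM.contDiff.comp h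
  have h'' : ContDiff ℝ (⊤ : ℕ∞) (fun z : ℝ => (z : ℂ)) := Complex.ofRealCLM.contDiff
  exact h'.mul (by fun_prop)

/-- `z ↦ ρ(z) e^{-inz}` as a Schwartz function. -/
def modeTest (n : ℤ) : 𝓢(ℝ, ℂ) :=
  (modeFun_hasCompactSupport n).toSchwartzMap (modeFun_contDiff n)

theorem norm_le_horiz_vert (x : Space) : 1 + ‖x‖ ≤ (1 + ‖horiz x‖) * (1 + ‖vert x‖) := by
  have h : ‖x‖ ≤ ‖horiz x‖ + ‖vert x‖ := by
    have h1 : ‖horiz x‖ ^ 2 = x 0 ^ 2 + x 1 ^ 2 := by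
      simp [EuclideanSpace.norm_sq_eq, Fin.sum_univ_two, horiz]
    have h2 : ‖vert x‖ ^ 2 = x 2 ^ 2 := by simp [vert]
    have h3 : ‖x‖ ^ 2 = x 0 ^ 2 + x 1 ^ 2 + x 2 ^ 2 := by
      simp [EuclideanSpace.norm_sq_eq, Fin.sum_univ_three]
    refine abs_le_of_sq_le_sq' ?_ (by positivity) |>.2
    nlinarith [mul_nonneg (norm_nonneg (horiz x)) (norm_nonneg (vert x))]
  nlinarith [mul_nonneg (norm_nonneg (horiz x)) (norm_nonneg (vert x))]

theorem norm_iteratedFDeriv_comp_clm_le {E F : Type} [NormedAddCommGroup E] [NormedSpace ℝ E]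
    [NormedAddCommGroup F] [NormedSpace ℝ F] (L : E →L[ℝ] F) {f : F → ℂ} {n i : ℕ}
    (hf : ContDiff ℝ n f) (hi : i ≤ n) (x : E) :
    ‖iteratedFDeriv ℝ i (f ∘ L) x‖ ≤ ‖iteratedFDeriv ℝ i f (L x)‖ * ‖L‖ ^ i := by
  rw [L.iteratedFDeriv_comp_right hf x (by exact_mod_cast hi)]
  refine (ContinuousMultilinearMap.norm_compContinuousLinearMap_le _ _).trans_eq ?_
  simp

/-- For fixed `g`, the map that sends `f` to the function `(x, y, z) ↦ f(x, y) g(z)`. -/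
def tensorCLM (g : 𝓢(ℝ, ℂ)) : 𝓢(Plane, ℂ) →L[ℂ] 𝓢(Space, ℂ) :=
  SchwartzMap.mkCLM (fun f x => f (horiz x) * g (vert x))
    (fun f₁ f₂ x => by simp [add_mul])
    (fun c f x => by simp [mul_assoc])
    (fun f => by
      have hf := f.smooth ⊤
      have hg := g.smooth ⊤
      exact (hf.comp horiz.contDiff).mul (hg.comp vert.contDiff))
    (by
      rintro ⟨k, n⟩
      let S : ℝ := ((Finset.Iic (k, n)).sup fun m => SchwartzMap.seminorm ℂ m.1 m.2) g
      refine ⟨Finset.Iic (k, n), ∑ i ∈ Finset.range (n + 1),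
        (n.choose i : ℝ) * (2 ^ k * ‖horiz‖ ^ i) * (2 ^ k * S * ‖vert‖ ^ (n - i)), ?_, ?_⟩
      · exact Finset.sum_nonneg fun i _ => by
          have : 0 ≤ S := apply_nonneg _ _
          positivity
      intro f x
      let T : ℝ := ((Finset.Iic (k, n)).sup (schwartzSeminormFamily ℂ Plane ℂ)) f
      have hf : ContDiff ℝ n f := f.smooth n
      have hg : ContDiff ℝ n g := g.smooth n
      have hm := norm_iteratedFDeriv_mul_le (𝕜 := ℝ) (hf.comp horiz.contDiff)
        (hg.comp vert.contDiff) x (n := n) le_rfl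
      have hx : ‖x‖ ^ k ≤ (1 + ‖horiz x‖) ^ k * (1 + ‖vert x‖) ^ k := by
        rw [← mul_pow]
        exact pow_le_pow_left₀ (norm_nonneg x) (by linarith [norm_le_horiz_vert x]) k
      refine (mul_le_mul hx hm (norm_nonneg _) (by positivity)).trans ?_
      rw [Finset.mul_sum, Finset.sum_mul]
      refine Finset.sum_le_sum fun i hi => ?_
      have hin : i ≤ n := Nat.lt_succ_iff.mp (Finset.mem_range.mp hi)
      have e1 := norm_iteratedFDeriv_comp_clm_le horiz hf hin x
      have e2 := norm_iteratedFDeriv_comp_clm_le vert hg (Nat.sub_le n i) x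
      have b1 : (1 + ‖horiz x‖) ^ k * ‖iteratedFDeriv ℝ i f (horiz x)‖ ≤ 2 ^ k * T :=
        SchwartzMap.one_add_le_sup_seminorm_apply (𝕜 := ℂ) (m := (k, n)) le_rfl hin f (horiz x)
      have b2 : (1 + ‖vert x‖) ^ k * ‖iteratedFDeriv ℝ (n - i) g (vert x)‖ ≤ 2 ^ k * S :=
        SchwartzMap.one_add_le_sup_seminorm_apply (𝕜 := ℂ) (m := (k, n)) le_rfl
          (Nat.sub_le n i) g (vert x)
      have c1 : (1 + ‖horiz x‖) ^ k * ‖iteratedFDeriv ℝ i (f ∘ horiz) x‖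
          ≤ 2 ^ k * T * ‖horiz‖ ^ i := by
        refine (mul_le_mul_of_nonneg_left e1 (by positivity)).trans ?_
        rw [← mul_assoc]
        exact mul_le_mul_of_nonneg_right b1 (by positivity)
      have c2 : (1 + ‖vert x‖) ^ k * ‖iteratedFDeriv ℝ (n - i) (g ∘ vert) x‖
          ≤ 2 ^ k * S * ‖vert‖ ^ (n - i) := by
        refine (mul_le_mul_of_nonneg_left e2 (by positivity)).trans ?_
        rw [← mul_assoc]
        exact mul_le_mul_of_nonneg_right b2 (by positivity)
      calc _ = (n.choose i : ℝ) * (((1 + ‖horiz x‖) ^ k * ‖iteratedFDeriv ℝ i (f ∘ horiz) x‖) *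
              ((1 + ‖vert x‖) ^ k * ‖iteratedFDeriv ℝ (n - i) (g ∘ vert) x‖)) := by ring
        _ ≤ (n.choose i : ℝ) * ((2 ^ k * T * ‖horiz‖ ^ i) * (2 ^ k * S * ‖vert‖ ^ (n - i))) :=
            mul_le_mul_of_nonneg_left
              (mul_le_mul c1 c2 (by positivity) ((by positivity : (0 : ℝ) ≤ _).trans c1))
              (by positivity)
        _ = _ := by ring)

theorem tensorCLM_apply (g : 𝓢(ℝ, ℂ)) (f : 𝓢(Plane, ℂ)) (x : Space) :
    tensorCLM g f x = f (horiz x) * g (vert x) := rfl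

/-- The `n`-th Fourier coefficient in `z` of a distribution on `ℝ³` that is `2π`-periodic in `z`,
`u_n = (1/2π) ∫_{-π}^{π} u(·, ·, z) e^{-inz} dz`, as a tempered distribution on `ℝ²`:
`⟨u_n, f⟩ = (1/2π) ⟨u, f(x, y) ρ(z) e^{-inz}⟩`. As `u` is periodic and the `2π`-translates of `ρ`
sum to `1`, the pairing with `ρ(z)` over `ℝ` is the integral over one period. -/
def zFourierCoeff (n : ℤ) (u : 𝓢'(Space, ℂ)) : 𝓢'(Plane, ℂ) :=
  ((1 / (2 * Real.pi) : ℝ) : ℂ) • PointwiseConvergenceCLM.precomp ℂ (tensorCLM (modeTest n)) u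

/-! ### Littlewood-Paley decomposition in the horizontal variables -/

/-- `φ` generates a homogeneous dyadic partition of unity on `ℝ²`. -/
structure IsDyadicPartition (φ : 𝓢(Plane, ℂ)) : Prop where
  support_subset : Function.support φ ⊆ {ξ | 3 / 4 ≤ ‖ξ‖ ∧ ‖ξ‖ ≤ 8 / 3}
  hasSum_one : ∀ ξ : Plane, ξ ≠ 0 → HasSum (fun q : ℤ => φ ((2 : ℝ) ^ (-q) • ξ)) 1

/-- `Δ̇_q = φ(2^{-q} D)` on `𝓢'(ℝ²)`, `D = -i∇`. In Mathlib's normalization of the Fourier transform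
the symbol of `D` is `2πξ`. -/
def blockPlane (φ : 𝓢(Plane, ℂ)) (q : ℤ) : 𝓢'(Plane, ℂ) →L[ℂ] 𝓢'(Plane, ℂ) :=
  TemperedDistribution.fourierMultiplierCLM ℂ
    (fun ξ => φ ((2 : ℝ) ^ (-q) • (2 * Real.pi) • ξ))

/-- `Δ̇_q = φ(2^{-q} D_h)`, acting in the horizontal variables only, on distributions on `ℝ³`. -/
def blockSpace (φ : 𝓢(Plane, ℂ)) (q : ℤ) : 𝓢'(Space, ℂ) →L[ℂ] 𝓢'(Space, ℂ) :=
  TemperedDistribution.fourierMultiplierCLM ℂ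
    (fun ξ => φ ((2 : ℝ) ^ (-q) • (2 * Real.pi) • horiz ξ))

/-- The series `Ṡ_q u = ∑_{j ≤ q - 1} Δ̇_j u` converges in `𝓢'`. -/
def LowFreqSummable (φ : 𝓢(Plane, ℂ)) (q : ℤ) (u : 𝓢'(Space, ℂ)) : Prop :=
  Summable (fun j : Set.Iic (q - 1) => blockSpace φ j u)

/-- `Ṡ_q u = ∑_{j ≤ q - 1} Δ̇_j u`, the sum being taken in `𝓢'`. -/
def lowFreq (φ : 𝓢(Plane, ℂ)) (q : ℤ) (u : 𝓢'(Space, ℂ)) : 𝓢'(Space, ℂ) :=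
  ∑' j : Set.Iic (q - 1), blockSpace φ j u

/-- The norm of `Ḃ^0_{p,1}(ℝ²)`: `∑_q ‖Δ̇_q u‖_{L^p(ℝ²)}`. -/
def besovPlane (φ : 𝓢(Plane, ℂ)) (p : ℝ≥0∞) (u : 𝓢'(Plane, ℂ)) : ℝ≥0∞ :=
  ∑' q : ℤ, lpNormOn Set.univ p (blockPlane φ q u)

/-- The Besov norm for distributions that are periodic in `z`: `∑_n ‖u_n‖_{Ḃ^0_{p,1}(ℝ²)}`; for a
vector or matrix field the norms of the components are added. -/
def besovStrip (φ : 𝓢(Plane, ℂ)) (p : ℝ≥0∞) {ι : Type} [Fintype ι] (F : ι → 𝓢'(Space, ℂ)) :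
    ℝ≥0∞ :=
  ∑ i, ∑' n : ℤ, besovPlane φ p (zFourierCoeff n (F i))

/-- The norm of `L^p(ℝ² × ]-π, π[)`; for a vector or matrix field the norms of the components are
added. -/
def lpStrip (p : ℝ≥0∞) {ι : Type} [Fintype ι] (F : ι → 𝓢'(Space, ℂ)) : ℝ≥0∞ :=
  ∑ i, lpNormOn strip p (F i)

/-! ### Vector fields -/

/-- The distributional partial derivative `∂_i`. -/
def pderiv (i : Fin 3) (u : 𝓢'(Space, ℂ)) : 𝓢'(Space, ℂ) :=
  ∂_{(EuclideanSpace.single i (1 : ℝ) : Space)} u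

/-- `div v = 0`. -/
def DivFree (v : Fin 3 → 𝓢'(Space, ℂ)) : Prop := ∑ i, pderiv i (v i) = 0

/-- `Ω = curl v`. -/
def curl (v : Fin 3 → 𝓢'(Space, ℂ)) : Fin 3 → 𝓢'(Space, ℂ) :=
  ![pderiv 1 (v 2) - pderiv 2 (v 1),
    pderiv 2 (v 0) - pderiv 0 (v 2),
    pderiv 0 (v 1) - pderiv 1 (v 0)]

/-- The horizontal gradient `∇_h v = (∂_x v, ∂_y v)`, a `2 × 3` matrix field. -/
def gradH (v : Fin 3 → 𝓢'(Space, ℂ)) : Fin 2 × Fin 3 → 𝓢'(Space, ℂ) :=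
  fun a => pderiv (Fin.castSucc a.1) (v a.2)

end

end StripBesov

open StripBesov

open scoped SchwartzMap ENNReal NNReal LineDeriv
open MeasureTheory

namespace StripBesov

noncomputable section

open Filter Topology FourierTransform TemperedDistribution

/-! ### Distributions that are functions, and their `L^p` norms -/

section Representation

variable {E : Type} [NormedAddCommGroup E] [InnerProductSpace ℝ E] [FiniteDimensional ℝ E]
  [MeasurableSpace E] [BorelSpace E]

namespace RepresentedBy

variable {u v : 𝓢'(E, ℂ)} {f g : E → ℂ}

/-! Since `div v = 0`, the Biot-Savart law `Δv = -curl Ω` recovers `∂_k v` from `Ω` through the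
symbols `ξ_k ξ_l / |ξ|²`. When the horizontal frequency is confined to an annulus, `|ξ|² ≥ |ξ_h|²`
stays away from `0`. The heart of the first two claims is that for horizontal `k` the localized
symbol is the Fourier transform of an integrable kernel (`exists_resolvent_symbol`). Dilation
preserves the `L¹` norm of kernels, so the bound is the same for every dyadic block
(`exists_inverse_laplacian_symbol`), and Young's inequality in `L^∞` finishes
(`lpNormOn_top_gradient_le`).

Integrability is seen by undoing the vertical transform alone: with `η = ξ_h`, the factors
`|η|/|ξ|²` and `ξ_3/|ξ|²` come from multiples of `e^{-2π|η||z|}` and `sgn(z) e^{-2π|η||z|}`. For `η`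
in an annulus these decay in `z`, and the remaining horizontal inverse transform has `L¹` norm
`O(1/(1+z²))` (`exists_lintegral_fourierInv_exp_le`). The index `k` has to be horizontal:
`ξ_3²/|ξ|²` would put a Dirac mass at `z = 0`.

For the Besov bound, the `n`-th Fourier coefficient in `z` sees symbols restricted to the plane `ξ_3
= n/(2π)`. Restriction is a ring homomorphism, so the Biot-Savart identity survives, and it does not
increase the `L¹` norm of kernels (`isWienerSymbol_slice`). The block bound holds for all `j`
without loss; the factor `2^{j/2}` is only a weakening.

For low frequencies, `1 = (1-∂_z²)⁻¹ - ∂_z(1-∂_z²)⁻¹ ∂_z` writes `v` as exponentially decaying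
vertical kernels applied to `v` and `∂_z v`. The curl and divergence equations trade `∂_z v` for
components of `Ω` and horizontal derivatives of `v`, which are harmless on blocks with `j ≤ 0`. The
two-dimensional Bernstein inequality from `L²` to `L^∞` costs `2^j`
(`exists_lpNormOn_top_block_le`), which is summable over `j ≤ -1`. -/

theorem locallyIntegrable (h : RepresentedBy u f) : LocallyIntegrable f volume := by
  intro x
  obtain ⟨χ, hχ⟩ : ∃ χ : ContDiffBump x, True := ⟨⟨1, 2, one_pos, one_lt_two⟩, trivial⟩
  have hc : HasCompactSupport (Complex.ofRealCLM ∘ χ) := χ.hasCompactSupport.comp_left rfl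
  have hs : ContDiff ℝ (⊤ : ℕ∞) (Complex.ofRealCLM ∘ χ) :=
    Complex.ofRealCLM.contDiff.comp χ.contDiff
  refine ⟨Metric.ball x χ.rIn, Metric.ball_mem_nhds x χ.rIn_pos, ?_⟩
  have hi := ((h.2 (hc.toSchwartzMap hs)).1).integrableOn (s := Metric.ball x χ.rIn)
  refine hi.congr_fun (fun y hy => ?_) measurableSet_ball
  have : χ y = 1 := χ.one_of_mem_closedBall (Metric.ball_subset_closedBall hy)
  simp [this]

/-- Smooth compactly supported functions separate locally integrable functions. Hence the infimum in
`lpNormOn` ranges over one almost-everywhere class and is the norm of any representative. -/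
theorem ae_eq (hf : RepresentedBy u f) (hg : RepresentedBy u g) : f =ᵐ[volume] g := by
  refine ae_eq_of_integral_contDiff_smul_eq hf.locallyIntegrable hg.locallyIntegrable ?_
  intro χ hχ hc
  have hc' : HasCompactSupport (Complex.ofRealCLM ∘ χ) := hc.comp_left rfl
  have hs : ContDiff ℝ (⊤ : ℕ∞) (Complex.ofRealCLM ∘ χ) := Complex.ofRealCLM.contDiff.comp hχ
  have h1 := (hf.2 (hc'.toSchwartzMap hs)).2
  rw [(hg.2 (hc'.toSchwartzMap hs)).2] at h1
  simpa using h1.symm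

theorem add (hf : RepresentedBy u f) (hg : RepresentedBy v g) :
    RepresentedBy (u + v) (f + g) := by
  refine ⟨hf.1.add hg.1, fun ψ => ?_⟩
  have h := (hf.2 ψ).1.add (hg.2 ψ).1
  have e : (fun x => ψ x * (f + g) x) = (fun x => ψ x * f x) + fun x => ψ x * g x := by
    ext x; simp [mul_add]
  refine ⟨e ▸ h, ?_⟩
  rw [e, integral_add' (hf.2 ψ).1 (hg.2 ψ).1, ← (hf.2 ψ).2, ← (hg.2 ψ).2]
  rfl

theorem const_smul (c : ℂ) (hf : RepresentedBy u f) : RepresentedBy (c • u) (c • f) := by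
  refine ⟨hf.1.const_smul c, fun ψ => ?_⟩
  have e : (fun x => ψ x * (c • f) x) = fun x => c * (ψ x * f x) := by
    ext x; simp [mul_left_comm]
  refine ⟨e ▸ (hf.2 ψ).1.const_mul c, ?_⟩
  rw [e, integral_const_mul, ← (hf.2 ψ).2]
  rfl

theorem lpNormOn_eq (hf : RepresentedBy u f) (S : Set E) (p : ℝ≥0∞) :
    lpNormOn S p u = eLpNorm f p (volume.restrict S) := by
  refine le_antisymm (iInf₂_le f hf) (le_iInf₂ fun g hg => ?_)
  exact (eLpNorm_congr_ae (ae_restrict_of_ae (hf.ae_eq hg))).le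

end RepresentedBy

theorem exists_representedBy_of_lpNormOn_lt_top {S : Set E} {p : ℝ≥0∞} {u : 𝓢'(E, ℂ)}
    (h : lpNormOn S p u < ∞) : ∃ f, RepresentedBy u f := by
  by_contra! hu
  refine h.ne ?_
  simp [lpNormOn, hu]

theorem lpNormOn_mono {S T : Set E} (hST : S ⊆ T) (p : ℝ≥0∞) (u : 𝓢'(E, ℂ)) :
    lpNormOn S p u ≤ lpNormOn T p u :=
  iInf₂_mono fun _ _ => eLpNorm_mono_measure _ (Measure.restrict_mono hST le_rfl)

theorem lpNormOn_add_le (S : Set E) {p : ℝ≥0∞} (hp : 1 ≤ p) (u v : 𝓢'(E, ℂ)) :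
    lpNormOn S p (u + v) ≤ lpNormOn S p u + lpNormOn S p v := by
  rcases eq_or_ne (lpNormOn S p u) ∞ with hu | hu
  · simp [hu]
  rcases eq_or_ne (lpNormOn S p v) ∞ with hv | hv
  · simp [hv]
  obtain ⟨f, hf⟩ := exists_representedBy_of_lpNormOn_lt_top hu.lt_top
  obtain ⟨g, hg⟩ := exists_representedBy_of_lpNormOn_lt_top hv.lt_top
  rw [hf.lpNormOn_eq, hg.lpNormOn_eq, (hf.add hg).lpNormOn_eq]
  exact eLpNorm_add_le hf.1.restrict hg.1.restrict hp

theorem lpNormOn_smul_le (S : Set E) (p : ℝ≥0∞) {c : ℂ} (hc : c ≠ 0) (u : 𝓢'(E, ℂ)) :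
    lpNormOn S p (c • u) ≤ ‖c‖ₑ * lpNormOn S p u := by
  rcases eq_or_ne (lpNormOn S p u) ∞ with hu | hu
  · simp [hu, ENNReal.mul_top, hc]
  obtain ⟨f, hf⟩ := exists_representedBy_of_lpNormOn_lt_top hu.lt_top
  rw [hf.lpNormOn_eq, (hf.const_smul c).lpNormOn_eq]
  exact eLpNorm_const_smul_le

theorem lpNormOn_neg (S : Set E) (p : ℝ≥0∞) (u : 𝓢'(E, ℂ)) :
    lpNormOn S p (-u) = lpNormOn S p u := by
  have key : ∀ w : 𝓢'(E, ℂ), lpNormOn S p (-w) ≤ lpNormOn S p w := fun w => by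
    have h := lpNormOn_smul_le S p (neg_ne_zero.2 (one_ne_zero (α := ℂ))) w
    have e : (-1 : ℂ) • w = -w := by ext ψ; simp
    rwa [e, enorm_neg, enorm_one, one_mul] at h
  exact le_antisymm (key u) (by simpa using key (-u))

theorem lpNormOn_sub_le (S : Set E) {p : ℝ≥0∞} (hp : 1 ≤ p) (u v : 𝓢'(E, ℂ)) :
    lpNormOn S p (u - v) ≤ lpNormOn S p u + lpNormOn S p v := by
  rw [sub_eq_add_neg, ← lpNormOn_neg S p v]
  exact lpNormOn_add_le S hp u (-v)

theorem exists_representedBy_of_bounded {f : E → ℂ} (hf : AEStronglyMeasurable f volume)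
    {M : ℝ} (hM : ∀ᵐ x, ‖f x‖ ≤ M) : ∃ u : 𝓢'(E, ℂ), RepresentedBy u f := by
  have hL : MemLp f ∞ volume := memLp_top_of_bound hf M hM
  refine ⟨(Lp.toTemperedDistribution (hL.toLp f)), hf, fun ψ => ⟨?_, ?_⟩⟩
  · exact ψ.integrable.mul_bdd hf hM
  · rw [Lp.toTemperedDistribution_apply]
    refine integral_congr_ae ?_
    filter_upwards [hL.coeFn_toLp] with x hx
    rw [hx, smul_eq_mul]

/-- A series of bounded functions whose sup norms are summable converges in `𝓢'`. -/
theorem summable_of_lpNormOn_top_le {ι : Type} [Countable ι] {u : ι → 𝓢'(E, ℂ)} {B : ι → ℝ≥0∞}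
    (hu : ∀ i, lpNormOn Set.univ ∞ (u i) ≤ B i) (hB : ∑' i, B i ≠ ∞) :
    Summable u ∧ lpNormOn Set.univ ∞ (∑' i, u i) ≤ ∑' i, B i := by
  have hBi : ∀ i, B i < ∞ := fun i => (ENNReal.le_tsum i).trans_lt hB.lt_top
  choose f hf using fun i => exists_representedBy_of_lpNormOn_lt_top ((hu i).trans_lt (hBi i))
  have hbd : ∀ᵐ x, ∀ i, ‖f i x‖ₑ ≤ B i := by
    rw [ae_all_iff]
    intro i
    have h := hu i
    rw [(hf i).lpNormOn_eq, Measure.restrict_univ, eLpNorm_exponent_top] at h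
    filter_upwards [ae_le_eLpNormEssSup (f := f i) (μ := volume)] with x hx using hx.trans h
  have hBs : Summable fun i => (B i).toReal := ENNReal.summable_toReal hB
  have hbd' : ∀ᵐ x, ∀ i, ‖f i x‖ ≤ (B i).toReal := by
    filter_upwards [hbd] with x hx i
    rw [← toReal_enorm]
    exact ENNReal.toReal_mono (hBi i).ne (hx i)
  -- The sum in `𝓢'` is identified as the pointwise almost-everywhere sum, by integrating termwise
  -- against a test function.
  set g : E → ℂ := fun x => ∑' i, f i x with hg
  have hgm : AEStronglyMeasurable g volume := by
    have : ∀ i, AEStronglyMeasurable (f i) volume := fun i => (hf i).1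
    refine ⟨fun x => ∑' i, (this i).mk _ x, ?_, ?_⟩
    · exact StronglyMeasurable.tsum fun i => (this i).stronglyMeasurable_mk
    · filter_upwards [ae_all_iff.2 fun i => (this i).ae_eq_mk] with x hx
      simp only [hg, hx]
  have hgb : ∀ᵐ x, ‖g x‖ ≤ ∑' i, (B i).toReal := by
    filter_upwards [hbd'] with x hx
    exact tsum_of_norm_bounded hBs.hasSum hx
  obtain ⟨w, hw⟩ := exists_representedBy_of_bounded hgm hgb
  have hsum : HasSum u w := by
    rw [HasSum, PointwiseConvergenceCLM.tendsto_iff_forall_tendsto]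
    intro ψ
    have hint : ∀ i, Integrable (fun x => ψ x * f i x) volume := fun i => ((hf i).2 ψ).1
    have hnorm : Summable fun i => ∫ x, ‖ψ x * f i x‖ := by
      refine Summable.of_nonneg_of_le (fun i => integral_nonneg fun x => norm_nonneg _)
        (fun i => ?_) (hBs.mul_left (∫ x, ‖ψ x‖))
      rw [← integral_mul_const]
      refine integral_mono_ae (hint i).norm (ψ.integrable.norm.mul_const _) ?_
      filter_upwards [hbd'] with x hx
      simp only [norm_mul]
      gcongr
      exact hx i
    have h := hasSum_integral_of_summable_integral_norm hint hnorm
    have e1 : ∀ i, ∫ x, ψ x * f i x = u i ψ := fun i => ((hf i).2 ψ).2.symm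
    have e2 : ∫ x, ∑' i, ψ x * f i x = w ψ := by
      rw [(hw.2 ψ).2]
      exact integral_congr_ae (Eventually.of_forall fun x => tsum_mul_left)
    rw [e2] at h
    simp only [e1] at h
    simpa [HasSum] using h
  refine ⟨hsum.summable, ?_⟩
  rw [hsum.tsum_eq, hw.lpNormOn_eq, Measure.restrict_univ, eLpNorm_exponent_top]
  refine eLpNormEssSup_le_of_ae_enorm_bound ?_
  filter_upwards [hgb] with x hx
  rw [← ofReal_norm]
  refine (ENNReal.ofReal_le_ofReal hx).trans ?_
  rw [← ENNReal.tsum_toReal_eq fun i => (hBi i).ne, ENNReal.ofReal_toReal hB]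

end Representation

/-! ### Fourier multipliers with integrable kernels -/

section Convolution

variable {E : Type} [NormedAddCommGroup E] [InnerProductSpace ℝ E] [FiniteDimensional ℝ E]
  [MeasurableSpace E] [BorelSpace E]

theorem fourier_smulLeft_fourierInv_apply {m : E → ℂ} (hm : m.HasTemperateGrowth) (ψ : 𝓢(E, ℂ))
    (y : E) :
    (𝓕 (SchwartzMap.smulLeftCLM ℂ m (𝓕⁻ ψ)) : 𝓢(E, ℂ)) y =
      ∫ ξ, Real.fourierChar (-inner ℝ ξ y) • (m ξ * (𝓕⁻ ψ : 𝓢(E, ℂ)) ξ) := by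
  rw [SchwartzMap.fourier_coe, Real.fourier_eq]
  simp only [SchwartzMap.smulLeftCLM_apply_apply hm, smul_eq_mul]

/-- If `m` is the Fourier transform of an integrable function `K`, the transpose of the Fourier
multiplier with symbol `m` is an integral operator. -/
theorem fourier_smulLeft_fourierInv_eq_integral {m K : E → ℂ} (hm : m.HasTemperateGrowth)
    (hK : Integrable K) (hmK : ∀ ξ, 𝓕 K ξ = m ξ) (ψ : 𝓢(E, ℂ)) (y : E) :
    (𝓕 (SchwartzMap.smulLeftCLM ℂ m (𝓕⁻ ψ)) : 𝓢(E, ℂ)) y = ∫ w, K w * ψ (y + w) := by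
  rw [fourier_smulLeft_fourierInv_apply hm]
  set g : E → ℂ := fun ξ => Real.fourierChar (-inner ℝ ξ y) • (𝓕⁻ ψ : 𝓢(E, ℂ)) ξ with hg
  have hgi : Integrable g := by
    have h := (Real.fourierIntegral_convergent_iff (μ := volume) (f := ⇑(𝓕⁻ ψ : 𝓢(E, ℂ))) y).2
      (𝓕⁻ ψ : 𝓢(E, ℂ)).integrable
    exact h
  -- The multiplication formula moves the transform from `K` to `g`, whose transform is a translate
  -- of `ψ`.
  have h1 : ∫ ξ, 𝓕 K ξ • g ξ = ∫ w, K w • 𝓕 g w := by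
    simpa using! (VectorFourier.integral_fourierIntegral_smul_eq_flip (L := innerₗ E)
      Real.continuous_fourierChar continuous_inner hK hgi)
  have h2 : ∀ w, 𝓕 g w = ψ (y + w) := by
    intro w
    have h3 : (𝓕 (𝓕⁻ ψ : 𝓢(E, ℂ)) : 𝓢(E, ℂ)) (y + w) = ψ (y + w) := by
      rw [FourierTransform.fourier_fourierInv_eq]
    rw [← h3, SchwartzMap.fourier_coe, Real.fourier_eq, Real.fourier_eq]
    refine integral_congr_ae (Eventually.of_forall fun ξ => ?_)
    simp only [hg, smul_smul, ← AddChar.map_add_eq_mul, inner_add_right, neg_add]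
    rw [add_comm]
  simp only [h2] at h1
  simp only [smul_eq_mul] at h1
  rw [← h1]
  refine integral_congr_ae (Eventually.of_forall fun ξ => ?_)
  simp only [hg, hmK, mul_smul_comm]

/-- Fourier multipliers commute with translations. -/
theorem fourier_smulLeft_fourierInv_compSubConst {m : E → ℂ} (hm : m.HasTemperateGrowth)
    (a : E) (ψ : 𝓢(E, ℂ)) :
    (𝓕 (SchwartzMap.smulLeftCLM ℂ m (𝓕⁻ (SchwartzMap.compSubConstCLM ℂ a ψ))) : 𝓢(E, ℂ)) =
      SchwartzMap.compSubConstCLM ℂ a (𝓕 (SchwartzMap.smulLeftCLM ℂ m (𝓕⁻ ψ))) := by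
  have key : ∀ ξ, (𝓕⁻ (SchwartzMap.compSubConstCLM ℂ a ψ) : 𝓢(E, ℂ)) ξ =
      Real.fourierChar (inner ℝ ξ a) • (𝓕⁻ ψ : 𝓢(E, ℂ)) ξ := by
    intro ξ
    rw [SchwartzMap.fourierInv_coe, SchwartzMap.fourierInv_coe, Real.fourierInv_eq,
      Real.fourierInv_eq, Circle.smul_def, ← integral_smul, ← integral_add_right_eq_self _ a]
    refine integral_congr_ae (Eventually.of_forall fun x => ?_)
    simp only [SchwartzMap.compSubConstCLM_apply, add_sub_cancel_right, inner_add_left]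
    rw [add_comm, real_inner_comm ξ a, AddChar.map_add_eq_mul, mul_smul]
    rfl
  ext y
  rw [SchwartzMap.compSubConstCLM_apply, fourier_smulLeft_fourierInv_apply hm,
    fourier_smulLeft_fourierInv_apply hm]
  refine integral_congr_ae (Eventually.of_forall fun ξ => ?_)
  simp only [key, inner_sub_right, mul_smul_comm, smul_smul, ← AddChar.map_add_eq_mul]
  congr 2
  ring

/-- Fubini moves the transposed kernel from the test function to `f`. The hypothesis is a uniform
bound on `|K| * |f|`, rather than a norm of `f`, so that it serves both bounded `f` (Young) and `f`
that is only square integrable over a period, against an exponentially decaying kernel. -/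
theorem representedBy_fourierMultiplier {m K f : E → ℂ} {u : 𝓢'(E, ℂ)}
    (hm : m.HasTemperateGrowth) (hK : Integrable K) (hmK : ∀ ξ, 𝓕 K ξ = m ξ)
    (hf : RepresentedBy u f) {M : ℝ≥0∞} (hM : M ≠ ∞)
    (hb : ∀ x, ∫⁻ y, ‖K (x - y)‖ₑ * ‖f y‖ₑ ≤ M) :
    RepresentedBy (fourierMultiplierCLM ℂ m u) (fun x => ∫ y, K (x - y) * f y) := by
  have hKf : AEStronglyMeasurable (fun p : E × E => K (p.1 - p.2) * f p.2)
      ((volume : Measure E).prod volume) := by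
    have h := AEStronglyMeasurable.convolution_integrand (ContinuousLinearMap.mul ℂ ℂ)
      hf.1 hK.1 (μ := (volume : Measure E))
    refine h.congr (Eventually.of_forall fun p => ?_)
    simp [mul_comm]
  have hgm : AEStronglyMeasurable (fun x => ∫ y, K (x - y) * f y) (volume : Measure E) :=
    hKf.integral_prod_right'
  have hgb : ∀ x, ‖∫ y, K (x - y) * f y‖ₑ ≤ M := fun x =>
    (enorm_integral_le_lintegral_enorm _).trans (by simpa only [enorm_mul] using hb x)
  refine ⟨hgm, fun ψ => ⟨?_, ?_⟩⟩
  · refine ψ.integrable.mul_bdd (c := M.toReal) hgm (Eventually.of_forall fun x => ?_)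
    rw [← toReal_enorm]
    exact ENNReal.toReal_mono hM (hgb x)
  · have hint : Integrable (Function.uncurry fun x y : E => ψ x * (K (x - y) * f y))
        ((volume : Measure E).prod volume) := by
      have hmeas : AEStronglyMeasurable (Function.uncurry fun x y : E => ψ x * (K (x - y) * f y))
          ((volume : Measure E).prod volume) := ψ.integrable.1.comp_fst.mul hKf
      refine ⟨hmeas, ?_⟩
      rw [HasFiniteIntegral, lintegral_prod _ hmeas.enorm]
      calc ∫⁻ x, ∫⁻ y, ‖ψ x * (K (x - y) * f y)‖ₑ
          ≤ ∫⁻ x, ‖ψ x‖ₑ * M := by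
            refine lintegral_mono fun x => ?_
            simp only [enorm_mul]
            rw [lintegral_const_mul' _ _ enorm_ne_top]
            exact mul_le_mul_right (hb x) _
        _ < ∞ := by
            rw [lintegral_mul_const' _ _ hM]
            exact ENNReal.mul_lt_top ψ.integrable.2 hM.lt_top
    rw [fourierMultiplierCLM_apply_apply, (hf.2 _).2]
    calc ∫ y, (𝓕 (SchwartzMap.smulLeftCLM ℂ m (𝓕⁻ ψ)) : 𝓢(E, ℂ)) y * f y
        = ∫ y, ∫ x, ψ x * (K (x - y) * f y) := by
          refine integral_congr_ae (Eventually.of_forall fun y => ?_)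
          simp only
          rw [fourier_smulLeft_fourierInv_eq_integral hm hK hmK, ← integral_mul_const,
            ← integral_sub_right_eq_self _ y]
          refine integral_congr_ae (Eventually.of_forall fun x => ?_)
          simp only [add_sub_cancel]
          ring
      _ = ∫ x, ∫ y, ψ x * (K (x - y) * f y) := (integral_integral_swap hint).symm
      _ = ∫ x, ψ x * ∫ y, K (x - y) * f y := by simp only [integral_const_mul]

theorem lpNormOn_top_fourierMultiplier_le {m K f : E → ℂ} {u : 𝓢'(E, ℂ)}
    (hm : m.HasTemperateGrowth) (hK : Integrable K) (hmK : ∀ ξ, 𝓕 K ξ = m ξ)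
    (hf : RepresentedBy u f) {M : ℝ≥0∞}
    (hb : ∀ x, ∫⁻ y, ‖K (x - y)‖ₑ * ‖f y‖ₑ ≤ M) :
    lpNormOn Set.univ ∞ (fourierMultiplierCLM ℂ m u) ≤ M := by
  rcases eq_or_ne M ∞ with rfl | hM
  · exact le_top
  rw [(representedBy_fourierMultiplier hm hK hmK hf hM hb).lpNormOn_eq, Measure.restrict_univ,
    eLpNorm_exponent_top]
  refine eLpNormEssSup_le_of_ae_enorm_bound (Eventually.of_forall fun x => ?_)
  exact (enorm_integral_le_lintegral_enorm _).trans (by simpa only [enorm_mul] using hb x)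

/-- `m` is the Fourier transform of an integrable function of integral norm at most `C`. -/
def IsWienerSymbol (C : ℝ≥0∞) (m : E → ℂ) : Prop :=
  ∃ K : E → ℂ, Integrable K ∧ (∀ ξ, 𝓕 K ξ = m ξ) ∧ ∫⁻ x, ‖K x‖ₑ ≤ C

namespace IsWienerSymbol

variable {C : ℝ≥0∞} {m : E → ℂ}

/-- Young's inequality `L¹ * L^∞ ⊆ L^∞`. With `C ≠ 0` the right side is `∞` when `u` has infinite
norm, which settles that case. -/
theorem lpNormOn_top_le (h : IsWienerSymbol C m) (hm : m.HasTemperateGrowth)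
    (hC0 : C ≠ 0) (u : 𝓢'(E, ℂ)) :
    lpNormOn Set.univ ∞ (fourierMultiplierCLM ℂ m u) ≤ C * lpNormOn Set.univ ∞ u := by
  obtain ⟨K, hK, hmK, hKC⟩ := h
  rcases eq_or_ne (lpNormOn Set.univ ∞ u) ∞ with hu | hu
  · simp [hu, ENNReal.mul_top, hC0]
  obtain ⟨f, hf⟩ := exists_representedBy_of_lpNormOn_lt_top hu.lt_top
  refine lpNormOn_top_fourierMultiplier_le hm hK hmK hf fun x => ?_
  rw [hf.lpNormOn_eq, Measure.restrict_univ, eLpNorm_exponent_top]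
  have hfe := ae_le_eLpNormEssSup (f := f) (μ := volume)
  calc ∫⁻ y, ‖K (x - y)‖ₑ * ‖f y‖ₑ
      ≤ ∫⁻ y, ‖K (x - y)‖ₑ * eLpNormEssSup f volume := by
        refine lintegral_mono_ae ?_
        filter_upwards [hfe] with y hy using mul_le_mul_right hy _
    _ ≤ (∫⁻ y, ‖K (x - y)‖ₑ) * eLpNormEssSup f volume := by
        rw [lintegral_mul_const'']
        exact (hK.1.enorm.comp_quasiMeasurePreserving
          (quasiMeasurePreserving_sub_left_of_right_invariant volume x))
    _ ≤ _ := by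
        rw [lintegral_sub_left_eq_self (fun z => ‖K z‖ₑ) x]
        exact mul_le_mul_left hKC _

/-- Dilating the symbol dilates the kernel in the `L¹`-invariant way. This is what makes the bounds
independent of the dyadic index. -/
theorem comp_smul (h : IsWienerSymbol C m) {c : ℝ} (hc : c ≠ 0) :
    IsWienerSymbol C (fun ξ => m (c • ξ)) := by
  obtain ⟨K, hK, hmK, hKC⟩ := h
  set d := Module.finrank ℝ E
  have hcd : |(c ^ d)⁻¹| ≠ 0 := by positivity
  refine ⟨fun x => ((|(c⁻¹ ^ d)| : ℝ) : ℂ) * K (c⁻¹ • x), ?_, fun ξ => ?_, ?_⟩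
  · exact (hK.comp_smul (inv_ne_zero hc)).const_mul _
  · change _ = m (c • ξ)
    rw [← hmK, Real.fourier_eq, Real.fourier_eq]
    have := Measure.integral_comp_smul (volume : Measure E)
      (fun x => Real.fourierChar (-inner ℝ x (c • ξ)) • K x) (c⁻¹)
    have e : ∀ x : E, inner ℝ (c⁻¹ • x) (c • ξ) = (inner ℝ x ξ : ℝ) := by
      intro x; rw [real_inner_smul_left, real_inner_smul_right, ← mul_assoc, inv_mul_cancel₀ hc,
        one_mul]
    simp only [e] at this
    have e' : ∀ (t : Circle) (a b : ℂ), t • (a * b) = a * t • b := fun t a b => by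
      simp only [Circle.smul_def, smul_eq_mul]; ring
    simp only [e']
    rw [integral_const_mul, this]
    rw [Complex.real_smul, ← mul_assoc, ← Complex.ofReal_mul, ← abs_mul, mul_inv_cancel₀
      (pow_ne_zero _ (inv_ne_zero hc))]
    simp
  · refine le_trans (le_of_eq ?_) hKC
    rw [← ofReal_integral_norm_eq_lintegral_enorm hK, ← ofReal_integral_norm_eq_lintegral_enorm
      ((hK.comp_smul (inv_ne_zero hc)).const_mul _)]
    have e : ∀ x : E, ‖((|c⁻¹ ^ d| : ℝ) : ℂ) * K (c⁻¹ • x)‖ = |c⁻¹ ^ d| * ‖K (c⁻¹ • x)‖ := by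
      intro x
      rw [norm_mul, Complex.norm_real, Real.norm_eq_abs, abs_abs]
    simp only [e]
    rw [integral_const_mul, Measure.integral_comp_smul (volume : Measure E) (fun x => ‖K x‖),
      smul_eq_mul, ← mul_assoc, ← abs_mul,
      mul_inv_cancel₀ (pow_ne_zero _ (inv_ne_zero hc)), abs_one, one_mul]

end IsWienerSymbol

end Convolution

/-! ### The splitting of space into horizontal and vertical variables -/

section Geometry

/-- The splitting `ℝ³ ≃ ℝ² × ℝ`, `(x, y, z) ↦ ((x, y), z)`. -/
def splitEquiv : Space ≃ᵐ Plane × ℝ where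
  toFun x := (horiz x, vert x)
  invFun p := !₂[p.1 0, p.1 1, p.2]
  left_inv x := by ext i; fin_cases i <;> simp [horiz, vert]
  right_inv p := by
    refine Prod.ext ?_ ?_
    · ext i; fin_cases i <;> simp [horiz]
    · simp [vert]
  measurable_toFun := by
    exact (horiz.continuous.prodMk vert.continuous).measurable
  measurable_invFun := by
    have h : Continuous fun p : Plane × ℝ => (!₂[p.1 0, p.1 1, p.2] : Space) := by
      fun_prop
    exact h.measurable

theorem splitEquiv_apply (x : Space) : splitEquiv x = (horiz x, vert x) := rfl

theorem horiz_splitEquiv_symm (p : Plane × ℝ) : horiz (splitEquiv.symm p) = p.1 :=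
  congrArg (fun q : Plane × ℝ => q.1) (splitEquiv.apply_symm_apply p)

theorem vert_splitEquiv_symm (p : Plane × ℝ) : vert (splitEquiv.symm p) = p.2 := by
  have h := splitEquiv.apply_symm_apply p
  rw [splitEquiv_apply] at h
  exact (Prod.ext_iff.1 h).2

theorem measurePreserving_splitEquiv :
    MeasurePreserving splitEquiv volume ((volume : Measure Plane).prod (volume : Measure ℝ)) := by
  have h1 := PiLp.volume_preserving_ofLp (Fin 3)
  have h2 := volume_preserving_piFinSuccAbove (fun _ : Fin 3 => ℝ) 2
  have h3 : MeasurePreserving (Prod.map id (@WithLp.toLp 2 (Fin 2 → ℝ)))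
      ((volume : Measure ℝ).prod volume) ((volume : Measure ℝ).prod volume) :=
    (MeasurePreserving.id _).prod (PiLp.volume_preserving_toLp (Fin 2))
  have h4 : MeasurePreserving Prod.swap ((volume : Measure ℝ).prod (volume : Measure Plane))
    (volume.prod volume) := Measure.measurePreserving_swap
  have h := h4.comp (h3.comp (h2.comp h1))
  have e : (splitEquiv : Space → Plane × ℝ) = Prod.swap ∘ Prod.map id (@WithLp.toLp 2 (Fin 2 → ℝ)) ∘
      (MeasurableEquiv.piFinSuccAbove (fun _ : Fin 3 => ℝ) 2) ∘ WithLp.ofLp := by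
    funext x
    refine Prod.ext ?_ ?_
    · ext i; fin_cases i <;> rfl
    · rfl
  rw [e]
  exact h

theorem lintegral_space_eq (F : Plane × ℝ → ℝ≥0∞) :
    ∫⁻ x, F (horiz x, vert x) = ∫⁻ p, F p ∂((volume : Measure Plane).prod volume) :=
  measurePreserving_splitEquiv.lintegral_comp_emb splitEquiv.measurableEmbedding F

theorem integral_space_eq (F : Plane × ℝ → ℂ) :
    ∫ x, F (horiz x, vert x) = ∫ p, F p ∂((volume : Measure Plane).prod volume) :=
  measurePreserving_splitEquiv.integral_comp' F

theorem integrable_space_iff {F : Plane × ℝ → ℂ} :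
    Integrable (fun x => F (horiz x, vert x)) ↔
      Integrable F ((volume : Measure Plane).prod volume) :=
  measurePreserving_splitEquiv.integrable_comp_emb splitEquiv.measurableEmbedding

theorem inner_space_eq (x y : Space) :
    inner ℝ x y = (inner ℝ (horiz x) (horiz y) + inner ℝ (vert x) (vert y) : ℝ) := by
  simp [PiLp.inner_apply, Fin.sum_univ_three, Fin.sum_univ_two, horiz, vert]

theorem norm_sq_space_eq (x : Space) : ‖x‖ ^ 2 = ‖horiz x‖ ^ 2 + vert x ^ 2 := by
  rw [← real_inner_self_eq_norm_sq, inner_space_eq, real_inner_self_eq_norm_sq]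
  simp [sq]

end Geometry

/-! ### Vertical periodicity and the tiling of space by strips -/

section Periodicity

/-- The period vector `(0, 0, 2π)`. -/
def periodVec : Space := EuclideanSpace.single (2 : Fin 3) (2 * Real.pi)

theorem vert_add_zsmul_periodVec (x : Space) (k : ℤ) :
    vert (x + k • periodVec) = vert x + 2 * Real.pi * k := by
  simp [vert, periodVec, mul_comm]

theorem ae_add_zsmul {P : Space → Prop} (h : ∀ᵐ x, P x) (k : ℤ) :
    ∀ᵐ x, P (x + k • periodVec) :=
  (measurePreserving_add_right (volume : Measure Space) (k • periodVec)).quasiMeasurePreserving.ae h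

/-- The translate of `f` by one period represents the same distribution, so uniqueness of
representatives applies. One null set serves all integer multiples, because there are countably
many. -/
theorem RepresentedBy.ae_periodic {u : 𝓢'(Space, ℂ)} {f : Space → ℂ} (hu : ZPeriodic u)
    (hf : RepresentedBy u f) : ∀ᵐ x, ∀ k : ℤ, f (x + k • periodVec) = f x := by
  have hrep : RepresentedBy u (fun x => f (x + periodVec)) := by
    have hmp := measurePreserving_add_right (volume : Measure Space) periodVec
    refine ⟨hf.1.comp_measurePreserving hmp, fun ψ => ?_⟩
    have h := hf.2 (SchwartzMap.compSubConstCLM ℂ periodVec ψ)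
    refine ⟨?_, ?_⟩
    · simpa using h.1.comp_add_right periodVec
    · rw [← hu ψ]
      refine h.2.trans ?_
      rw [← integral_add_right_eq_self _ periodVec]
      simp
  have h1 : ∀ᵐ x, f (x + periodVec) = f x := hrep.ae_eq hf
  have h2 : ∀ᵐ x, ∀ k : ℤ, f (x + k • periodVec + periodVec) = f (x + k • periodVec) :=
    ae_all_iff.2 fun k => ae_add_zsmul h1 k
  filter_upwards [h2] with x hx k
  induction k using Int.induction_on with
  | zero => simp
  | succ n ih => rw [← ih, ← hx n, add_smul, one_smul, add_assoc]
  | pred n ih =>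
    rw [← ih, ← hx, add_assoc, sub_smul, one_smul, sub_add_cancel]

theorem ae_vert_ne {N : Set ℝ} (hN : N.Countable) : ∀ᵐ x : Space, vert x ∉ N := by
  have h1 : ∀ᵐ z : ℝ, z ∉ N := hN.ae_notMem volume
  have h2 : Measure.QuasiMeasurePreserving vert (volume : Measure Space) (volume : Measure ℝ) :=
    Measure.quasiMeasurePreserving_snd.comp measurePreserving_splitEquiv.quasiMeasurePreserving
  exact h2.ae h1

/-- Space is tiled, up to a null set, by the vertical translates of the strip. -/
theorem volume_eq_sum_strip : (volume : Measure Space) =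
    Measure.sum fun k : ℤ => ((volume : Measure Space).restrict strip).map
      (MeasurableEquiv.addRight (k • periodVec)) := by
  have hp := Real.pi_pos
  set tile : ℤ → Set Space := fun k => {x | vert x - 2 * Real.pi * k ∈ Set.Ioo (-Real.pi) Real.pi}
    with htile
  have hmeas : ∀ k, MeasurableSet (tile k) := fun k =>
    measurableSet_Ioo.preimage (vert.continuous.sub continuous_const).measurable
  have hdisj : Pairwise (Function.onFun Disjoint tile) := by
    intro j k hjk
    refine Set.disjoint_left.2 fun x hj hk => hjk ?_
    simp only [htile, Set.mem_ofPred_eq, Set.mem_Ioo] at hj hk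
    have h1 : (j : ℝ) < k + 1 := by nlinarith
    have h2 : (k : ℝ) < j + 1 := by nlinarith
    have h3 : j < k + 1 := by exact_mod_cast h1
    have h4 : k < j + 1 := by exact_mod_cast h2
    omega
  have hcover : ∀ᵐ x : Space, x ∈ ⋃ k, tile k := by
    -- The open tiles miss only these heights, the boundaries between consecutive strips.
    have hN : (Set.range fun k : ℤ => Real.pi + 2 * Real.pi * k).Countable :=
      Set.countable_range _
    filter_upwards [ae_vert_ne hN] with x hx
    obtain ⟨k, hk⟩ : ∃ k : ℤ, k = ⌊(vert x + Real.pi) / (2 * Real.pi)⌋ := ⟨_, rfl⟩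
    have h1 : (k : ℝ) ≤ (vert x + Real.pi) / (2 * Real.pi) := hk ▸ Int.floor_le _
    have h2 : (vert x + Real.pi) / (2 * Real.pi) < k + 1 := hk ▸ Int.lt_floor_add_one _
    rw [le_div_iff₀ (by positivity)] at h1
    rw [div_lt_iff₀ (by positivity)] at h2
    refine Set.mem_iUnion.2 ⟨k, ?_⟩
    simp only [htile, Set.mem_ofPred_eq, Set.mem_Ioo]
    refine ⟨lt_of_le_of_ne (by linarith) fun h => hx ⟨k - 1, ?_⟩, by linarith⟩
    push_cast
    linarith
  have h1 : (volume : Measure Space) = Measure.sum fun k => volume.restrict (tile k) := by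
    rw [← Measure.restrict_iUnion hdisj hmeas, Measure.restrict_eq_self_of_ae_mem hcover]
  refine h1.trans ?_
  congr 1
  funext k
  have hmp := measurePreserving_add_right (volume : Measure Space) (k • periodVec)
  have h := (hmp.restrict_preimage (hmeas k)).map_eq
  rw [← h]
  have hpre : (fun x => x + k • periodVec) ⁻¹' tile k = strip := by
    ext x
    simp only [htile, Set.mem_preimage, Set.mem_ofPred_eq, vert_add_zsmul_periodVec,
      add_sub_cancel_right]
    rfl
  rw [hpre]
  rfl

theorem lintegral_eq_tsum_strip (F : Space → ℝ≥0∞) :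
    ∫⁻ x, F x = ∑' k : ℤ, ∫⁻ x in strip, F (x + k • periodVec) := by
  conv_lhs => rw [volume_eq_sum_strip, lintegral_sum_measure]
  refine tsum_congr fun k => ?_
  rw [lintegral_map_equiv]
  rfl

/-- Convolution estimates live on all of space while the norms in the theorem live on one period;
for sup norms of periodic distributions there is no difference. -/
theorem lpNormOn_top_univ_eq_strip {u : 𝓢'(Space, ℂ)} (hu : ZPeriodic u) :
    lpNormOn Set.univ ∞ u = lpNormOn strip ∞ u := by
  refine le_antisymm (le_iInf₂ fun f hf => ?_) (lpNormOn_mono (Set.subset_univ _) _ _)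
  rw [hf.lpNormOn_eq, Measure.restrict_univ, eLpNorm_exponent_top, eLpNorm_exponent_top]
  refine eLpNormEssSup_le_of_ae_enorm_bound ?_
  generalize hMdef : eLpNormEssSup f ((volume : Measure Space).restrict strip) = M
  rw [volume_eq_sum_strip, Measure.ae_sum_iff]
  intro k
  have hM := ae_le_eLpNormEssSup (f := f) (μ := (volume : Measure Space).restrict strip)
  rw [(MeasurableEquiv.addRight (k • periodVec)).measurableEmbedding.ae_map_iff]
  filter_upwards [hM, ae_restrict_of_ae (hf.ae_periodic hu)] with x hx hx'
  change ‖f (x + k • periodVec)‖ₑ ≤ _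
  rwa [hx' k, ← hMdef]

theorem ZPeriodic.fourierMultiplier {u : 𝓢'(Space, ℂ)} (hu : ZPeriodic u) {m : Space → ℂ}
    (hm : m.HasTemperateGrowth) : ZPeriodic (fourierMultiplierCLM ℂ m u) := by
  intro ψ
  rw [fourierMultiplierCLM_apply_apply, fourierMultiplierCLM_apply_apply,
    fourier_smulLeft_fourierInv_compSubConst hm, hu]

theorem ZPeriodic.sub {u v : 𝓢'(Space, ℂ)} (hu : ZPeriodic u) (hv : ZPeriodic v) :
    ZPeriodic (u - v) := fun ψ => by
  simp only [_root_.sub_apply, hu ψ, hv ψ]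

end Periodicity

/-! ### Exponential weights against periodic functions -/

section SquareIntegrable

theorem summable_exp_neg_abs_int : Summable fun k : ℤ => Real.exp (-(2 * Real.pi * |(k : ℝ)|)) := by
  have h : Summable fun n : ℕ => Real.exp (-(2 * Real.pi * (n : ℝ))) := by
    have := Real.summable_exp_nat_mul_iff (a := -(2 * Real.pi)) |>.2 (by linarith [Real.pi_pos])
    refine this.congr fun n => ?_
    congr 1
    ring
  refine Summable.of_nat_of_neg ?_ ?_
  · simpa using h
  · simpa using h

/-- Recentring at the multiple of `2π` nearest to `s` costs at most a factor `e^π` and leaves a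
geometric series independent of `s`. -/
theorem exists_tsum_exp_neg_abs_le :
    ∃ C : ℝ≥0, ∀ s : ℝ,
      ∑' k : ℤ, ENNReal.ofReal (Real.exp (-|s - 2 * Real.pi * k|)) ≤ C := by
  have hp := Real.pi_pos
  refine ⟨(Real.exp Real.pi * ∑' k : ℤ, Real.exp (-(2 * Real.pi * |(k : ℝ)|))).toNNReal,
    fun s => ?_⟩
  set m : ℤ := round (s / (2 * Real.pi))
  have hm : |s - 2 * Real.pi * m| ≤ Real.pi := by
    have h := abs_sub_round (s / (2 * Real.pi))
    have e : s - 2 * Real.pi * m = 2 * Real.pi * (s / (2 * Real.pi) - m) := by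
      field_simp
    rw [e, abs_mul, abs_of_pos (by positivity)]
    nlinarith
  have hk : ∀ k : ℤ, Real.exp (-|s - 2 * Real.pi * k|) ≤
      Real.exp Real.pi * Real.exp (-(2 * Real.pi * |((k - m : ℤ) : ℝ)|)) := by
    intro k
    rw [← Real.exp_add, Real.exp_le_exp]
    have h1 : 2 * Real.pi * |((k - m : ℤ) : ℝ)| = |(s - 2 * Real.pi * m) - (s - 2 * Real.pi * k)| := by
      rw [← abs_of_pos (show (0 : ℝ) < 2 * Real.pi by positivity), ← abs_mul]
      rw [abs_of_pos (show (0 : ℝ) < 2 * Real.pi by positivity)]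
      congr 1
      push_cast
      ring
    have h2 := abs_sub (s - 2 * Real.pi * m) (s - 2 * Real.pi * k)
    linarith
  have hs : Summable fun k : ℤ =>
      Real.exp Real.pi * Real.exp (-(2 * Real.pi * |((k - m : ℤ) : ℝ)|)) :=
    ((Equiv.subRight m).summable_iff.2 summable_exp_neg_abs_int).mul_left _
  calc ∑' k : ℤ, ENNReal.ofReal (Real.exp (-|s - 2 * Real.pi * k|))
      ≤ ∑' k : ℤ, ENNReal.ofReal
          (Real.exp Real.pi * Real.exp (-(2 * Real.pi * |((k - m : ℤ) : ℝ)|))) :=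
        ENNReal.tsum_le_tsum fun k => ENNReal.ofReal_le_ofReal (hk k)
    _ = ENNReal.ofReal (∑' k : ℤ,
          Real.exp Real.pi * Real.exp (-(2 * Real.pi * |((k - m : ℤ) : ℝ)|))) :=
        (ENNReal.ofReal_tsum_of_nonneg (fun k => by positivity) hs).symm
    _ = _ := by
        have e := (Equiv.subRight m).tsum_eq fun k : ℤ => Real.exp (-(2 * Real.pi * |(k : ℝ)|))
        simp only [Equiv.subRight_apply] at e
        rw [tsum_mul_left, e]
        rfl

/-- An exponentially weighted integral of a periodic function is controlled by one period. -/
theorem exists_lintegral_exp_mul_le :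
    ∃ C : ℝ≥0, ∀ (F : Space → ℝ≥0∞), AEMeasurable F volume →
      (∀ᵐ x, ∀ k : ℤ, F (x + k • periodVec) = F x) → ∀ s : ℝ,
      ∫⁻ y, ENNReal.ofReal (Real.exp (-|s - vert y|)) * F y ≤ C * ∫⁻ y in strip, F y := by
  obtain ⟨C, hC⟩ := exists_tsum_exp_neg_abs_le
  refine ⟨C, fun F hF hper s => ?_⟩
  rw [lintegral_eq_tsum_strip]
  have h1 : ∀ k : ℤ, ∫⁻ y in strip, ENNReal.ofReal (Real.exp (-|s - vert (y + k • periodVec)|)) *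
      F (y + k • periodVec) = ∫⁻ y in strip,
        ENNReal.ofReal (Real.exp (-|(s - vert y) - 2 * Real.pi * k|)) * F y := by
    intro k
    refine lintegral_congr_ae ?_
    filter_upwards [ae_restrict_of_ae hper] with y hy
    rw [hy k, vert_add_zsmul_periodVec, sub_sub]
  simp only [h1]
  rw [← lintegral_tsum]
  · rw [← lintegral_const_mul'' _ hF.restrict]
    refine lintegral_mono fun y => ?_
    simp only
    rw [ENNReal.tsum_mul_right]
    exact mul_le_mul_left (hC _) _
  · intro k
    refine AEMeasurable.mul ?_ hF.restrict
    have : Continuous fun y : Space => Real.exp (-|(s - vert y) - 2 * Real.pi * k|) := by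
      fun_prop
    exact this.measurable.ennreal_ofReal.aemeasurable

end SquareIntegrable

/-! ### One-dimensional Fourier transforms of two-sided exponentials -/

section VerticalKernels

theorem fourierChar_smul_exp (z ζ : ℝ) (e : ℂ) :
    Real.fourierChar (-(z * ζ)) • (Complex.exp e) =
      Complex.exp (e - 2 * Real.pi * Complex.I * ζ * z) := by
  rw [Circle.smul_def, Real.fourierChar_apply, smul_eq_mul, ← Complex.exp_add]
  congr 1
  push_cast
  ring

theorem integral_Ioi_fourierChar_exp {c : ℝ} (hc : 0 < c) (ζ : ℝ) :
    IntegrableOn (fun z : ℝ => Real.fourierChar (-(z * ζ)) • Complex.exp (-(c * z)))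
      (Set.Ioi 0) ∧
    ∫ z in Set.Ioi (0 : ℝ), Real.fourierChar (-(z * ζ)) • Complex.exp (-(c * z)) =
      1 / (c + 2 * Real.pi * Complex.I * ζ) := by
  set w : ℂ := -(c + 2 * Real.pi * Complex.I * ζ) with hw
  have hre : w.re < 0 := by simp [hw, hc]
  have e : ∀ z : ℝ, Real.fourierChar (-(z * ζ)) • Complex.exp (-(c * z)) =
      Complex.exp (w * z) := by
    intro z
    rw [fourierChar_smul_exp]
    congr 1
    rw [hw]
    ring
  simp only [e]
  refine ⟨integrableOn_exp_mul_complex_Ioi hre 0, ?_⟩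
  rw [integral_exp_mul_complex_Ioi hre]
  simp only [Complex.ofReal_zero, mul_zero, Complex.exp_zero, hw]
  rw [neg_div_neg_eq]

/-- Both half-lines at once: the parameters `p`, `q` are the weights of the two half-lines. -/
theorem integral_fourierChar_exp_abs {c : ℝ} (hc : 0 < c) (ζ : ℝ) (b : ℝ → ℂ) (p q : ℂ)
    (hp : ∀ z, 0 < z → b z = p) (hq : ∀ z, z < 0 → b z = q) :
    ∫ z : ℝ, Real.fourierChar (-(z * ζ)) • (b z * Complex.exp (-(c * |z|))) =
      p / (c + 2 * Real.pi * Complex.I * ζ) + q / (c - 2 * Real.pi * Complex.I * ζ) := by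
  set F : ℝ → ℂ := fun z => Real.fourierChar (-(z * ζ)) • (b z * Complex.exp (-(c * |z|))) with hF
  have e' : ∀ (t : Circle) (a b : ℂ), t • (a * b) = a * t • b := fun t a b => by
    simp only [Circle.smul_def, smul_eq_mul]; ring
  have h1 := integral_Ioi_fourierChar_exp hc ζ
  have h2 := integral_Ioi_fourierChar_exp hc (-ζ)
  have e1 : Set.EqOn F (fun z => p * (Real.fourierChar (-(z * ζ)) • Complex.exp (-(c * z))))
      (Set.Ioi 0) := by
    intro z hz
    simp only [hF, hp z hz, abs_of_pos (Set.mem_Ioi.1 hz), e']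
  have e2 : Set.EqOn (fun z => F (-z))
      (fun z => q * (Real.fourierChar (-(z * (-ζ))) • Complex.exp (-(c * z)))) (Set.Ioi 0) := by
    intro z hz
    have hz' : (0 : ℝ) < z := hz
    simp only [hF, hq (-z) (by linarith), abs_neg, abs_of_pos hz', e', neg_mul, mul_neg]
  have i1 : IntegrableOn F (Set.Ioi 0) :=
    IntegrableOn.congr_fun (h1.1.const_mul p) e1.symm measurableSet_Ioi
  have i2 : IntegrableOn (fun z => F (-z)) (Set.Ioi 0) :=
    IntegrableOn.congr_fun (h2.1.const_mul q) e2.symm measurableSet_Ioi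
  have i2' : IntegrableOn F (Set.Iic 0) := by
    rw [integrableOn_Iic_iff_integrableOn_Iio]
    refine ((Measure.measurePreserving_neg volume).integrableOn_comp_preimage
      (MeasurableEquiv.neg ℝ).measurableEmbedding).1 ?_
    have : (Neg.neg : ℝ → ℝ) ⁻¹' Set.Iio 0 = Set.Ioi 0 := by ext; simp
    rw [this]
    exact i2
  rw [← intervalIntegral.integral_Iic_add_Ioi i2' i1]
  have s1 : ∫ z in Set.Ioi (0 : ℝ), F z = p / (c + 2 * Real.pi * Complex.I * ζ) := by
    rw [setIntegral_congr_fun measurableSet_Ioi e1, integral_const_mul, h1.2, mul_one_div]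
  have s2 : ∫ z in Set.Iic (0 : ℝ), F z = q / (c - 2 * Real.pi * Complex.I * ζ) := by
    have := integral_comp_neg_Ioi (0 : ℝ) F
    rw [neg_zero] at this
    rw [← this, setIntegral_congr_fun measurableSet_Ioi e2, integral_const_mul, h2.2, mul_one_div]
    congr 1
    push_cast
    ring
  rw [s1, s2, add_comm]

theorem sq_add_sq_ne_zero {c : ℝ} (hc : 0 < c) (ζ : ℝ) :
    (c : ℂ) + 2 * Real.pi * Complex.I * ζ ≠ 0 ∧ (c : ℂ) - 2 * Real.pi * Complex.I * ζ ≠ 0 ∧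
      (c : ℂ) ^ 2 + 4 * Real.pi ^ 2 * ζ ^ 2 ≠ 0 := by
  refine ⟨fun h => ?_, fun h => ?_, fun h => ?_⟩
  · have := congrArg Complex.re h
    simp at this
    linarith
  · have := congrArg Complex.re h
    simp at this
    linarith
  · have h' : ((c ^ 2 + 4 * Real.pi ^ 2 * ζ ^ 2 : ℝ) : ℂ) = 0 := by push_cast; exact h
    rw [Complex.ofReal_eq_zero] at h'
    nlinarith [sq_nonneg (Real.pi * ζ), pow_pos hc 2]

theorem integral_fourierChar_exp_abs_even {c : ℝ} (hc : 0 < c) (ζ : ℝ) :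
    ∫ z : ℝ, Real.fourierChar (-(z * ζ)) • (1 * Complex.exp (-(c * |z|)) : ℂ) =
      2 * c / (c ^ 2 + 4 * Real.pi ^ 2 * ζ ^ 2) := by
  obtain ⟨h1, h2, h3⟩ := sq_add_sq_ne_zero hc ζ
  rw [integral_fourierChar_exp_abs hc ζ (fun _ => 1) 1 1 (fun _ _ => rfl) fun _ _ => rfl,
    div_add_div _ _ h1 h2, div_eq_div_iff (mul_ne_zero h1 h2) h3]
  linear_combination (8 * c * Real.pi ^ 2 * ζ ^ 2 : ℂ) * Complex.I_sq

theorem integral_fourierChar_exp_abs_odd {c : ℝ} (hc : 0 < c) (ζ : ℝ) :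
    ∫ z : ℝ, Real.fourierChar (-(z * ζ)) •
        (((SignType.sign z : ℝ) : ℂ) * Complex.exp (-(c * |z|)) : ℂ) =
      -(4 * Real.pi * Complex.I * ζ) / (c ^ 2 + 4 * Real.pi ^ 2 * ζ ^ 2) := by
  obtain ⟨h1, h2, h3⟩ := sq_add_sq_ne_zero hc ζ
  rw [integral_fourierChar_exp_abs hc ζ (fun z => ((SignType.sign z : ℝ) : ℂ)) 1 (-1)
    (fun z hz => by simp [sign_pos hz]) (fun z hz => by simp [sign_neg hz]),
    div_add_div _ _ h1 h2, div_eq_div_iff (mul_ne_zero h1 h2) h3]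
  linear_combination (-(16 * Real.pi ^ 3 * Complex.I * ζ ^ 3) : ℂ) * Complex.I_sq

end VerticalKernels

/-! ### Kernels built from horizontal slices, and slices of symbols -/

section KernelFamilies

theorem continuous_coe_fourierChar {X : Type} [TopologicalSpace X] {f : X → ℝ}
    (hf : Continuous f) : Continuous fun x => (Real.fourierChar (f x) : ℂ) := by
  simp only [Real.fourierChar_apply]
  fun_prop

theorem circle_integral_smul {X : Type} [MeasurableSpace X] {μ : Measure X} (t : Circle)
    (f : X → ℂ) : ∫ x, t • f x ∂μ = t • ∫ x, f x ∂μ := by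
  simp only [Circle.smul_def]
  exact integral_smul _ _

/-- The function on `ℝ³` whose slices at height `z` are the inverse Fourier transforms of `a z`. -/
def sliceKernel (a : ℝ → 𝓢(Plane, ℂ)) (x : Space) : ℂ :=
  (𝓕⁻ (a (vert x)) : 𝓢(Plane, ℂ)) (horiz x)

theorem aestronglyMeasurable_sliceKernel {a : ℝ → 𝓢(Plane, ℂ)}
    (ha : Measurable fun p : ℝ × Plane => a p.1 p.2) :
    AEStronglyMeasurable (fun p : Plane × ℝ => (𝓕⁻ (a p.2) : 𝓢(Plane, ℂ)) p.1)
      ((volume : Measure Plane).prod volume) := by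
  have h : StronglyMeasurable (fun q : (Plane × ℝ) × Plane =>
      Real.fourierChar (inner ℝ q.2 q.1.1) • a q.1.2 q.2) := by
    have h1 : Measurable fun q : (Plane × ℝ) × Plane => a q.1.2 q.2 :=
      ha.comp (measurable_fst.snd.prodMk measurable_snd)
    have h2 : Continuous fun q : (Plane × ℝ) × Plane =>
        (Real.fourierChar (inner ℝ q.2 q.1.1) : ℂ) := by
      exact continuous_coe_fourierChar (by fun_prop)
    have h3 := (h2.measurable.mul h1).stronglyMeasurable
    exact h3
  have h' := h.integral_prod_right' (ν := (volume : Measure Plane))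
  refine h'.aestronglyMeasurable.congr (Eventually.of_forall fun p => ?_)
  simp only [SchwartzMap.fourierInv_coe, Real.fourierInv_eq]

theorem integrable_sliceKernel {a : ℝ → 𝓢(Plane, ℂ)}
    (ha : Measurable fun p : ℝ × Plane => a p.1 p.2) {B : ℝ → ℝ≥0∞} {C : ℝ≥0∞} (hC : C ≠ ∞)
    (hB : ∀ z, ∫⁻ x, ‖(𝓕⁻ (a z) : 𝓢(Plane, ℂ)) x‖ₑ ≤ B z) (hBC : ∫⁻ z, B z ≤ C) :
    Integrable (sliceKernel a) ∧ ∫⁻ x, ‖sliceKernel a x‖ₑ ≤ C := by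
  have hm := aestronglyMeasurable_sliceKernel ha
  set F : Plane × ℝ → ℂ := fun p => (𝓕⁻ (a p.2) : 𝓢(Plane, ℂ)) p.1 with hF
  have e : sliceKernel a = fun x => F (horiz x, vert x) := rfl
  have hle : ∫⁻ x, ‖sliceKernel a x‖ₑ ≤ C := by
    rw [e, lintegral_space_eq fun p => ‖F p‖ₑ, lintegral_prod_symm _ hm.enorm]
    exact (lintegral_mono hB).trans hBC
  refine ⟨⟨?_, hle.trans_lt hC.lt_top⟩, hle⟩
  rw [e]
  exact hm.comp_measurePreserving measurePreserving_splitEquiv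

/-- By Fubini the horizontal transform cancels the inverse transform in each slice, so only the
vertical transform of `a z` remains. -/
theorem fourier_sliceKernel {a : ℝ → 𝓢(Plane, ℂ)} (hK : Integrable (sliceKernel a)) (ξ : Space) :
    𝓕 (sliceKernel a) ξ = ∫ z : ℝ, Real.fourierChar (-(z * vert ξ)) • a z (horiz ξ) := by
  rw [Real.fourier_eq]
  have hi := (Real.fourierIntegral_convergent_iff (μ := volume) ξ).2 hK
  set F : Plane × ℝ → ℂ := fun p =>
    Real.fourierChar (-(inner ℝ p.1 (horiz ξ) + inner ℝ p.2 (vert ξ))) •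
      (𝓕⁻ (a p.2) : 𝓢(Plane, ℂ)) p.1 with hF
  have e : (fun x => Real.fourierChar (-inner ℝ x ξ) • sliceKernel a x) =
      fun x => F (horiz x, vert x) := by
    funext x
    simp only [hF, sliceKernel, inner_space_eq x ξ]
  rw [e] at hi ⊢
  rw [integral_space_eq, integral_prod_symm _ (integrable_space_iff.1 hi)]
  refine integral_congr_ae (Eventually.of_forall fun z => ?_)
  have h1 : ∀ p : Plane, F (p, z) = Real.fourierChar (-(z * vert ξ)) •
      (Real.fourierChar (-inner ℝ p (horiz ξ)) • (𝓕⁻ (a z) : 𝓢(Plane, ℂ)) p) := by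
    intro p
    simp only [hF, smul_smul, ← AddChar.map_add_eq_mul]
    congr 2
    simp [mul_comm]
  simp only [h1]
  rw [circle_integral_smul, ← Real.fourier_eq, ← SchwartzMap.fourier_coe,
    FourierTransform.fourier_fourierInv_eq]

/-- Freezing the vertical frequency at `τ` integrates the kernel in `z` against a unimodular
character, which cannot increase the `L¹` norm. The constant is therefore uniform in `τ`, hence in
the Fourier mode. -/
theorem isWienerSymbol_slice {C : ℝ≥0∞} {m : Space → ℂ} (h : IsWienerSymbol C m) (τ : ℝ) :
    IsWienerSymbol C (fun η : Plane => m (splitEquiv.symm (η, τ))) := by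
  obtain ⟨K, hK, hmK, hKC⟩ := h
  set F : Plane × ℝ → ℂ := fun p =>
    Real.fourierChar (-inner ℝ p.2 τ) • K (splitEquiv.symm p) with hF
  have e : ∀ x, K x = K (splitEquiv.symm (horiz x, vert x)) := fun x => by
    rw [← splitEquiv_apply, splitEquiv.symm_apply_apply]
  have hK' : Integrable (fun p => K (splitEquiv.symm p)) ((volume : Measure Plane).prod volume) :=
    integrable_space_iff.1 (hK.congr (Eventually.of_forall e))
  have hFi : Integrable F ((volume : Measure Plane).prod volume) := by
    have hc : Continuous fun p : Plane × ℝ => (Real.fourierChar (-inner ℝ p.2 τ) : ℂ) := by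
      exact continuous_coe_fourierChar (by fun_prop)
    exact hK'.bdd_mul (c := 1) hc.aestronglyMeasurable
      (Eventually.of_forall fun p => (Circle.norm_coe _).le)
  refine ⟨fun x => ∫ z, F (x, z), hFi.integral_prod_left, fun η => ?_, ?_⟩
  · beta_reduce
    rw [← hmK, Real.fourier_eq, Real.fourier_eq]
    set ξ := splitEquiv.symm (η, τ) with hξ
    have hξ1 : horiz ξ = η := horiz_splitEquiv_symm _
    have hξ2 : vert ξ = τ := vert_splitEquiv_symm _
    have hi := (Real.fourierIntegral_convergent_iff (μ := volume) ξ).2 hK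
    set G : Plane × ℝ → ℂ := fun p => Real.fourierChar (-inner ℝ p.1 η) • F p with hG
    have e2 : (fun x => Real.fourierChar (-inner ℝ x ξ) • K x) =
        fun x => G (horiz x, vert x) := by
      funext x
      simp only [hG, hF, smul_smul, ← AddChar.map_add_eq_mul, ← e x]
      rw [inner_space_eq, hξ1, hξ2, neg_add]
    rw [e2] at hi ⊢
    rw [integral_space_eq, integral_prod _ (integrable_space_iff.1 hi)]
    refine integral_congr_ae (Eventually.of_forall fun x => ?_)
    simp only [hG]
    rw [circle_integral_smul]
  · calc ∫⁻ x, ‖∫ z, F (x, z)‖ₑ ≤ ∫⁻ x, ∫⁻ z, ‖F (x, z)‖ₑ :=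
          lintegral_mono fun x => enorm_integral_le_lintegral_enorm _
      _ = ∫⁻ p, ‖F p‖ₑ ∂((volume : Measure Plane).prod volume) :=
          (lintegral_prod _ hFi.1.enorm).symm
      _ = ∫⁻ p, ‖K (splitEquiv.symm p)‖ₑ ∂((volume : Measure Plane).prod volume) := by
          refine lintegral_congr fun p => ?_
          simp only [hF, Circle.smul_def, smul_eq_mul, enorm_mul]
          rw [← ofReal_norm, Circle.norm_coe, ENNReal.ofReal_one, one_mul]
      _ = ∫⁻ x, ‖K x‖ₑ := by
          rw [← lintegral_space_eq]
          exact lintegral_congr fun x => by rw [← e x]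
      _ ≤ C := hKC

end KernelFamilies

/-! ### Uniform `L¹` bounds for inverse Fourier transforms of families -/

section UniformBounds

/-- The inverse Fourier transform followed by the inclusion in `L¹` is continuous on the Schwartz
space, so finitely many seminorms control it. -/
theorem exists_lintegral_fourierInv_le_seminorm : ∃ (s : Finset (ℕ × ℕ)) (C : ℝ≥0),
    ∀ g : 𝓢(Plane, ℂ), ∫⁻ x, ‖(𝓕⁻ g : 𝓢(Plane, ℂ)) x‖ₑ ≤
      C * ENNReal.ofReal ((s.sup (schwartzSeminormFamily ℂ Plane ℂ)) g) := by
  let T : 𝓢(Plane, ℂ) →L[ℂ] Lp ℂ 1 (volume : Measure Plane) :=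
    SchwartzMap.toLpCLM ℂ ℂ 1 volume ∘L fourierInvCLM ℂ 𝓢(Plane, ℂ)
  let q : Seminorm ℂ 𝓢(Plane, ℂ) := (normSeminorm ℂ (Lp ℂ 1 (volume : Measure Plane))).comp
    T.toLinearMap
  have hq : Continuous q := by
    change Continuous fun g => ‖T g‖
    exact T.continuous.norm
  obtain ⟨s, C, -, hC⟩ := Seminorm.bound_of_continuous (schwartz_withSeminorms ℂ Plane ℂ) q hq
  refine ⟨s, C, fun g => ?_⟩
  have h1 : q g ≤ C * (s.sup (schwartzSeminormFamily ℂ Plane ℂ)) g := hC g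
  have h2 : q g = ∫ x, ‖(𝓕⁻ g : 𝓢(Plane, ℂ)) x‖ := by
    change ‖T g‖ = _
    exact SchwartzMap.norm_toLp_one
  rw [← ofReal_integral_norm_eq_lintegral_enorm (𝓕⁻ g : 𝓢(Plane, ℂ)).integrable, ← h2]
  refine (ENNReal.ofReal_le_ofReal h1).trans ?_
  rw [ENNReal.ofReal_mul (NNReal.coe_nonneg C)]
  simp

/-- A smooth family of test functions with common compact support has uniformly integrable
inverse Fourier transforms, for parameters in a compact interval. -/
theorem exists_lintegral_fourierInv_le_of_contDiff {H : ℝ × Plane → ℂ}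
    (hH : ContDiff ℝ (⊤ : ℕ∞) H) {R : ℝ} (hR : ∀ p : ℝ × Plane, R ≤ ‖p.2‖ → H p = 0) :
    ∃ C : ℝ≥0, ∀ s ∈ Set.Icc (0 : ℝ) 1, ∀ g : 𝓢(Plane, ℂ), (∀ η, g η = H (s, η)) →
      ∫⁻ x, ‖(𝓕⁻ g : 𝓢(Plane, ℂ)) x‖ₑ ≤ C := by
  have key : ∀ k n : ℕ, ∃ M : ℝ, 0 ≤ M ∧ ∀ s ∈ Set.Icc (0 : ℝ) 1, ∀ g : 𝓢(Plane, ℂ),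
      (∀ η, g η = H (s, η)) → SchwartzMap.seminorm ℂ k n g ≤ M := by
    intro k n
    have hcont : Continuous fun p => ‖iteratedFDeriv ℝ n H p‖ :=
      (hH.continuous_iteratedFDeriv (mod_cast le_top)).norm
    have hcomp : IsCompact (Set.Icc (0 : ℝ) 1 ×ˢ Metric.closedBall (0 : Plane) R) :=
      isCompact_Icc.prod (isCompact_closedBall _ _)
    obtain ⟨M, hM⟩ := hcomp.bddAbove_image hcont.continuousOn
    have hM' : ∀ p ∈ Set.Icc (0 : ℝ) 1 ×ˢ Metric.closedBall (0 : Plane) R,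
        ‖iteratedFDeriv ℝ n H p‖ ≤ |M| := fun p hp =>
      (hM (Set.mem_image_of_mem _ hp)).trans (le_abs_self M)
    set J : Plane →L[ℝ] ℝ × Plane := ContinuousLinearMap.inr ℝ ℝ Plane
    refine ⟨|R| ^ k * (|M| * ‖J‖ ^ n), by positivity, fun s hs g hg => ?_⟩
    refine SchwartzMap.seminorm_le_bound ℂ k n g (by positivity) fun η => ?_
    by_cases hη : η ∈ Metric.closedBall (0 : Plane) R
    · have hηR : ‖η‖ ≤ R := by simpa using hη
      have hg' : (g : Plane → ℂ) = (fun p => H ((s, 0) + p)) ∘ J := by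
        funext x
        simp [hg, J]
      have hsm : ContDiff ℝ n (fun p => H ((s, 0) + p)) :=
        (hH.of_le (mod_cast le_top)).comp (contDiff_const.add contDiff_id)
      have h1 := norm_iteratedFDeriv_comp_clm_le J hsm le_rfl η
      rw [iteratedFDeriv_comp_add_left] at h1
      rw [hg']
      have h2 : ‖iteratedFDeriv ℝ n H ((s, 0) + J η)‖ ≤ |M| := by
        refine hM' _ ?_
        simp only [J, ContinuousLinearMap.inr_apply, Prod.mk_add_mk, add_zero, zero_add]
        exact ⟨hs, hη⟩
      gcongr
      · exact hηR.trans (le_abs_self R)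
      · exact h1.trans (by gcongr)
    · have hz : iteratedFDeriv ℝ n g η = 0 := by
        have hsupp : tsupport (g : Plane → ℂ) ⊆ Metric.closedBall (0 : Plane) R := by
          refine closure_minimal (fun x hx => ?_) Metric.isClosed_closedBall
          by_contra hx'
          simp only [Metric.mem_closedBall, dist_zero_right, not_le] at hx'
          exact hx ((hg x).trans (hR (s, x) hx'.le))
        have hsub := support_iteratedFDeriv_subset (𝕜 := ℝ) (f := (g : Plane → ℂ)) n
        exact Function.notMem_support.1 fun hne => hη (hsupp (hsub hne))
      rw [hz]
      simp only [norm_zero, mul_zero]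
      positivity
  choose M hM0 hM using key
  obtain ⟨s, C, hC⟩ := exists_lintegral_fourierInv_le_seminorm
  refine ⟨C * (∑ i ∈ s, M i.1 i.2).toNNReal, fun t ht g hg => (hC g).trans ?_⟩
  rw [ENNReal.coe_mul]
  refine mul_le_mul_right (ENNReal.ofReal_le_ofReal ?_) _
  refine Seminorm.finset_sup_apply_le (Finset.sum_nonneg fun i _ => hM0 _ _) fun i hi => ?_
  exact (hM i.1 i.2 t ht g hg).trans
    (Finset.single_le_sum (f := fun i : ℕ × ℕ => M i.1 i.2) (fun i _ => hM0 _ _) hi)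

/-- Near points where `L` vanishes the product is identically `0`. This hides the singularity of
`|η|` at the origin in all symbols below. -/
theorem contDiff_mul_of_vanish {X : Type} [NormedAddCommGroup X] [NormedSpace ℝ X]
    {A : Plane → ℂ} (hA : ContDiff ℝ (⊤ : ℕ∞) A) {r : ℝ} (hr : 0 < r)
    (hAr : ∀ η, ‖η‖ ≤ r → A η = 0) {L : X → Plane} (hL : ContDiff ℝ (⊤ : ℕ∞) L) {G : X → ℂ}
    (hG : ∀ p, L p ≠ 0 → ContDiffAt ℝ (⊤ : ℕ∞) G p) :
    ContDiff ℝ (⊤ : ℕ∞) fun p => A (L p) * G p := by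
  rw [contDiff_iff_contDiffAt]
  intro p
  by_cases hp : L p = 0
  · have h : ∀ᶠ q in 𝓝 p, ‖L q‖ < r := by
      refine hL.continuous.norm.continuousAt.eventually_lt continuousAt_const ?_
      simpa [hp] using hr
    refine (contDiffAt_const (c := (0 : ℂ))).congr_of_eventuallyEq ?_
    filter_upwards [h] with q hq
    rw [hAr _ hq.le, zero_mul]
  · exact (hA.comp hL).contDiffAt.mul (hG p hp)

/-- The function `x ↦ x⁻² e^{-1/x}`, extended by `0` to `x ≤ 0`. -/
def invSqExpGlue (x : ℝ) : ℝ := (Polynomial.X ^ 2 : Polynomial ℝ).eval x⁻¹ * expNegInvGlue x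

theorem contDiff_invSqExpGlue : ContDiff ℝ (⊤ : ℕ∞) invSqExpGlue :=
  expNegInvGlue.contDiff_polynomial_eval_inv_mul _

theorem invSqExpGlue_inv {y : ℝ} (hy : 0 < y) : invSqExpGlue y⁻¹ = y ^ 2 * Real.exp (-y) := by
  have : ¬ y⁻¹ ≤ 0 := not_le.2 (inv_pos.2 hy)
  simp [invSqExpGlue, expNegInvGlue, this]

variable {A : Plane → ℂ}

/-- The inverse Fourier transforms of `A(η) e^{-2πt|η|}` decay quadratically in `t`, if `A` is
supported in an annulus. -/
theorem exists_lintegral_fourierInv_exp_le (hA : ContDiff ℝ (⊤ : ℕ∞) A) {r R : ℝ} (hr : 0 < r)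
    (hAr : ∀ η, ‖η‖ ≤ r → A η = 0) (hAR : ∀ η, R ≤ ‖η‖ → A η = 0) :
    ∃ C : ℝ≥0, ∀ t : ℝ, 0 ≤ t → ∀ g : 𝓢(Plane, ℂ),
      (∀ η, g η = A η * Complex.exp (-((2 * Real.pi * ‖η‖ : ℝ) * t))) →
      ∫⁻ x, ‖(𝓕⁻ g : 𝓢(Plane, ℂ)) x‖ₑ ≤ C * ENNReal.ofReal ((1 + t ^ 2)⁻¹) := by
  have hp := Real.pi_pos
  have hof : ContDiff ℝ (⊤ : ℕ∞) (fun x : ℝ => (x : ℂ)) := Complex.ofRealCLM.contDiff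
  have hnorm : ∀ p : ℝ × Plane, p.2 ≠ 0 →
      ContDiffAt ℝ (⊤ : ℕ∞) (fun q : ℝ × Plane => 2 * Real.pi * ‖q.2‖) p := fun p h2 =>
    contDiffAt_const.mul ((contDiffAt_norm ℝ h2).comp p contDiffAt_snd)
  have h1 : ContDiff ℝ (⊤ : ℕ∞) (fun p : ℝ × Plane =>
      A p.2 * Complex.exp (-((2 * Real.pi * ‖p.2‖ : ℝ) * (p.1 : ℝ)))) := by
    refine contDiff_mul_of_vanish hA hr hAr contDiff_snd fun p h2 => ?_
    refine ContDiffAt.cexp (ContDiffAt.neg (ContDiffAt.mul ?_ ?_))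
    · exact hof.contDiffAt.comp p (hnorm p h2)
    · exact (hof.comp contDiff_fst).contDiffAt
  -- This family handles `t ≥ 1` in the parameter `s = 1/t`: with `y = 2π|η|`, the function `t²
  -- e^{-ty}` equals `y⁻²` times `invSqExpGlue (s/y)`, which is smooth up to `s = 0`. Thus `[1, ∞)`
  -- becomes part of the compact interval `[0, 1]`, and the factor `t²` is the decay to be gained.
  have h2 : ContDiff ℝ (⊤ : ℕ∞) (fun p : ℝ × Plane =>
      A p.2 * (((2 * Real.pi * ‖p.2‖)⁻¹ ^ 2 * invSqExpGlue (p.1 * (2 * Real.pi * ‖p.2‖)⁻¹) : ℝ) :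
        ℂ)) := by
    refine contDiff_mul_of_vanish hA hr hAr contDiff_snd fun p h2 => ?_
    have hne : 2 * Real.pi * ‖p.2‖ ≠ 0 := by positivity
    have hinv := (hnorm p h2).inv hne
    exact hof.contDiffAt.comp p ((hinv.pow 2).mul
      (contDiff_invSqExpGlue.contDiffAt.comp p (contDiffAt_fst.mul hinv)))
  obtain ⟨C1, hC1⟩ := exists_lintegral_fourierInv_le_of_contDiff h1 (R := R)
    fun p hp => by rw [hAR _ hp, zero_mul]
  obtain ⟨C2, hC2⟩ := exists_lintegral_fourierInv_le_of_contDiff h2 (R := R)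
    fun p hp => by rw [hAR _ hp, zero_mul]
  refine ⟨2 * C1 + 2 * C2, fun t ht g hg => ?_⟩
  have hle : ∀ {c : ℝ≥0} {x y : ℝ}, x ≤ 2 * y →
      (c : ℝ≥0∞) * ENNReal.ofReal x ≤ 2 * c * ENNReal.ofReal y := by
    intro c x y hxy
    calc (c : ℝ≥0∞) * ENNReal.ofReal x ≤ c * ENNReal.ofReal (2 * y) := by gcongr
      _ = 2 * c * ENNReal.ofReal y := by
        rw [ENNReal.ofReal_mul (by norm_num), ENNReal.ofReal_ofNat]; ring
  push_cast
  rw [add_mul]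
  rcases le_total t 1 with h | h
  · refine le_trans ?_ le_self_add
    have := hC1 t ⟨ht, h⟩ g hg
    refine this.trans ?_
    have h3 : (1 : ℝ) ≤ 2 * (1 + t ^ 2)⁻¹ := by
      rw [← div_eq_mul_inv, le_div_iff₀ (by positivity)]
      nlinarith
    simpa using hle (c := C1) h3
  · refine le_trans ?_ le_add_self
    have ht0 : 0 < t := by linarith
    have h3 : t⁻¹ ∈ Set.Icc (0 : ℝ) 1 := ⟨by positivity, inv_le_one_of_one_le₀ h⟩
    have h4 : ∀ η, (((t ^ 2 : ℝ) : ℂ) • g) η =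
        A η * (((2 * Real.pi * ‖η‖)⁻¹ ^ 2 * invSqExpGlue (t⁻¹ * (2 * Real.pi * ‖η‖)⁻¹) : ℝ) :
          ℂ) := by
      intro η
      rw [_root_.smul_apply, hg, smul_eq_mul]
      by_cases hη : η = 0
      · simp [hη, hAr 0 (by simpa using hr.le)]
      have hpos : 0 < 2 * Real.pi * ‖η‖ := by positivity
      rw [← mul_inv, invSqExpGlue_inv (by positivity)]
      have : (2 * Real.pi * ‖η‖)⁻¹ ^ 2 * ((t * (2 * Real.pi * ‖η‖)) ^ 2 *
          Real.exp (-(t * (2 * Real.pi * ‖η‖)))) =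
          t ^ 2 * Real.exp (-(t * (2 * Real.pi * ‖η‖))) := by
        field_simp
      rw [this]
      push_cast
      rw [mul_left_comm]
      congr 4
      ring
    have h5 := hC2 t⁻¹ h3 _ h4
    have h6 : ∀ x, (𝓕⁻ g : 𝓢(Plane, ℂ)) x = ((t ^ 2 : ℝ) : ℂ)⁻¹ *
        (𝓕⁻ (((t ^ 2 : ℝ) : ℂ) • g) : 𝓢(Plane, ℂ)) x := by
      intro x
      rw [FourierTransform.fourierInv_smul, _root_.smul_apply, smul_eq_mul, ← mul_assoc,
        inv_mul_cancel₀ (by exact_mod_cast (pow_pos ht0 2).ne'), one_mul]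
    have h7 : ‖((t ^ 2 : ℝ) : ℂ)⁻¹‖ₑ = ENNReal.ofReal ((t ^ 2)⁻¹) := by
      rw [← ofReal_norm, norm_inv, Complex.norm_real, Real.norm_of_nonneg (by positivity)]
    simp only [h6, enorm_mul]
    rw [lintegral_const_mul' _ _ enorm_ne_top, h7, mul_comm]
    refine (mul_le_mul_left h5 _).trans (hle ?_)
    rw [← div_eq_mul_inv, le_div_iff₀ (by positivity), inv_mul_le_iff₀ (by positivity)]
    nlinarith

end UniformBounds

/-! ### Integrable kernels from exponential families -/

section WienerSymbols

variable {A : Plane → ℂ}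

/-- The slice of the kernel at height `z` has `L¹` norm at most a constant times `1/(1+z²)`, whose
integral is `π`. The bounded weight `b` allows for both the even kernel and the one with a sign. -/
theorem isWienerSymbol_of_exp_family (hA : ContDiff ℝ (⊤ : ℕ∞) A) {r R : ℝ} (hr : 0 < r)
    (hAr : ∀ η, ‖η‖ ≤ r → A η = 0) (hAR : ∀ η, R ≤ ‖η‖ → A η = 0) {b : ℝ → ℂ}
    (hb : Measurable b) (hb1 : ∀ z, ‖b z‖ ≤ 1) :
    ∃ C : ℝ≥0, IsWienerSymbol (E := Space) C fun ξ => ∫ z : ℝ, Real.fourierChar (-(z * vert ξ)) •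
      (A (horiz ξ) * (b z * Complex.exp (-((2 * Real.pi * ‖horiz ξ‖ : ℝ) * |z|)))) := by
  have hof : ContDiff ℝ (⊤ : ℕ∞) (fun x : ℝ => (x : ℂ)) := Complex.ofRealCLM.contDiff
  have hsm : ∀ t : ℝ, ContDiff ℝ (⊤ : ℕ∞) (fun η : Plane =>
      A η * Complex.exp (-((2 * Real.pi * ‖η‖ : ℝ) * t))) := by
    intro t
    refine contDiff_mul_of_vanish hA hr hAr contDiff_id fun p h2 => ?_
    refine ContDiffAt.cexp (ContDiffAt.neg (ContDiffAt.mul ?_ contDiffAt_const))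
    exact hof.contDiffAt.comp p (contDiffAt_const.mul (contDiffAt_norm ℝ h2))
  have hcs : ∀ t : ℝ, HasCompactSupport (fun η : Plane =>
      A η * Complex.exp (-((2 * Real.pi * ‖η‖ : ℝ) * t))) := fun t =>
    HasCompactSupport.intro (isCompact_closedBall (0 : Plane) R) fun η hη => by
      rw [hAR η (by simpa using (not_le.1 (by simpa using hη)).le), zero_mul]
  set g : ℝ → 𝓢(Plane, ℂ) := fun t => (hcs t).toSchwartzMap (hsm t) with hg
  have hgt : ∀ t η, g t η = A η * Complex.exp (-((2 * Real.pi * ‖η‖ : ℝ) * t)) :=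
    fun t η => rfl
  obtain ⟨C, hC⟩ := exists_lintegral_fourierInv_exp_le hA hr hAr hAR
  set a : ℝ → 𝓢(Plane, ℂ) := fun z => b z • g |z| with ha
  have hmeas : Measurable fun p : ℝ × Plane => a p.1 p.2 := by
    have h1 : Continuous fun p : ℝ × Plane =>
        A p.2 * Complex.exp (-((2 * Real.pi * ‖p.2‖ : ℝ) * (|p.1| : ℝ))) := by
      have := hA.continuous
      fun_prop
    exact (hb.comp measurable_fst).mul h1.measurable
  have hB : ∀ z, ∫⁻ x, ‖(𝓕⁻ (a z) : 𝓢(Plane, ℂ)) x‖ₑ ≤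
      C * ENNReal.ofReal ((1 + z ^ 2)⁻¹) := by
    intro z
    have h := hC |z| (abs_nonneg z) (g |z|) (hgt |z|)
    rw [sq_abs] at h
    refine le_trans (lintegral_mono fun x => ?_) h
    simp only [ha]
    rw [FourierTransform.fourierInv_smul, _root_.smul_apply, smul_eq_mul, enorm_mul]
    refine mul_le_of_le_one_left' ?_
    rw [← ofReal_norm]
    exact ENNReal.ofReal_le_one.2 (hb1 z)
  have hBC : ∫⁻ z : ℝ, C * ENNReal.ofReal ((1 + z ^ 2)⁻¹) ≤ (C * NNReal.pi : ℝ≥0) := by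
    rw [lintegral_const_mul' _ _ ENNReal.coe_ne_top,
      ← ofReal_integral_eq_lintegral_ofReal integrable_inv_one_add_sq
        (Eventually.of_forall fun z => by positivity), integral_univ_inv_one_add_sq,
      ENNReal.coe_mul]
    gcongr
    rw [ENNReal.ofReal_le_iff_le_toReal ENNReal.coe_ne_top]
    rfl
  obtain ⟨hK, hKC⟩ := integrable_sliceKernel hmeas ENNReal.coe_ne_top hB hBC
  refine ⟨_, sliceKernel a, hK, fun ξ => ?_, hKC⟩
  rw [fourier_sliceKernel hK]
  refine integral_congr_ae (Eventually.of_forall fun z => ?_)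
  simp only [ha, _root_.smul_apply, hgt, smul_eq_mul]
  congr 1
  ring

theorem exists_isWienerSymbol_even (hA : ContDiff ℝ (⊤ : ℕ∞) A) {r R : ℝ} (hr : 0 < r)
    (hAr : ∀ η, ‖η‖ ≤ r → A η = 0) (hAR : ∀ η, R ≤ ‖η‖ → A η = 0) :
    ∃ C : ℝ≥0, IsWienerSymbol (E := Space) C fun ξ =>
      A (horiz ξ) * (‖horiz ξ‖ / (Real.pi * (‖horiz ξ‖ ^ 2 + vert ξ ^ 2)) : ℝ) := by
  obtain ⟨C, hC⟩ := isWienerSymbol_of_exp_family hA hr hAr hAR (b := fun _ => 1)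
    measurable_const (by simp)
  refine ⟨C, ?_⟩
  convert hC using 2 with ξ
  by_cases h0 : horiz ξ = 0
  · simp [h0, hAr 0 (by simpa using hr.le)]
  have hpos : 0 < 2 * Real.pi * ‖horiz ξ‖ := by positivity
  have e' : ∀ (t : Circle) (a b : ℂ), t • (a * b) = a * t • b := fun t a b => by
    simp only [Circle.smul_def, smul_eq_mul]; ring
  simp only [e' _ (A (horiz ξ))]
  rw [integral_const_mul, integral_fourierChar_exp_abs_even hpos]
  congr 1
  have h4 : (‖horiz ξ‖ ^ 2 + vert ξ ^ 2 : ℂ) ≠ 0 := by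
    have : 0 < ‖horiz ξ‖ ^ 2 + vert ξ ^ 2 := by positivity
    exact_mod_cast this.ne'
  have h5 : (Real.pi : ℂ) ≠ 0 := by exact_mod_cast Real.pi_ne_zero
  push_cast
  rw [div_eq_div_iff (mul_ne_zero h5 h4)]
  · ring
  · have : (2 * (Real.pi : ℂ) * ‖horiz ξ‖) ^ 2 + 4 * Real.pi ^ 2 * vert ξ ^ 2 =
      4 * Real.pi ^ 2 * (‖horiz ξ‖ ^ 2 + vert ξ ^ 2) := by ring
    rw [this]
    exact mul_ne_zero (mul_ne_zero (by norm_num) (pow_ne_zero 2 h5)) h4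

theorem measurable_ofReal_sign : Measurable fun z : ℝ => ((SignType.sign z : ℝ) : ℂ) := by
  have e : (fun z : ℝ => ((SignType.sign z : ℝ) : ℂ)) =
      fun z => if 0 < z then 1 else if z < 0 then -1 else 0 := by
    funext z
    rw [sign_apply]
    split_ifs <;> simp
  rw [e]
  exact Measurable.ite measurableSet_Ioi measurable_const
    (Measurable.ite measurableSet_Iio measurable_const measurable_const)

theorem exists_isWienerSymbol_odd (hA : ContDiff ℝ (⊤ : ℕ∞) A) {r R : ℝ} (hr : 0 < r)
    (hAr : ∀ η, ‖η‖ ≤ r → A η = 0) (hAR : ∀ η, R ≤ ‖η‖ → A η = 0) :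
    ∃ C : ℝ≥0, IsWienerSymbol (E := Space) C fun ξ =>
      A (horiz ξ) * (-Complex.I * (vert ξ / (Real.pi * (‖horiz ξ‖ ^ 2 + vert ξ ^ 2)) : ℝ)) := by
  obtain ⟨C, hC⟩ := isWienerSymbol_of_exp_family hA hr hAr hAR measurable_ofReal_sign fun z => by
    rcases lt_trichotomy z 0 with h | h | h
    · simp [sign_neg h]
    · simp [h]
    · simp [sign_pos h]
  refine ⟨C, ?_⟩
  convert hC using 2 with ξ
  by_cases h0 : horiz ξ = 0
  · simp [h0, hAr 0 (by simpa using hr.le)]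
  have hpos : 0 < 2 * Real.pi * ‖horiz ξ‖ := by positivity
  have e' : ∀ (t : Circle) (a b : ℂ), t • (a * b) = a * t • b := fun t a b => by
    simp only [Circle.smul_def, smul_eq_mul]; ring
  simp only [e' _ (A (horiz ξ))]
  rw [integral_const_mul, integral_fourierChar_exp_abs_odd hpos]
  congr 1
  have h4 : (‖horiz ξ‖ ^ 2 + vert ξ ^ 2 : ℂ) ≠ 0 := by
    have : 0 < ‖horiz ξ‖ ^ 2 + vert ξ ^ 2 := by positivity
    exact_mod_cast this.ne'
  have h5 : (Real.pi : ℂ) ≠ 0 := by exact_mod_cast Real.pi_ne_zero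
  push_cast
  rw [mul_div_assoc', div_eq_div_iff (mul_ne_zero h5 h4)]
  · ring
  · have : (2 * (Real.pi : ℂ) * ‖horiz ξ‖) ^ 2 + 4 * Real.pi ^ 2 * vert ξ ^ 2 =
      4 * Real.pi ^ 2 * (‖horiz ξ‖ ^ 2 + vert ξ ^ 2) := by ring
    rw [this]
    exact mul_ne_zero (mul_ne_zero (by norm_num) (pow_ne_zero 2 h5)) h4

end WienerSymbols

/-! ### The horizontally localized inverse Laplacian -/

section ResolventSymbol

theorem exists_annular_cutoff {a b c d : ℝ} (ha : 0 < a) (hab : a < b) (hbc : b < c) (hcd : c < d) :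
    ∃ χ : Plane → ℂ, ContDiff ℝ (⊤ : ℕ∞) χ ∧ (∀ η, b ≤ ‖η‖ → ‖η‖ ≤ c → χ η = 1) ∧
      (∀ η, ‖η‖ ≤ a → χ η = 0) ∧ ∀ η, d ≤ ‖η‖ → χ η = 0 := by
  let f : ContDiffBump (0 : Plane) := ⟨c, d, by linarith, hcd⟩
  let g : ContDiffBump (0 : Plane) := ⟨a, b, ha, hab⟩
  refine ⟨fun η => ((f η * (1 - g η) : ℝ) : ℂ), ?_, fun η h1 h2 => ?_, fun η h => ?_, fun η h => ?_⟩
  · exact Complex.ofRealCLM.contDiff.comp (f.contDiff.mul (contDiff_const.sub g.contDiff))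
  · have hf : f η = 1 := f.one_of_mem_closedBall (by simpa using h2)
    have hg : g η = 0 := g.zero_of_le_dist (by simpa using h1)
    simp [hf, hg]
  · have hg : g η = 1 := g.one_of_mem_closedBall (by simpa using h)
    simp [hg]
  · have hf : f η = 0 := f.zero_of_le_dist (by simpa using h)
    simp [hf]

theorem hasTemperateGrowth_of_contDiff_of_vanish {A : Plane → ℂ} (hA : ContDiff ℝ (⊤ : ℕ∞) A)
    {R : ℝ} (hAR : ∀ η, R ≤ ‖η‖ → A η = 0) : A.HasTemperateGrowth := by
  refine HasCompactSupport.hasTemperateGrowth ?_ hA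
  exact HasCompactSupport.intro (isCompact_closedBall (0 : Plane) R) fun η hη =>
    hAR η (by simpa using (not_le.1 (by simpa using hη)).le)

/-- Composition of a power of the Japanese bracket on `ℝ` with `f`. The resolvent symbols below are
put in this form so that no derivative of a quotient needs estimating. -/
theorem hasTemperateGrowth_inv_one_add_sq {f : Space → ℝ} (hf : f.HasTemperateGrowth) :
    (fun ξ => (((1 + f ξ ^ 2)⁻¹ : ℝ) : ℂ)).HasTemperateGrowth := by
  have h := (Function.hasTemperateGrowth_one_add_norm_sq_rpow ℝ (-1)).comp hf
  have h' := Complex.ofRealCLM.hasTemperateGrowth.comp h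
  convert h' using 1
  funext ξ
  simp [Real.rpow_neg_one]

theorem contDiff_coord (k : Fin 2) : ContDiff ℝ (⊤ : ℕ∞) fun η : Plane => ((η k : ℝ) : ℂ) :=
  Complex.ofRealCLM.contDiff.comp (EuclideanSpace.proj (𝕜 := ℝ) k).contDiff

theorem horiz_apply (ξ : Space) (k : Fin 2) : horiz ξ k = ξ k.castSucc := by
  fin_cases k <;> rfl

theorem IsWienerSymbol.mono {E : Type} [NormedAddCommGroup E] [InnerProductSpace ℝ E]
    [FiniteDimensional ℝ E] [MeasurableSpace E] [BorelSpace E] {C D : ℝ≥0∞} {m : E → ℂ}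
    (h : IsWienerSymbol C m) (hCD : C ≤ D) : IsWienerSymbol D m := by
  obtain ⟨K, h1, h2, h3⟩ := h
  exact ⟨K, h1, h2, h3.trans hCD⟩

/-- The symbol `|ξ|⁻²` of the inverse Laplacian, localized to horizontal frequencies in an annulus:
its products with `ξ_k ξ_l`, `k` horizontal, are Fourier transforms of integrable functions. -/
theorem exists_resolvent_symbol : ∃ (χ : Plane → ℂ) (q : Space → ℂ) (C : ℝ≥0),
    (∀ η, 3 / 4 ≤ ‖η‖ → ‖η‖ ≤ 8 / 3 → χ η = 1) ∧ q.HasTemperateGrowth ∧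
    (∀ ξ, q ξ * ((‖ξ‖ ^ 2 : ℝ) : ℂ) = χ (horiz ξ)) ∧
    ∀ (k : Fin 2) (l : Fin 3), IsWienerSymbol (E := Space) C fun ξ =>
      q ξ * ((ξ k.castSucc : ℝ) : ℂ) * ((ξ l : ℝ) : ℂ) := by
  obtain ⟨χ, hχ, hχ1, hχ0, hχ2⟩ := exists_annular_cutoff (a := 1 / 2) (b := 3 / 4) (c := 8 / 3)
    (d := 4) (by norm_num) (by norm_num) (by norm_num) (by norm_num)
  obtain ⟨θ, hθ, hθ1, hθ0, hθ2⟩ := exists_annular_cutoff (a := 1 / 4) (b := 1 / 2) (c := 4)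
    (d := 5) (by norm_num) (by norm_num) (by norm_num) (by norm_num)
  have hof : ContDiff ℝ (⊤ : ℕ∞) (fun x : ℝ => (x : ℂ)) := Complex.ofRealCLM.contDiff
  have hinv : ∀ η : Plane, id η ≠ 0 →
      ContDiffAt ℝ (⊤ : ℕ∞) (fun η : Plane => ((‖η‖⁻¹ : ℝ) : ℂ)) η := fun η h =>
    hof.contDiffAt.comp η ((contDiffAt_norm ℝ h).inv (norm_ne_zero_iff.2 h))
  -- A smooth version of `1/|η|`, exact on the support of `χ` because `θ = 1` there. It gives
  -- `χ/(|η|²+ζ²) = χρ²/(1+(ζρ)²)`, whose right side visibly has temperate growth in all variables.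
  set ρ : Plane → ℂ := fun η => θ η * ((‖η‖⁻¹ : ℝ) : ℂ) with hρ
  have hρs : ContDiff ℝ (⊤ : ℕ∞) ρ :=
    contDiff_mul_of_vanish hθ (by norm_num) hθ0 contDiff_id hinv
  have hρt : ρ.HasTemperateGrowth :=
    hasTemperateGrowth_of_contDiff_of_vanish hρs (R := 5) fun η h => by simp [hρ, hθ2 η h]
  have hχt : χ.HasTemperateGrowth := hasTemperateGrowth_of_contDiff_of_vanish hχ hχ2
  have hhor : Function.HasTemperateGrowth horiz := horiz.hasTemperateGrowth
  have hvert : Function.HasTemperateGrowth vert := vert.hasTemperateGrowth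
  set y : Space → ℝ := fun ξ => vert ξ * (ρ (horiz ξ)).re with hy
  have hyt : y.HasTemperateGrowth := by
    have h1 : (fun ξ => (ρ (horiz ξ)).re).HasTemperateGrowth :=
      (Complex.reCLM.hasTemperateGrowth.comp hρt).comp hhor
    exact hvert.mul h1
  set q : Space → ℂ := fun ξ => χ (horiz ξ) * (ρ (horiz ξ) ^ 2 * (((1 + y ξ ^ 2)⁻¹ : ℝ) : ℂ))
    with hq
  have hqt : q.HasTemperateGrowth :=
    (hχt.comp hhor).mul (((hρt.comp hhor).pow 2).mul (hasTemperateGrowth_inv_one_add_sq hyt))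
  have hχz : ∀ {η}, χ η ≠ 0 → 1 / 2 ≤ ‖η‖ ∧ ‖η‖ ≤ 4 := fun {η} h =>
    ⟨le_of_not_ge fun h' => h (hχ0 η h'), le_of_not_ge fun h' => h (hχ2 η h')⟩
  have hqχ : ∀ ξ, q ξ * ((‖ξ‖ ^ 2 : ℝ) : ℂ) = χ (horiz ξ) := by
    intro ξ
    by_cases h : χ (horiz ξ) = 0
    · simp [hq, h]
    obtain ⟨h1, h2⟩ := hχz h
    have hpos : 0 < ‖horiz ξ‖ := by linarith
    have hρ1 : ρ (horiz ξ) = ((‖horiz ξ‖⁻¹ : ℝ) : ℂ) := by simp only [hρ, hθ1 _ h1 h2, one_mul]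
    have key : (‖horiz ξ‖⁻¹) ^ 2 * (1 + (vert ξ * ‖horiz ξ‖⁻¹) ^ 2)⁻¹ *
        (‖horiz ξ‖ ^ 2 + vert ξ ^ 2) = 1 := by
      have : (1 + (vert ξ * ‖horiz ξ‖⁻¹) ^ 2) = (‖horiz ξ‖ ^ 2 + vert ξ ^ 2) / ‖horiz ξ‖ ^ 2 := by
        field_simp
      rw [this, inv_div]
      have h3 : ‖horiz ξ‖ ^ 2 + vert ξ ^ 2 ≠ 0 := by positivity
      field_simp
    simp only [hq, hy, hρ1, Complex.ofReal_re]
    rw [mul_assoc, norm_sq_space_eq]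
    rw [← Complex.ofReal_pow, ← Complex.ofReal_mul, ← Complex.ofReal_mul, key]
    simp
  have hqdiv : ∀ ξ, horiz ξ ≠ 0 → q ξ = χ (horiz ξ) * ((‖horiz ξ‖ ^ 2 + vert ξ ^ 2 : ℝ) : ℂ)⁻¹ := by
    intro ξ h
    have h3 : (0 : ℝ) < ‖horiz ξ‖ ^ 2 + vert ξ ^ 2 := by positivity
    rw [← hqχ, norm_sq_space_eq, mul_assoc, mul_inv_cancel₀ (by exact_mod_cast h3.ne'), mul_one]
  have hcoord0 : ∀ (ξ : Space) (k : Fin 2), horiz ξ = 0 → ξ k.castSucc = 0 := fun ξ k h => by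
    rw [← horiz_apply, h]; rfl
  have hW : ∀ (k : Fin 2) (l : Fin 3), ∃ C : ℝ≥0, IsWienerSymbol (E := Space) C fun ξ =>
      q ξ * ((ξ k.castSucc : ℝ) : ℂ) * ((ξ l : ℝ) : ℂ) := by
    intro k l
    rcases Fin.eq_castSucc_or_eq_last l with ⟨l, rfl⟩ | rfl
    -- The factor `π/|η|` compensates the numerator and the constant of the even kernel's transform.
    · set A : Plane → ℂ := fun η => χ η * (((η k : ℝ) : ℂ) * ((η l : ℝ) : ℂ) *
        ((Real.pi : ℂ) * ((‖η‖⁻¹ : ℝ) : ℂ))) with hA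
      have hAs : ContDiff ℝ (⊤ : ℕ∞) A := by
        refine contDiff_mul_of_vanish hχ (by norm_num) hχ0 contDiff_id fun η h => ?_
        exact ((contDiff_coord k).contDiffAt.mul (contDiff_coord l).contDiffAt).mul
          (contDiffAt_const.mul (hinv η h))
      obtain ⟨C, hC⟩ := exists_isWienerSymbol_even hAs (r := 1 / 2) (R := 4) (by norm_num)
        (fun η h => by simp [hA, hχ0 η h]) (fun η h => by simp [hA, hχ2 η h])
      refine ⟨C, ?_⟩
      convert hC using 2 with ξ
      by_cases h0 : horiz ξ = 0
      · simp [h0, hcoord0 ξ _ h0]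
      have h3 : (0 : ℝ) < ‖horiz ξ‖ ^ 2 + vert ξ ^ 2 := by positivity
      have h4 : ((‖horiz ξ‖ ^ 2 + vert ξ ^ 2 : ℝ) : ℂ) ≠ 0 := by exact_mod_cast h3.ne'
      have h5 : (Real.pi : ℂ) ≠ 0 := by exact_mod_cast Real.pi_ne_zero
      have h6 : ((‖horiz ξ‖ : ℝ) : ℂ) ≠ 0 := by exact_mod_cast norm_ne_zero_iff.2 h0
      rw [hqdiv ξ h0]
      simp only [hA, horiz_apply, Complex.ofReal_div, Complex.ofReal_mul, Complex.ofReal_inv]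
      field_simp
    -- With `l` vertical, the factor `ξ_3` comes from the odd kernel; `πi` cancels its constant
    -- `-i/π`.
    · set A : Plane → ℂ := fun η => χ η * (((η k : ℝ) : ℂ) * (Real.pi * Complex.I)) with hA
      have hAs : ContDiff ℝ (⊤ : ℕ∞) A := hχ.mul ((contDiff_coord k).mul contDiff_const)
      obtain ⟨C, hC⟩ := exists_isWienerSymbol_odd hAs (r := 1 / 2) (R := 4) (by norm_num)
        (fun η h => by simp [hA, hχ0 η h]) (fun η h => by simp [hA, hχ2 η h])
      refine ⟨C, ?_⟩
      convert hC using 2 with ξ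
      by_cases h0 : horiz ξ = 0
      · simp [h0, hcoord0 ξ _ h0, hA, hχ0 0 (by simp)]
      have h3 : (0 : ℝ) < ‖horiz ξ‖ ^ 2 + vert ξ ^ 2 := by positivity
      have h4 : ((‖horiz ξ‖ ^ 2 + vert ξ ^ 2 : ℝ) : ℂ) ≠ 0 := by exact_mod_cast h3.ne'
      have h5 : (Real.pi : ℂ) ≠ 0 := by exact_mod_cast Real.pi_ne_zero
      have h7 : ξ (Fin.last 2) = vert ξ := rfl
      rw [hqdiv ξ h0, h7]
      simp only [hA, horiz_apply, Complex.ofReal_div, Complex.ofReal_mul]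
      field_simp
      rw [Complex.I_sq]
      ring
  choose C hC using hW
  refine ⟨χ, q, ∑ k, ∑ l, C k l, hχ1, hqt, hqχ, fun k l => (hC k l).mono ?_⟩
  rw [ENNReal.coe_le_coe]
  exact (Finset.single_le_sum (f := fun l => C k l) (fun _ _ => zero_le)
    (Finset.mem_univ l)).trans (Finset.single_le_sum (f := fun k => ∑ l, C k l)
    (fun _ _ => zero_le) (Finset.mem_univ k))

end ResolventSymbol

/-! ### From square integrability on a period to boundedness -/

section SquareIntegrableBound

theorem lintegral_enorm_fourierInv_sq (σ : 𝓢(Plane, ℂ)) :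
    ∫⁻ x, ‖(𝓕⁻ σ : 𝓢(Plane, ℂ)) x‖ₑ ^ (2 : ℝ) = ENNReal.ofReal (∫ η, ‖σ η‖ ^ 2) := by
  have h := SchwartzMap.integral_norm_sq_fourier (𝓕⁻ σ : 𝓢(Plane, ℂ))
  rw [FourierTransform.fourier_fourierInv_eq] at h
  have hi : Integrable fun x => ‖(𝓕⁻ σ : 𝓢(Plane, ℂ)) x‖ ^ 2 :=
    ((𝓕⁻ σ : 𝓢(Plane, ℂ)).memLp 2 volume).integrable_norm_pow two_ne_zero
  rw [h, ofReal_integral_eq_lintegral_ofReal hi (Eventually.of_forall fun x => by positivity)]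
  refine lintegral_congr fun x => ?_
  rw [ENNReal.ofReal_pow (norm_nonneg _), ofReal_norm, ENNReal.rpow_ofNat]

theorem lintegral_exp_neg_abs : ∫⁻ z : ℝ, ENNReal.ofReal (Real.exp (-|z|)) = 2 := by
  have h1 : ∫ z : ℝ, Real.exp (-|z|) = 2 := by
    rw [integral_comp_abs (f := fun z => Real.exp (-z)), integral_exp_neg_Ioi_zero, mul_one]
  have h2 : Integrable fun z : ℝ => Real.exp (-|z|) := by
    by_contra h
    rw [integral_undef h] at h1
    norm_num at h1
  rw [← ofReal_integral_eq_lintegral_ofReal h2 (Eventually.of_forall fun z => by positivity), h1]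
  simp

/-- Multipliers with symbol `σ(ξ_h) b̂(ξ_3)`, with `b` exponentially decaying, map periodic
distributions that are square integrable over one period to bounded functions. -/
theorem exists_lpNormOn_top_le_strip_two : ∃ C : ℝ≥0, ∀ (σ : 𝓢(Plane, ℂ)) (b : ℝ → ℂ)
    (m : Space → ℂ) (u : 𝓢'(Space, ℂ)), Measurable b → (∀ z, ‖b z‖ ≤ Real.exp (-|z|)) →
    m.HasTemperateGrowth →
    (∀ ξ, m ξ = σ (horiz ξ) * ∫ z, Real.fourierChar (-(z * vert ξ)) • b z) →
    ZPeriodic u → lpNormOn strip 2 u < ∞ →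
    lpNormOn Set.univ ∞ (fourierMultiplierCLM ℂ m u) ≤
      C * ENNReal.ofReal (√(∫ η, ‖σ η‖ ^ 2)) * lpNormOn strip 2 u := by
  obtain ⟨C, hC⟩ := exists_lintegral_exp_mul_le
  refine ⟨NNReal.sqrt (2 * C), fun σ b m u hb hbe hm hmb hu hfin => ?_⟩
  obtain ⟨f, hf⟩ := exists_representedBy_of_lpNormOn_lt_top hfin
  set κ : 𝓢(Plane, ℂ) := 𝓕⁻ σ with hκ
  set a : ℝ → 𝓢(Plane, ℂ) := fun z => b z • σ with ha
  have hinva : ∀ z x, (𝓕⁻ (a z) : 𝓢(Plane, ℂ)) x = b z * κ x := fun z x => by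
    simp only [ha, FourierTransform.fourierInv_smul, _root_.smul_apply, smul_eq_mul, hκ]
  have hmeas : Measurable fun p : ℝ × Plane => a p.1 p.2 :=
    (hb.comp measurable_fst).mul (σ.continuous.measurable.comp measurable_snd)
  have hbe' : ∀ z, ‖b z‖ₑ ≤ ENNReal.ofReal (Real.exp (-|z|)) := fun z => by
    rw [← ofReal_norm]
    exact ENNReal.ofReal_le_ofReal (hbe z)
  have hκfin : ∫⁻ x, ‖κ x‖ₑ < ∞ := κ.integrable.2
  obtain ⟨hK, -⟩ := integrable_sliceKernel (a := a) hmeas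
    (B := fun z => ENNReal.ofReal (Real.exp (-|z|)) * ∫⁻ x, ‖κ x‖ₑ)
    (C := 2 * ∫⁻ x, ‖κ x‖ₑ) (ENNReal.mul_ne_top (by simp) hκfin.ne)
    (fun z => by
      simp only [hinva, enorm_mul]
      rw [lintegral_const_mul' _ _ enorm_ne_top]
      exact mul_le_mul_left (hbe' z) _)
    (by rw [lintegral_mul_const' _ _ hκfin.ne, lintegral_exp_neg_abs])
  have hFK : ∀ ξ, 𝓕 (sliceKernel a) ξ = m ξ := fun ξ => by
    rw [fourier_sliceKernel hK, hmb, ← integral_const_mul]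
    refine integral_congr_ae (Eventually.of_forall fun z => ?_)
    simp only [ha, _root_.smul_apply, smul_eq_mul, Circle.smul_def]
    ring
  refine lpNormOn_top_fourierMultiplier_le hm hK hFK hf fun x => ?_
  -- The exponential is split evenly for Cauchy-Schwarz. One half makes the horizontal kernel square
  -- integrable on space, with the factor `2 = ∫ e^{-|z|}` and Plancherel; the other makes the
  -- square integral of the periodic `f` converge. Hence the constant `√(2C)`.
  set w : Space → ℝ≥0∞ := fun y => ENNReal.ofReal (Real.exp (-|vert x - vert y| / 2)) with hw
  have hwm : Measurable w := by
    have : Continuous fun y : Space => Real.exp (-|vert x - vert y| / 2) := by fun_prop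
    exact this.measurable.ennreal_ofReal
  have hw2 : ∀ y, w y * w y = ENNReal.ofReal (Real.exp (-|vert x - vert y|)) := fun y => by
    rw [hw, ← ENNReal.ofReal_mul (by positivity), ← Real.exp_add]
    congr 2
    ring
  have hκm : Measurable fun y : Space => ‖κ (horiz (x - y))‖ₑ := by
    have : Continuous fun y : Space => κ (horiz (x - y)) :=
      κ.continuous.comp (horiz.continuous.comp (continuous_const.sub continuous_id))
    exact this.measurable.enorm
  have hle : ∀ y, ‖sliceKernel a (x - y)‖ₑ * ‖f y‖ₑ ≤
      ((fun y => ‖κ (horiz (x - y))‖ₑ * w y) * fun y => w y * ‖f y‖ₑ) y := by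
    intro y
    have h1 : ‖sliceKernel a (x - y)‖ₑ ≤ w y * w y * ‖κ (horiz (x - y))‖ₑ := by
      rw [hw2, sliceKernel, hinva, enorm_mul, map_sub]
      exact mul_le_mul_left (hbe' _) _
    calc ‖sliceKernel a (x - y)‖ₑ * ‖f y‖ₑ ≤ w y * w y * ‖κ (horiz (x - y))‖ₑ * ‖f y‖ₑ :=
          mul_le_mul_left h1 _
      _ = _ := by simp only [Pi.mul_apply]; ring
  refine (lintegral_mono hle).trans ?_
  refine (ENNReal.lintegral_mul_le_Lp_mul_Lq volume Real.HolderConjugate.two_two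
    (hκm.mul hwm).aemeasurable (hwm.aemeasurable.mul hf.1.enorm)).trans ?_
  have hF : ∫⁻ y, (‖κ (horiz (x - y))‖ₑ * w y) ^ (2 : ℝ) =
      2 * ENNReal.ofReal (∫ η, ‖σ η‖ ^ 2) := by
    have h1 : ∀ y, (‖κ (horiz (x - y))‖ₑ * w y) ^ (2 : ℝ) =
        (fun y => ‖κ (horiz y)‖ₑ ^ (2 : ℝ) * ENNReal.ofReal (Real.exp (-|vert y|))) (x - y) := by
      intro y
      rw [ENNReal.mul_rpow_of_nonneg _ _ (by norm_num), ENNReal.rpow_ofNat (w y), sq, hw2, map_sub]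
      simp only [map_sub]
    simp only [h1]
    rw [lintegral_sub_left_eq_self
      (fun y => ‖κ (horiz y)‖ₑ ^ (2 : ℝ) * ENNReal.ofReal (Real.exp (-|vert y|))) x,
      lintegral_space_eq fun p : Plane × ℝ =>
        ‖κ p.1‖ₑ ^ (2 : ℝ) * ENNReal.ofReal (Real.exp (-|p.2|))]
    have hc : Continuous fun z : ℝ => Real.exp (-|z|) := by fun_prop
    rw [lintegral_prod_mul (f := fun x => ‖κ x‖ₑ ^ (2 : ℝ))
      (g := fun z => ENNReal.ofReal (Real.exp (-|z|)))
      (κ.continuous.measurable.enorm.pow_const _).aemeasurable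
      hc.measurable.ennreal_ofReal.aemeasurable, lintegral_exp_neg_abs,
      lintegral_enorm_fourierInv_sq, mul_comm]
  have hG : ∫⁻ y, (w y * ‖f y‖ₑ) ^ (2 : ℝ) ≤ C * ∫⁻ y in strip, ‖f y‖ₑ ^ (2 : ℝ) := by
    have h1 : ∀ y, (w y * ‖f y‖ₑ) ^ (2 : ℝ) =
        ENNReal.ofReal (Real.exp (-|vert x - vert y|)) * ‖f y‖ₑ ^ (2 : ℝ) := by
      intro y
      rw [ENNReal.mul_rpow_of_nonneg _ _ (by norm_num), ENNReal.rpow_ofNat (w y), sq, hw2]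
    simp only [h1]
    refine hC (fun y => ‖f y‖ₑ ^ (2 : ℝ)) (hf.1.enorm.pow_const _) ?_ _
    filter_upwards [hf.ae_periodic hu] with y hy k
    rw [hy k]
  have hL : lpNormOn strip 2 u = (∫⁻ y in strip, ‖f y‖ₑ ^ (2 : ℝ)) ^ (1 / (2 : ℝ)) := by
    rw [hf.lpNormOn_eq, eLpNorm_eq_lintegral_rpow_enorm_toReal (by norm_num) (by norm_num)]
    simp
  simp only [Pi.mul_apply]
  rw [hF, hL]
  calc (2 * ENNReal.ofReal (∫ η, ‖σ η‖ ^ 2)) ^ (1 / (2 : ℝ)) *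
        (∫⁻ y, (w y * ‖f y‖ₑ) ^ (2 : ℝ)) ^ (1 / (2 : ℝ))
      ≤ (2 * ENNReal.ofReal (∫ η, ‖σ η‖ ^ 2)) ^ (1 / (2 : ℝ)) *
        (C * ∫⁻ y in strip, ‖f y‖ₑ ^ (2 : ℝ)) ^ (1 / (2 : ℝ)) := by
        gcongr
    _ = (2 * C : ℝ≥0∞) ^ (1 / (2 : ℝ)) * ENNReal.ofReal (∫ η, ‖σ η‖ ^ 2) ^ (1 / (2 : ℝ)) *
        (∫⁻ y in strip, ‖f y‖ₑ ^ (2 : ℝ)) ^ (1 / (2 : ℝ)) := by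
        simp only [ENNReal.mul_rpow_of_nonneg _ _ (show (0 : ℝ) ≤ 1 / 2 by norm_num)]
        ring
    _ = _ := by
        congr 2
        · rw [NNReal.sqrt_eq_rpow, ENNReal.coe_rpow_of_nonneg _ (by norm_num)]
          push_cast
          rfl
        · rw [Real.sqrt_eq_rpow, ENNReal.ofReal_rpow_of_nonneg
            (integral_nonneg fun η => by positivity) (by norm_num)]

end SquareIntegrableBound

/-! ### The ring of symbols acting on distributions, and the Biot-Savart law -/

section SymbolModule

variable (E : Type) [NormedAddCommGroup E] [InnerProductSpace ℝ E] [FiniteDimensional ℝ E]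
  [MeasurableSpace E] [BorelSpace E]

/-- The ring of symbols of temperate growth. -/
def temperateSymbols : Subring (E → ℂ) where
  carrier := {f | f.HasTemperateGrowth}
  mul_mem' hf hg := hf.mul hg
  one_mem' := Function.HasTemperateGrowth.const 1
  add_mem' hf hg := hf.add hg
  zero_mem' := Function.HasTemperateGrowth.zero
  neg_mem' hf := hf.neg

variable {E}

theorem fourierMultiplier_add_symbol {f g : E → ℂ} (hf : f.HasTemperateGrowth)
    (hg : g.HasTemperateGrowth) (u : 𝓢'(E, ℂ)) :
    fourierMultiplierCLM ℂ (f + g) u =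
      fourierMultiplierCLM ℂ f u + fourierMultiplierCLM ℂ g u := by
  simp only [fourierMultiplierCLM_apply]
  rw [smulLeftCLM_add hf hg, _root_.add_apply, FourierTransform.fourierInv_add]

/-- Tempered distributions form a module over the ring of symbols, acting as Fourier multipliers. -/
instance symbolModule : Module (temperateSymbols E) 𝓢'(E, ℂ) where
  smul f u := fourierMultiplierCLM ℂ (f : E → ℂ) u
  one_smul u := by
    change fourierMultiplierCLM ℂ (fun _ : E => (1 : ℂ)) u = u
    rw [fourierMultiplierCLM_const]
    simp
  mul_smul f g u := by
    change fourierMultiplierCLM ℂ ((f : E → ℂ) * (g : E → ℂ)) u =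
      fourierMultiplierCLM ℂ (f : E → ℂ) (fourierMultiplierCLM ℂ (g : E → ℂ) u)
    rw [fourierMultiplierCLM_fourierMultiplierCLM_apply g.2 f.2, mul_comm]
  smul_zero f := map_zero _
  smul_add f u v := map_add _ u v
  add_smul f g u := fourierMultiplier_add_symbol f.2 g.2 u
  zero_smul u := by
    change fourierMultiplierCLM ℂ (fun _ : E => (0 : ℂ)) u = 0
    rw [fourierMultiplierCLM_const]
    simp

theorem symbol_smul_def (f : temperateSymbols E) (u : 𝓢'(E, ℂ)) :
    f • u = fourierMultiplierCLM ℂ (f : E → ℂ) u := rfl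

/-- The Biot-Savart law, localized in frequency by `b`: `q` is an inverse of the Laplacian on the
support of `b`. -/
theorem localized_biotSavart {R M : Type} [CommRing R] [AddCommGroup M] [Module R M]
    {b q d₀ d₁ d₂ : R} (hq : b * q * (d₀ ^ 2 + d₁ ^ 2 + d₂ ^ 2) = b) (k : R) {v₀ v₁ v₂ : M}
    (hdiv : d₀ • v₀ + d₁ • v₁ + d₂ • v₂ = 0) :
    b • k • v₀ = (q * k * d₂) • b • (d₂ • v₀ - d₀ • v₂) -
      (q * k * d₁) • b • (d₀ • v₁ - d₁ • v₀) := by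
  have h1 : b • k • v₀ = (b * q * (d₀ ^ 2 + d₁ ^ 2 + d₂ ^ 2)) • k • v₀ := by rw [hq]
  -- The divergence replaces `d₀² v₀` by `-d₀(d₁v₁ + d₂v₂)`, which completes the two curl
  -- components; what is left is an identity in the module.
  have h2 : (b * q * k * d₀) • (d₀ • v₀ + d₁ • v₁ + d₂ • v₂) = 0 := by rw [hdiv, smul_zero]
  rw [h1, ← sub_eq_zero, ← h2]
  module

/-- The localized Biot-Savart law under cyclic permutations of the indices, combined with Young's
inequality. It is stated for arbitrary symbols `d` so that it applies both on space and, with the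
vertical derivative replaced by a constant, on the plane of each Fourier mode. -/
theorem lpNormOn_top_gradient_le {C : ℝ≥0∞} (hC : C ≠ 0) {b q k : temperateSymbols E}
    {d : Fin 3 → temperateSymbols E} (hq : b * q * (d 0 ^ 2 + d 1 ^ 2 + d 2 ^ 2) = b)
    (hW : ∀ l, IsWienerSymbol C ((q * k * d l : temperateSymbols E) : E → ℂ))
    {v Ω : Fin 3 → 𝓢'(E, ℂ)} (hdiv : d 0 • v 0 + d 1 • v 1 + d 2 • v 2 = 0)
    (h0 : Ω 0 = d 1 • v 2 - d 2 • v 1) (h1 : Ω 1 = d 2 • v 0 - d 0 • v 2)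
    (h2 : Ω 2 = d 0 • v 1 - d 1 • v 0) (i : Fin 3) :
    lpNormOn Set.univ ∞ (b • k • v i) ≤ C * ∑ m, lpNormOn Set.univ ∞ (b • Ω m) := by
  have key : ∀ l m l' m', lpNormOn Set.univ ∞
      ((q * k * d l) • b • Ω m - (q * k * d l') • b • Ω m') ≤
      C * (lpNormOn Set.univ ∞ (b • Ω m) + lpNormOn Set.univ ∞ (b • Ω m')) := by
    intro l m l' m'
    refine (lpNormOn_sub_le _ le_top _ _).trans ?_
    rw [mul_add]
    exact add_le_add ((hW l).lpNormOn_top_le (q * k * d l).2 hC _)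
      ((hW l').lpNormOn_top_le (q * k * d l').2 hC _)
  have hq1 : b * q * (d 1 ^ 2 + d 2 ^ 2 + d 0 ^ 2) = b := by linear_combination hq
  have hq2 : b * q * (d 2 ^ 2 + d 0 ^ 2 + d 1 ^ 2) = b := by linear_combination hq
  have hdiv1 : d 1 • v 1 + d 2 • v 2 + d 0 • v 0 = 0 := by rw [← hdiv]; abel
  have hdiv2 : d 2 • v 2 + d 0 • v 0 + d 1 • v 1 = 0 := by rw [← hdiv]; abel
  rw [Fin.sum_univ_three]
  fin_cases i
  · have e := localized_biotSavart hq k hdiv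
    rw [← h1, ← h2] at e
    change lpNormOn _ _ (b • k • v 0) ≤ _
    rw [e]
    refine (key _ _ _ _).trans (mul_le_mul_right ?_ _)
    rw [add_assoc]
    exact le_add_self
  · have e := localized_biotSavart hq1 k hdiv1
    rw [← h2, ← h0] at e
    change lpNormOn _ _ (b • k • v 1) ≤ _
    rw [e]
    refine (key _ _ _ _).trans (mul_le_mul_right ?_ _)
    rw [add_comm (lpNormOn _ _ (b • Ω 2)), add_right_comm]
    exact le_self_add
  · have e := localized_biotSavart hq2 k hdiv2
    rw [← h0, ← h1] at e
    change lpNormOn _ _ (b • k • v 2) ≤ _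
    rw [e]
    exact (key _ _ _ _).trans (mul_le_mul_right le_self_add _)

end SymbolModule

/-! ### Symbols of derivatives and their restriction to a Fourier mode -/

section Symbols

/-- The symbol `2πi ξ_l` of `∂_l`. -/
def derivSymbol (l : Fin 3) : temperateSymbols Space :=
  ⟨fun ξ => 2 * Real.pi * Complex.I * ((ξ l : ℝ) : ℂ), by
    have h1 : Function.HasTemperateGrowth fun ξ : Space => (ξ l : ℝ) :=
      (EuclideanSpace.proj (𝕜 := ℝ) l : Space →L[ℝ] ℝ).hasTemperateGrowth
    exact (Function.HasTemperateGrowth.const _).mul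
      (Complex.ofRealCLM.hasTemperateGrowth.comp h1)⟩

theorem fourierMultiplier_const_mul {E : Type} [NormedAddCommGroup E] [InnerProductSpace ℝ E]
    [FiniteDimensional ℝ E] [MeasurableSpace E] [BorelSpace E] {f : E → ℂ}
    (hf : f.HasTemperateGrowth) (c : ℂ) (u : 𝓢'(E, ℂ)) :
    fourierMultiplierCLM ℂ (fun ξ => c * f ξ) u = c • fourierMultiplierCLM ℂ f u := by
  have h := fourierMultiplierCLM_smul (F := ℂ) hf c
  exact congrArg (fun T : 𝓢'(E, ℂ) →L[ℂ] 𝓢'(E, ℂ) => T u) h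

theorem pderiv_eq_smul (l : Fin 3) (u : 𝓢'(Space, ℂ)) : pderiv l u = derivSymbol l • u := by
  rw [pderiv, lineDeriv_eq_fourierMultiplierCLM, symbol_smul_def, derivSymbol,
    fourierMultiplier_const_mul]
  · congr 3
    funext ξ
    simp [EuclideanSpace.inner_single_right]
  · have h1 : Function.HasTemperateGrowth fun ξ : Space => (ξ l : ℝ) :=
      (EuclideanSpace.proj (𝕜 := ℝ) l : Space →L[ℝ] ℝ).hasTemperateGrowth
    exact Complex.ofRealCLM.hasTemperateGrowth.comp h1

/-- The embedding of horizontal frequencies at the vertical frequency `n`. -/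
def freqSlice (n : ℤ) (η : Plane) : Space := splitEquiv.symm (η, n / (2 * Real.pi))

theorem horiz_freqSlice (n : ℤ) (η : Plane) : horiz (freqSlice n η) = η :=
  horiz_splitEquiv_symm _

theorem freqSlice_castSucc (n : ℤ) (η : Plane) (k : Fin 2) : freqSlice n η k.castSucc = η k := by
  rw [← horiz_apply, horiz_freqSlice]

theorem freqSlice_two (n : ℤ) (η : Plane) : freqSlice n η 2 = n / (2 * Real.pi) := by
  change vert (freqSlice n η) = _
  exact vert_splitEquiv_symm (η, (n : ℝ) / (2 * Real.pi))

theorem hasTemperateGrowth_freqSlice (n : ℤ) : (freqSlice n).HasTemperateGrowth := by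
  let L : Plane →L[ℝ] Space := LinearMap.toContinuousLinearMap
    { toFun := fun x => !₂[x 0, x 1, 0]
      map_add' := fun x y => by ext i; fin_cases i <;> simp
      map_smul' := fun c x => by ext i; fin_cases i <;> simp }
  have h : freqSlice n = fun η => L η + !₂[0, 0, n / (2 * Real.pi)] := by
    funext η
    ext i
    fin_cases i <;> simp [freqSlice, splitEquiv, L]
  rw [h]
  exact L.hasTemperateGrowth.add (Function.HasTemperateGrowth.const _)

/-- The restriction of a symbol to the vertical frequency `n`. -/
def sliceSymbol (n : ℤ) : temperateSymbols Space →+* temperateSymbols Plane where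
  toFun f := ⟨fun η => (f : Space → ℂ) (freqSlice n η), f.2.comp (hasTemperateGrowth_freqSlice n)⟩
  map_one' := rfl
  map_mul' _ _ := rfl
  map_zero' := rfl
  map_add' _ _ := rfl

end Symbols

/-! ### Fourier coefficients of derivatives -/

section FourierCoefficients

theorem zFourierCoeff_apply (n : ℤ) (u : 𝓢'(Space, ℂ)) (f : 𝓢(Plane, ℂ)) :
    zFourierCoeff n u f = ((1 / (2 * Real.pi) : ℝ) : ℂ) * u (tensorCLM (modeTest n) f) := rfl

theorem zFourierCoeff_add (n : ℤ) (u v : 𝓢'(Space, ℂ)) :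
    zFourierCoeff n (u + v) = zFourierCoeff n u + zFourierCoeff n v := by
  ext f
  simp only [zFourierCoeff_apply, _root_.add_apply, mul_add]

theorem zFourierCoeff_sub (n : ℤ) (u v : 𝓢'(Space, ℂ)) :
    zFourierCoeff n (u - v) = zFourierCoeff n u - zFourierCoeff n v := by
  ext f
  simp only [zFourierCoeff_apply, _root_.sub_apply, mul_sub]

theorem zFourierCoeff_zero (n : ℤ) : zFourierCoeff n (0 : 𝓢'(Space, ℂ)) = 0 := by
  ext f
  simp [zFourierCoeff_apply]

theorem lineDeriv_tensorCLM (g : 𝓢(ℝ, ℂ)) (f : 𝓢(Plane, ℂ)) (e : Space) :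
    (∂_{e} (tensorCLM g f) : 𝓢(Space, ℂ)) =
      tensorCLM g (∂_{horiz e} f) + ((vert e : ℝ) : ℂ) • tensorCLM (SchwartzMap.derivCLM ℂ ℂ g) f := by
  ext x
  rw [SchwartzMap.lineDerivOp_apply_eq_fderiv]
  have hf : HasFDerivAt (fun x : Space => f (horiz x)) ((fderiv ℝ f (horiz x)).comp horiz) x :=
    (f.differentiable (horiz x)).hasFDerivAt.comp x horiz.hasFDerivAt
  have hg : HasFDerivAt (fun x : Space => g (vert x)) ((fderiv ℝ g (vert x)).comp vert) x :=
    (g.differentiable (vert x)).hasFDerivAt.comp x vert.hasFDerivAt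
  have h := hf.mul hg
  have e1 : (tensorCLM g f : Space → ℂ) = (fun x => f (horiz x)) * fun x => g (vert x) := rfl
  rw [e1, h.fderiv]
  have e2 : fderiv ℝ g (vert x) (vert e) = ((vert e : ℝ) : ℂ) * deriv g (vert x) := by
    rw [fderiv_eq_smul_deriv, Complex.real_smul]
  simp only [_root_.add_apply, _root_.smul_apply, tensorCLM_apply,
    SchwartzMap.lineDerivOp_apply_eq_fderiv, SchwartzMap.derivCLM_apply, smul_eq_mul,
    ContinuousLinearMap.comp_apply, e2]
  ring

/-- The derivative of the transition function defining the cutoff, modulated. -/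
def transitionFun (n : ℤ) (z : ℝ) : ℂ :=
  (((2 * Real.pi)⁻¹ * deriv Real.smoothTransition (z / (2 * Real.pi)) : ℝ) : ℂ) *
    Complex.exp (-(Complex.I * n * z))

theorem deriv_smoothTransition_eq_zero {t : ℝ} (ht : t ∉ Set.Icc (0 : ℝ) 1) :
    deriv Real.smoothTransition t = 0 := by
  rw [Set.mem_Icc, not_and_or, not_le, not_le] at ht
  rcases ht with h | h
  · have : Real.smoothTransition =ᶠ[𝓝 t] fun _ => 0 := by
      filter_upwards [Iio_mem_nhds h] with s hs using Real.smoothTransition.zero_of_nonpos hs.le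
    rw [this.deriv_eq, deriv_const]
  · have : Real.smoothTransition =ᶠ[𝓝 t] fun _ => 1 := by
      filter_upwards [Ioi_mem_nhds h] with s hs using Real.smoothTransition.one_of_one_le hs.le
    rw [this.deriv_eq, deriv_const]

theorem transitionFun_hasCompactSupport (n : ℤ) : HasCompactSupport (transitionFun n) := by
  have hp : 0 < 2 * Real.pi := by positivity
  refine HasCompactSupport.intro (K := Set.Icc 0 (2 * Real.pi)) isCompact_Icc fun z hz => ?_
  have h : z / (2 * Real.pi) ∉ Set.Icc (0 : ℝ) 1 := fun h => hz ⟨by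
    have := mul_nonneg h.1 hp.le
    rwa [div_mul_cancel₀ _ hp.ne'] at this, by
    have := h.2
    rwa [div_le_one hp] at this⟩
  simp [transitionFun, deriv_smoothTransition_eq_zero h]

theorem transitionFun_contDiff (n : ℤ) : ContDiff ℝ (⊤ : ℕ∞) (transitionFun n) := by
  have h0 : ContDiff ℝ (⊤ : ℕ∞) (deriv Real.smoothTransition) :=
    (contDiff_infty_iff_deriv.1 Real.smoothTransition.contDiff).2
  have h : ContDiff ℝ (⊤ : ℕ∞) fun z : ℝ =>
      (2 * Real.pi)⁻¹ * deriv Real.smoothTransition (z / (2 * Real.pi)) :=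
    contDiff_const.mul (h0.comp (by fun_prop))
  have h' := Complex.ofRealCLM.contDiff.comp h
  have h'' : ContDiff ℝ (⊤ : ℕ∞) (fun z : ℝ => (z : ℂ)) := Complex.ofRealCLM.contDiff
  exact h'.mul (by fun_prop)

/-- `transitionFun` as a Schwartz function. -/
def transitionTest (n : ℤ) : 𝓢(ℝ, ℂ) :=
  (transitionFun_hasCompactSupport n).toSchwartzMap (transitionFun_contDiff n)

/-- The cutoff is a smooth step minus its translate, so the terms from its derivative are a
translate by one period minus the function itself; the exponential does not see the translation. A
periodic distribution annihilates this difference. -/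
theorem deriv_modeTest (n : ℤ) : SchwartzMap.derivCLM ℂ ℂ (modeTest n) =
    SchwartzMap.compSubConstCLM ℂ (-(2 * Real.pi)) (transitionTest n) - transitionTest n -
      (Complex.I * n) • modeTest n := by
  have hp : 2 * Real.pi ≠ 0 := by positivity
  ext z
  rw [SchwartzMap.derivCLM_apply]
  have hS : ∀ t, HasDerivAt Real.smoothTransition (deriv Real.smoothTransition t) t := fun t =>
    ((Real.smoothTransition.contDiff (n := 1)).differentiable one_ne_zero t).hasDerivAt
  have hlin : HasDerivAt (fun z : ℝ => z / (2 * Real.pi)) (2 * Real.pi)⁻¹ z := by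
    simpa using (hasDerivAt_id z).div_const (2 * Real.pi)
  have h1 : HasDerivAt periodCutoff
      (deriv Real.smoothTransition (z / (2 * Real.pi) + 1) * (2 * Real.pi)⁻¹ -
        deriv Real.smoothTransition (z / (2 * Real.pi)) * (2 * Real.pi)⁻¹) z :=
    ((hS _).comp z (hlin.add_const 1)).sub ((hS _).comp z hlin)
  have h2 : HasDerivAt (fun z : ℝ => Complex.exp (-(Complex.I * n * z)))
      (Complex.exp (-(Complex.I * n * z)) * -(Complex.I * n * 1)) z :=
    ((Complex.ofRealCLM.hasDerivAt.const_mul _).neg).cexp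
  have h3 := h1.ofReal_comp.mul h2
  have e2 : HasDerivAt (modeTest n) _ z := h3
  rw [e2.deriv]
  have e3 : Complex.exp (-(Complex.I * n * ((z - -(2 * Real.pi) : ℝ) : ℂ))) =
      Complex.exp (-(Complex.I * n * z)) := by
    have : -(Complex.I * n * ((z - -(2 * Real.pi) : ℝ) : ℂ)) =
        -(Complex.I * n * z) + ((-n : ℤ) : ℂ) * (2 * Real.pi * Complex.I) := by
      push_cast; ring
    rw [this, Complex.exp_add, Complex.exp_int_mul_two_pi_mul_I, mul_one]
  have e4 : (z - -(2 * Real.pi)) / (2 * Real.pi) = z / (2 * Real.pi) + 1 := by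
    field_simp
    ring
  have e5 : (SchwartzMap.compSubConstCLM ℂ (-(2 * Real.pi)) (transitionTest n)) z =
      (((2 * Real.pi)⁻¹ * deriv Real.smoothTransition (z / (2 * Real.pi) + 1) : ℝ) : ℂ) *
        Complex.exp (-(Complex.I * n * z)) := by
    rw [SchwartzMap.compSubConstCLM_apply]
    change transitionFun n _ = _
    rw [transitionFun, e3, e4]
  have e6 : (transitionTest n) z = transitionFun n z := rfl
  have e7 : (modeTest n) z = ((periodCutoff z : ℝ) : ℂ) * Complex.exp (-(Complex.I * n * z)) := rfl
  simp only [_root_.sub_apply, _root_.smul_apply, e5, e6, e7, transitionFun, smul_eq_mul]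
  push_cast
  ring

/-- Horizontal derivatives pass through the pairing in `z`. For the vertical one, periodicity kills
the cutoff terms and leaves multiplication by `in`, the value of `2πiξ_3` at `ξ_3 = n/(2π)`. -/
theorem zFourierCoeff_pderiv {u : 𝓢'(Space, ℂ)} (hu : ZPeriodic u) (n : ℤ) (l : Fin 3) :
    zFourierCoeff n (pderiv l u) = sliceSymbol n (derivSymbol l) • zFourierCoeff n u := by
  rcases Fin.eq_castSucc_or_eq_last l with ⟨k, rfl⟩ | rfl
  · have h1 : sliceSymbol n (derivSymbol k.castSucc) • zFourierCoeff n u =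
        ∂_{(EuclideanSpace.single k (1 : ℝ) : Plane)} (zFourierCoeff n u) := by
      rw [lineDeriv_eq_fourierMultiplierCLM, symbol_smul_def, ← fourierMultiplier_const_mul]
      · congr 2
        funext η
        simp [sliceSymbol, derivSymbol, freqSlice_castSucc, EuclideanSpace.inner_single_right]
      · have h1 : Function.HasTemperateGrowth fun η : Plane =>
            (inner ℝ η (EuclideanSpace.single k (1 : ℝ)) : ℝ) := by fun_prop
        exact Complex.ofRealCLM.hasTemperateGrowth.comp h1
    rw [h1]
    ext f
    rw [zFourierCoeff_apply, pderiv, lineDerivOp_apply_apply, lineDerivOp_apply_apply,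
      zFourierCoeff_apply, lineDeriv_tensorCLM]
    have e1 : horiz (EuclideanSpace.single k.castSucc (1 : ℝ)) = EuclideanSpace.single k 1 := by
      ext i; fin_cases k <;> fin_cases i <;> simp [horiz]
    have e2 : vert (EuclideanSpace.single k.castSucc (1 : ℝ)) = 0 := by
      fin_cases k <;> simp [vert]
    rw [e1, e2]
    simp
  · have h1 : sliceSymbol n (derivSymbol (Fin.last 2)) • zFourierCoeff n u =
        (Complex.I * n) • zFourierCoeff n u := by
      have e : ((sliceSymbol n (derivSymbol (Fin.last 2)) : temperateSymbols Plane) : Plane → ℂ) =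
          fun _ => Complex.I * n := by
        funext η
        have h2 : freqSlice n η (Fin.last 2) = n / (2 * Real.pi) := freqSlice_two n η
        have h5 : (Real.pi : ℂ) ≠ 0 := by exact_mod_cast Real.pi_ne_zero
        simp only [sliceSymbol, derivSymbol, RingHom.coe_mk, MonoidHom.coe_mk, OneHom.coe_mk, h2]
        push_cast
        field_simp
      rw [symbol_smul_def, e, fourierMultiplierCLM_const]
      rfl
    rw [h1]
    ext f
    have e1 : horiz (EuclideanSpace.single (Fin.last 2) (1 : ℝ)) = 0 := by
      ext i; fin_cases i <;> simp [horiz]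
    have e2 : vert (EuclideanSpace.single (Fin.last 2) (1 : ℝ)) = 1 := by
      simp [vert]
    have hper : u (tensorCLM (SchwartzMap.compSubConstCLM ℂ (-(2 * Real.pi)) (transitionTest n)) f)
        = u (tensorCLM (transitionTest n) f) := by
      rw [← hu]
      congr 1
      ext x
      rw [SchwartzMap.compSubConstCLM_apply, tensorCLM_apply, tensorCLM_apply,
        SchwartzMap.compSubConstCLM_apply, map_sub horiz, map_sub vert]
      have e3 : horiz (EuclideanSpace.single (2 : Fin 3) (2 * Real.pi)) = 0 := by
        ext i; fin_cases i <;> simp [horiz]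
      have e4 : vert (EuclideanSpace.single (2 : Fin 3) (2 * Real.pi)) = 2 * Real.pi := by
        simp [vert]
      rw [e3, e4]
      simp
    have hsplit : tensorCLM (SchwartzMap.derivCLM ℂ ℂ (modeTest n)) f =
        tensorCLM (SchwartzMap.compSubConstCLM ℂ (-(2 * Real.pi)) (transitionTest n)) f -
          tensorCLM (transitionTest n) f - (Complex.I * n) • tensorCLM (modeTest n) f := by
      rw [deriv_modeTest]
      ext x
      simp only [tensorCLM_apply, _root_.sub_apply, _root_.smul_apply, smul_eq_mul]
      ring
    rw [zFourierCoeff_apply, pderiv, lineDerivOp_apply_apply, lineDeriv_tensorCLM, e1, e2,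
      hsplit]
    have e0 : (∂_{(0 : Plane)} f : 𝓢(Plane, ℂ)) = 0 := by
      ext x
      rw [SchwartzMap.lineDerivOp_apply_eq_fderiv, map_zero]
      rfl
    rw [e0, map_zero, zero_add, Complex.ofReal_one, one_smul, map_neg, map_sub u, map_sub u, hper,
      sub_self, zero_sub, neg_neg, map_smul, _root_.smul_apply, zFourierCoeff_apply, smul_eq_mul,
      smul_eq_mul]
    ring

end FourierCoefficients

/-! ### The gradient estimates -/

section GradientBound

/-- The symbol of `Δ̇_j` acting in the horizontal variables. -/
def blockSymbol (φ : 𝓢(Plane, ℂ)) (j : ℤ) : temperateSymbols Space :=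
  ⟨fun ξ => φ ((2 : ℝ) ^ (-j) • (2 * Real.pi) • horiz ξ), by
    have h : Function.HasTemperateGrowth fun ξ : Space =>
        (2 : ℝ) ^ (-j) • (2 * Real.pi) • horiz ξ :=
      (((2 : ℝ) ^ (-j) • (2 * Real.pi) • horiz : Space →L[ℝ] Plane)).hasTemperateGrowth
    exact φ.hasTemperateGrowth.comp h⟩

theorem blockSpace_eq_smul (φ : 𝓢(Plane, ℂ)) (j : ℤ) (u : 𝓢'(Space, ℂ)) :
    blockSpace φ j u = blockSymbol φ j • u := rfl

/-- The symbol does not depend on the vertical frequency, so `n` is free and can be matched to the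
mode under consideration. -/
theorem blockPlane_eq_smul (φ : 𝓢(Plane, ℂ)) (j n : ℤ) (u : 𝓢'(Plane, ℂ)) :
    blockPlane φ j u = sliceSymbol n (blockSymbol φ j) • u := by
  rw [symbol_smul_def, blockPlane]
  congr 2
  funext η
  change _ = φ ((2 : ℝ) ^ (-j) • (2 * Real.pi) • horiz (freqSlice n η))
  rw [horiz_freqSlice]

/-- On the frequencies of `Δ̇_j` the Laplacian is inverted by a symbol for which the second
derivatives of the inverse have integrable kernels, with a bound independent of `j`. -/
theorem exists_inverse_laplacian_symbol : ∃ C : ℝ≥0, C ≠ 0 ∧ ∀ φ : 𝓢(Plane, ℂ),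
    Function.support φ ⊆ {ξ | 3 / 4 ≤ ‖ξ‖ ∧ ‖ξ‖ ≤ 8 / 3} → ∀ j : ℤ,
    ∃ Q : temperateSymbols Space,
      blockSymbol φ j * Q * (derivSymbol 0 ^ 2 + derivSymbol 1 ^ 2 + derivSymbol 2 ^ 2) =
        blockSymbol φ j ∧
      ∀ (k : Fin 2) (l : Fin 3), IsWienerSymbol (C : ℝ≥0∞)
        ((Q * derivSymbol k.castSucc * derivSymbol l : temperateSymbols Space) : Space → ℂ) := by
  obtain ⟨χ, q, C, hχ, hq, hqχ, hW⟩ := exists_resolvent_symbol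
  -- The added `1` makes the constant nonzero, as Young's inequality above requires.
  refine ⟨C + 1, by positivity, fun φ hφ j => ?_⟩
  set c : ℝ := (2 : ℝ) ^ (-j) * (2 * Real.pi) with hc
  have hc0 : c ≠ 0 := by positivity
  have hpi : (Real.pi : ℂ) ≠ 0 := by exact_mod_cast Real.pi_ne_zero
  have hgrow : Function.HasTemperateGrowth fun ξ : Space => q (c • ξ) :=
    hq.comp (c • ContinuousLinearMap.id ℝ Space).hasTemperateGrowth
  -- The Laplacian has symbol `-4π²|ξ|²`, and `q (c • ξ)` inverts `c²|ξ|²` where `χ (c • horiz ξ) =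
  -- 1`. After multiplication by two derivative symbols all constants cancel, leaving an exact
  -- dilate of a fixed Wiener symbol.
  refine ⟨⟨fun ξ => -((c : ℂ) ^ 2 / (4 * Real.pi ^ 2)) * q (c • ξ),
    (Function.HasTemperateGrowth.const (-((c : ℂ) ^ 2 / (4 * Real.pi ^ 2)))).mul hgrow⟩, ?_, fun k l => ?_⟩
  · apply Subtype.ext
    funext ξ
    change φ ((2 : ℝ) ^ (-j) • (2 * Real.pi) • horiz ξ) *
      (-((c : ℂ) ^ 2 / (4 * Real.pi ^ 2)) * q (c • ξ)) *
        ((2 * Real.pi * Complex.I * ((ξ 0 : ℝ) : ℂ)) ^ 2 +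
          (2 * Real.pi * Complex.I * ((ξ 1 : ℝ) : ℂ)) ^ 2 +
          (2 * Real.pi * Complex.I * ((ξ 2 : ℝ) : ℂ)) ^ 2) =
      φ ((2 : ℝ) ^ (-j) • (2 * Real.pi) • horiz ξ)
    rw [smul_smul, ← hc]
    by_cases h0 : φ (c • horiz ξ) = 0
    · rw [h0]; ring
    obtain ⟨h1, h2⟩ := hφ h0
    have h3 := hqχ (c • ξ)
    rw [map_smul, hχ _ h1 h2] at h3
    have h4 : ((‖c • ξ‖ ^ 2 : ℝ) : ℂ) =
        (c : ℂ) ^ 2 * ((ξ 0 : ℂ) ^ 2 + (ξ 1 : ℂ) ^ 2 + (ξ 2 : ℂ) ^ 2) := by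
      rw [norm_smul, mul_pow, Real.norm_eq_abs, sq_abs, EuclideanSpace.norm_sq_eq,
        Fin.sum_univ_three]
      simp only [Real.norm_eq_abs, sq_abs]
      push_cast
      ring
    rw [h4] at h3
    have h5 : -((c : ℂ) ^ 2 / (4 * Real.pi ^ 2)) * q (c • ξ) *
        ((2 * Real.pi * Complex.I * ((ξ 0 : ℝ) : ℂ)) ^ 2 +
          (2 * Real.pi * Complex.I * ((ξ 1 : ℝ) : ℂ)) ^ 2 +
          (2 * Real.pi * Complex.I * ((ξ 2 : ℝ) : ℂ)) ^ 2) = 1 := by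
      rw [← h3]
      simp only [mul_pow, Complex.I_sq]
      field_simp
      ring
    rw [mul_assoc, h5, mul_one]
  · have h := ((hW k l).comp_smul hc0).mono (D := ((C + 1 : ℝ≥0) : ℝ≥0∞)) (by
      exact_mod_cast le_self_add)
    convert h using 1
    funext ξ
    change -((c : ℂ) ^ 2 / (4 * Real.pi ^ 2)) * q (c • ξ) *
      (2 * Real.pi * Complex.I * ((ξ k.castSucc : ℝ) : ℂ)) *
      (2 * Real.pi * Complex.I * ((ξ l : ℝ) : ℂ)) = _
    simp only [PiLp.smul_apply, smul_eq_mul]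
    push_cast
    field_simp
    rw [Complex.I_sq]
    ring

theorem ZPeriodic.pderiv {u : 𝓢'(Space, ℂ)} (hu : ZPeriodic u) (l : Fin 3) :
    ZPeriodic (pderiv l u) := by
  rw [pderiv_eq_smul]
  exact hu.fourierMultiplier (derivSymbol l).2

theorem ZPeriodic.curl {v : Fin 3 → 𝓢'(Space, ℂ)} (hv : ∀ i, ZPeriodic (v i)) (i : Fin 3) :
    ZPeriodic (curl v i) := by
  fin_cases i
  · exact ((hv 2).pderiv 1).sub ((hv 1).pderiv 2)
  · exact ((hv 0).pderiv 2).sub ((hv 2).pderiv 0)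
  · exact ((hv 1).pderiv 0).sub ((hv 0).pderiv 1)

theorem divFree_iff_smul {v : Fin 3 → 𝓢'(Space, ℂ)} : DivFree v ↔
    derivSymbol 0 • v 0 + derivSymbol 1 • v 1 + derivSymbol 2 • v 2 = 0 := by
  simp only [DivFree, Fin.sum_univ_three, pderiv_eq_smul]

theorem sum_gradient_le {f : Fin 2 × Fin 3 → ℝ≥0∞} {B : ℝ≥0∞} (h : ∀ a, f a ≤ B) :
    ∑ a, f a ≤ 6 * B := by
  refine (Finset.sum_le_card_nsmul _ _ B fun a _ => h a).trans_eq ?_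
  simp [Finset.card_univ]

/-- The bound holds for each Fourier mode and each block separately, with one constant, so it can be
summed over both. The factor `6` counts the entries of the horizontal gradient. -/
theorem exists_besovStrip_gradH_le : ∃ C : ℝ≥0, ∀ φ : 𝓢(Plane, ℂ),
    Function.support φ ⊆ {ξ | 3 / 4 ≤ ‖ξ‖ ∧ ‖ξ‖ ≤ 8 / 3} →
    ∀ v : Fin 3 → 𝓢'(Space, ℂ), (∀ i, ZPeriodic (v i)) → DivFree v →
      besovStrip φ ∞ (gradH v) ≤ C * besovStrip φ ∞ (curl v) := by
  obtain ⟨C, hC0, hC⟩ := exists_inverse_laplacian_symbol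
  refine ⟨6 * C, fun φ hφ v hv hdiv => ?_⟩
  have key : ∀ (n q : ℤ) (k : Fin 2) (i : Fin 3),
      lpNormOn Set.univ ∞ (blockPlane φ q (zFourierCoeff n (pderiv k.castSucc (v i)))) ≤
        C * ∑ m, lpNormOn Set.univ ∞ (blockPlane φ q (zFourierCoeff n (curl v m))) := by
    intro n q k i
    obtain ⟨Q, hQ, hW⟩ := hC φ hφ q
    have hQ' := congrArg (sliceSymbol n) hQ
    simp only [map_mul, map_add, map_pow] at hQ'
    simp only [blockPlane_eq_smul φ q n]
    rw [zFourierCoeff_pderiv (hv i)]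
    refine lpNormOn_top_gradient_le (q := sliceSymbol n Q)
      (d := fun l => sliceSymbol n (derivSymbol l)) (v := fun i => zFourierCoeff n (v i))
      (Ω := fun m => zFourierCoeff n (curl v m))
      (ENNReal.coe_ne_zero.2 hC0) hQ' (fun l => ?_) ?_ ?_ ?_ ?_ i
    · exact isWienerSymbol_slice (hW k l) (n / (2 * Real.pi))
    · have h := congrArg (zFourierCoeff n) hdiv
      simpa only [Fin.sum_univ_three, zFourierCoeff_add, zFourierCoeff_pderiv (hv _),
        zFourierCoeff_zero] using h
    · change zFourierCoeff n (pderiv 1 (v 2) - pderiv 2 (v 1)) = _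
      simp only [zFourierCoeff_sub, zFourierCoeff_pderiv (hv _)]
    · change zFourierCoeff n (pderiv 2 (v 0) - pderiv 0 (v 2)) = _
      simp only [zFourierCoeff_sub, zFourierCoeff_pderiv (hv _)]
    · change zFourierCoeff n (pderiv 0 (v 1) - pderiv 1 (v 0)) = _
      simp only [zFourierCoeff_sub, zFourierCoeff_pderiv (hv _)]
  rw [ENNReal.coe_mul, mul_assoc]
  refine sum_gradient_le fun a => ?_
  calc ∑' n : ℤ, besovPlane φ ∞ (zFourierCoeff n (gradH v a))
      ≤ ∑' n : ℤ, ∑' q : ℤ, C * ∑ m, lpNormOn Set.univ ∞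
          (blockPlane φ q (zFourierCoeff n (curl v m))) :=
        ENNReal.tsum_le_tsum fun n => ENNReal.tsum_le_tsum fun q => key n q a.1 a.2
    _ = C * besovStrip φ ∞ (curl v) := by
        simp only [ENNReal.tsum_mul_left, Fin.sum_univ_three, ENNReal.tsum_add, besovStrip,
          besovPlane]

theorem exists_lpStrip_blockSpace_gradH_le : ∃ C : ℝ≥0, ∀ φ : 𝓢(Plane, ℂ),
    Function.support φ ⊆ {ξ | 3 / 4 ≤ ‖ξ‖ ∧ ‖ξ‖ ≤ 8 / 3} →
    ∀ v : Fin 3 → 𝓢'(Space, ℂ), (∀ i, ZPeriodic (v i)) → DivFree v → ∀ j : ℤ,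
      lpStrip ∞ (fun a => blockSpace φ j (gradH v a)) ≤
        C * lpStrip ∞ (fun i => blockSpace φ j (curl v i)) := by
  obtain ⟨C, hC0, hC⟩ := exists_inverse_laplacian_symbol
  refine ⟨6 * C, fun φ hφ v hv hdiv j => ?_⟩
  obtain ⟨Q, hQ, hW⟩ := hC φ hφ j
  rw [ENNReal.coe_mul, mul_assoc]
  refine sum_gradient_le fun a => (lpNormOn_mono (Set.subset_univ strip) _ _).trans ?_
  have h := lpNormOn_top_gradient_le (ENNReal.coe_ne_zero.2 hC0) hQ (hW a.1)
    (divFree_iff_smul.1 hdiv) (Ω := curl v)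
    (by simp only [← pderiv_eq_smul]; rfl) (by simp only [← pderiv_eq_smul]; rfl)
    (by simp only [← pderiv_eq_smul]; rfl) a.2
  have e : ∀ m, lpNormOn Set.univ ∞ (blockSymbol φ j • curl v m) =
      lpNormOn strip ∞ (blockSpace φ j (curl v m)) := fun m =>
    lpNormOn_top_univ_eq_strip ((ZPeriodic.curl hv m).fourierMultiplier (blockSymbol φ j).2)
  simp only [e, ← pderiv_eq_smul] at h
  exact h

end GradientBound

/-! ### Low horizontal frequencies -/

section LowFrequencies

/-- The symbol of `(1 - ∂_z²)⁻¹`. -/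
def vertResolvent : temperateSymbols Space :=
  ⟨fun ξ => (((1 + (2 * Real.pi * vert ξ) ^ 2)⁻¹ : ℝ) : ℂ), by
    have h : Function.HasTemperateGrowth fun ξ : Space => 2 * Real.pi * vert ξ :=
      ((2 * Real.pi) • vert : Space →L[ℝ] ℝ).hasTemperateGrowth
    exact hasTemperateGrowth_inv_one_add_sq h⟩

theorem one_sub_sq_mul_vertResolvent : (1 - derivSymbol 2 ^ 2) * vertResolvent = 1 := by
  apply Subtype.ext
  funext ξ
  change (1 - (2 * Real.pi * Complex.I * ((vert ξ : ℝ) : ℂ)) ^ 2) *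
    (((1 + (2 * Real.pi * vert ξ) ^ 2)⁻¹ : ℝ) : ℂ) = 1
  have h : (1 - (2 * Real.pi * Complex.I * ((vert ξ : ℝ) : ℂ)) ^ 2) =
      ((1 + (2 * Real.pi * vert ξ) ^ 2 : ℝ) : ℂ) := by
    simp only [mul_pow, Complex.I_sq]
    push_cast
    ring
  rw [h, ← Complex.ofReal_mul, mul_inv_cancel₀ (by positivity), Complex.ofReal_one]

/-- A symbol depending only on the vertical frequency, whose kernel decays like `e^{-|z|}`. -/
def HasExpKernel (e : temperateSymbols Space) : Prop :=
  ∃ b : ℝ → ℂ, Measurable b ∧ (∀ z, ‖b z‖ ≤ Real.exp (-|z|)) ∧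
    ∀ ξ, (e : Space → ℂ) ξ = ∫ z, Real.fourierChar (-(z * vert ξ)) • b z

theorem hasExpKernel_vertResolvent : HasExpKernel vertResolvent := by
  refine ⟨fun z => 1 / 2 * (1 * (Real.exp (-(1 * |z|)) : ℂ)), ?_, fun z => ?_, fun ξ => ?_⟩
  · have : Continuous fun z : ℝ => 1 / 2 * (1 * (Real.exp (-(1 * |z|)) : ℂ)) := by fun_prop
    exact this.measurable
  · simp only [one_mul, norm_mul, Complex.norm_real, Real.norm_eq_abs, Real.abs_exp]
    norm_num
    linarith [Real.exp_pos (-|z|)]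
  · have e' : ∀ (t : Circle) (a b : ℂ), t • (a * b) = a * t • b := fun t a b => by
      simp only [Circle.smul_def, smul_eq_mul]; ring
    have h := integral_fourierChar_exp_abs_even one_pos (vert ξ)
    simp only [← Complex.ofReal_mul 1, ← Complex.ofReal_neg, ← Complex.ofReal_exp] at h
    simp only [e' _ (1 / 2)]
    rw [integral_const_mul, h]
    change (((1 + (2 * Real.pi * vert ξ) ^ 2)⁻¹ : ℝ) : ℂ) = _
    push_cast
    ring

/-- The kernel is minus the derivative of `e^{-|z|}/2`, that is `sgn(z) e^{-|z|}/2`. -/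
theorem hasExpKernel_deriv_vertResolvent : HasExpKernel (-(derivSymbol 2 * vertResolvent)) := by
  refine ⟨fun z => 1 / 2 * (((SignType.sign z : ℝ) : ℂ) * (Real.exp (-(1 * |z|)) : ℂ)), ?_,
    fun z => ?_, fun ξ => ?_⟩
  · have h : Continuous fun z : ℝ => (Real.exp (-(1 * |z|)) : ℂ) := by fun_prop
    exact measurable_const.mul (measurable_ofReal_sign.mul h.measurable)
  · have h : ‖((SignType.sign z : ℝ) : ℂ)‖ ≤ 1 := by
      rcases lt_trichotomy z 0 with h | h | h
      · simp [sign_neg h]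
      · simp [h]
      · simp [sign_pos h]
    simp only [one_mul, norm_mul, Complex.norm_real, Real.norm_eq_abs, Real.abs_exp] at h ⊢
    norm_num
    nlinarith [Real.exp_pos (-|z|)]
  · have e' : ∀ (t : Circle) (a b : ℂ), t • (a * b) = a * t • b := fun t a b => by
      simp only [Circle.smul_def, smul_eq_mul]; ring
    have h := integral_fourierChar_exp_abs_odd one_pos (vert ξ)
    simp only [← Complex.ofReal_mul 1, ← Complex.ofReal_neg, ← Complex.ofReal_exp] at h
    simp only [e' _ (1 / 2)]
    rw [integral_const_mul, h]
    change -((2 * Real.pi * Complex.I * ((vert ξ : ℝ) : ℂ)) *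
      (((1 + (2 * Real.pi * vert ξ) ^ 2)⁻¹ : ℝ) : ℂ)) = _
    push_cast
    ring

/-- The `L²` norm of a Schwartz function on the plane. -/
def sqNorm (σ : 𝓢(Plane, ℂ)) : ℝ≥0 := (√(∫ η, ‖σ η‖ ^ 2)).toNNReal

/-- The dilation of a Schwartz function on the plane to the frequencies of size `2 ^ j`. -/
theorem exists_dilation (σ : 𝓢(Plane, ℂ)) (j : ℤ) : ∃ τ : 𝓢(Plane, ℂ),
    (∀ η, τ η = σ ((2 : ℝ) ^ (-j) • (2 * Real.pi) • η)) ∧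
      √(∫ η, ‖τ η‖ ^ 2) ≤ (2 : ℝ) ^ j * √(∫ η, ‖σ η‖ ^ 2) := by
  set c : ℝ := (2 : ℝ) ^ (-j) * (2 * Real.pi) with hc
  have hc0 : c ≠ 0 := by positivity
  let g : Plane ≃L[ℝ] Plane := ContinuousLinearEquiv.smulLeft (Units.mk0 c hc0)
  have hg : ∀ η, SchwartzMap.compCLMOfContinuousLinearEquiv ℂ g σ η = σ (c • η) := fun η => rfl
  refine ⟨SchwartzMap.compCLMOfContinuousLinearEquiv ℂ g σ, fun η => ?_, ?_⟩
  · rw [hg, smul_smul]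
  simp only [hg]
  rw [Measure.integral_comp_smul volume (fun η : Plane => ‖σ η‖ ^ 2) c, smul_eq_mul,
    Real.sqrt_mul (abs_nonneg _)]
  refine mul_le_mul_of_nonneg_right ?_ (Real.sqrt_nonneg _)
  -- Dimension two enters here: the `L²` norm scales by `c⁻¹ = 2^j/(2π)`, and the `2π` is dropped.
  have h1 : |(c ^ Module.finrank ℝ Plane)⁻¹| = (c⁻¹) ^ 2 := by
    rw [finrank_euclideanSpace_fin, ← inv_pow, abs_of_nonneg (by positivity)]
  rw [h1, Real.sqrt_sq (by positivity), hc, mul_inv, zpow_neg, inv_inv]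
  refine mul_le_of_le_one_right (by positivity) (inv_le_one_of_one_le₀ ?_)
  linarith [Real.pi_gt_three]

/-- Bernstein's inequality in the horizontal plane; in the vertical direction the exponential kernel
does the smoothing. The profile `σ` is arbitrary so that horizontal derivatives of a block, which
have another profile, are covered. -/
theorem exists_lpNormOn_top_block_le : ∃ C : ℝ≥0, ∀ (σ : 𝓢(Plane, ℂ)) (j : ℤ)
    (e : temperateSymbols Space) (u : 𝓢'(Space, ℂ)), HasExpKernel e → ZPeriodic u →
    lpNormOn strip 2 u < ∞ →
    lpNormOn Set.univ ∞ ((blockSymbol σ j * e) • u) ≤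
      (C * sqNorm σ * 2 ^ j : ℝ≥0) * lpNormOn strip 2 u := by
  obtain ⟨C, hC⟩ := exists_lpNormOn_top_le_strip_two
  refine ⟨C, fun σ j e u ⟨b, hb, hbe, heb⟩ hu hfin => ?_⟩
  obtain ⟨τ, hτ, hτσ⟩ := exists_dilation σ j
  refine (hC τ b _ u hb hbe (blockSymbol σ j * e).2 (fun ξ => ?_) hu hfin).trans ?_
  · rw [hτ, ← heb]
    rfl
  · refine mul_le_mul_left ?_ _
    rw [mul_assoc, ENNReal.coe_mul]
    refine mul_le_mul_right ?_ _
    refine (ENNReal.ofReal_le_ofReal hτσ).trans_eq ?_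
    rw [mul_comm, ENNReal.ofReal_mul (Real.sqrt_nonneg _), ENNReal.coe_mul]
    congr 1
    rw [ENNReal.ofReal, Real.toNNReal_zpow (by norm_num)]
    norm_num

/-- The product of `φ` with the `k`-th coordinate. -/
def coordMul (k : Fin 2) (φ : 𝓢(Plane, ℂ)) : 𝓢(Plane, ℂ) :=
  SchwartzMap.smulLeftCLM ℂ (fun η : Plane => ((η k : ℝ) : ℂ)) φ

theorem coordMul_apply (k : Fin 2) (φ : 𝓢(Plane, ℂ)) (η : Plane) :
    coordMul k φ η = ((η k : ℝ) : ℂ) * φ η := by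
  have h1 : Function.HasTemperateGrowth fun η : Plane => (η k : ℝ) :=
    (EuclideanSpace.proj (𝕜 := ℝ) k : Plane →L[ℝ] ℝ).hasTemperateGrowth
  have h2 : Function.HasTemperateGrowth fun η : Plane => ((η k : ℝ) : ℂ) :=
    Complex.ofRealCLM.hasTemperateGrowth.comp h1
  rw [coordMul, SchwartzMap.smulLeftCLM_apply_apply h2, smul_eq_mul]

/-- Since `2πiξ_k = i 2^j (2^{-j} 2πξ_k)`, a horizontal derivative on a block is `2^j` times a block
with the modified profile `η_k φ(η)`. -/
theorem blockSymbol_mul_derivSymbol_smul (φ : 𝓢(Plane, ℂ)) (j : ℤ) (e : temperateSymbols Space)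
    (k : Fin 2) (u : 𝓢'(Space, ℂ)) :
    (blockSymbol φ j * e) • derivSymbol k.castSucc • u =
      (((2 : ℝ) ^ j : ℝ) * Complex.I : ℂ) • (blockSymbol (coordMul k φ) j * e) • u := by
  rw [smul_smul, symbol_smul_def, symbol_smul_def,
    ← fourierMultiplier_const_mul (blockSymbol (coordMul k φ) j * e).2]
  congr 2
  funext ξ
  change φ ((2 : ℝ) ^ (-j) • (2 * Real.pi) • horiz ξ) * (e : Space → ℂ) ξ *
    (2 * Real.pi * Complex.I * ((ξ k.castSucc : ℝ) : ℂ)) = (((2 : ℝ) ^ j : ℝ) * Complex.I : ℂ) *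
      (coordMul k φ ((2 : ℝ) ^ (-j) • (2 * Real.pi) • horiz ξ) * (e : Space → ℂ) ξ)
  rw [coordMul_apply, ← horiz_apply, PiLp.smul_apply, PiLp.smul_apply, smul_eq_mul, smul_eq_mul,
    zpow_neg]
  have h : ((2 : ℝ) ^ j : ℝ) ≠ 0 := by positivity
  generalize (2 : ℝ) ^ j = t at h ⊢
  have h' : (t : ℂ) ≠ 0 := by exact_mod_cast h
  push_cast
  field_simp

/-- A distribution is recovered from its image and that of its vertical derivative under multipliers
with exponentially decaying vertical kernels. -/
theorem smul_eq_vertResolvent (b : temperateSymbols Space) (u : 𝓢'(Space, ℂ)) :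
    b • u = (b * vertResolvent) • u +
      (b * -(derivSymbol 2 * vertResolvent)) • derivSymbol 2 • u := by
  rw [smul_smul, ← add_smul]
  congr 1
  linear_combination (-b) * one_sub_sq_mul_vertResolvent

/-- The vertical derivative in `smul_eq_vertResolvent` is never estimated directly: curl and
divergence express it through `Ω` and horizontal derivatives of `v`. -/
theorem exists_lpNormOn_top_lowBlock_le (φ : 𝓢(Plane, ℂ)) : ∃ C : ℝ≥0,
    ∀ v : Fin 3 → 𝓢'(Space, ℂ), (∀ i, ZPeriodic (v i)) → DivFree v →
      lpStrip 2 v < ∞ → lpStrip 2 (curl v) < ∞ → ∀ j : ℤ, j ≤ 0 → ∀ i,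
      lpNormOn Set.univ ∞ (blockSpace φ j (v i)) ≤
        (C * 2 ^ j : ℝ≥0) * (lpStrip 2 v + lpStrip 2 (curl v)) := by
  obtain ⟨C, hC⟩ := exists_lpNormOn_top_block_le
  set S : ℝ≥0 := sqNorm φ + sqNorm (coordMul 0 φ) + sqNorm (coordMul 1 φ) with hS
  refine ⟨C * S, fun v hv hdiv hvfin hΩfin j hj i => ?_⟩
  set N := lpNormOn (E := Space) Set.univ ∞ with hN
  set L := lpNormOn (E := Space) strip 2 with hL
  set A : ℝ≥0∞ := ((C * S * 2 ^ j : ℝ≥0) : ℝ≥0∞) with hA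
  set b := blockSymbol φ j with hb
  set r := -(derivSymbol 2 * vertResolvent) with hr
  have hvl : ∀ m, L (v m) < ∞ := fun m =>
    (Finset.single_le_sum (fun _ _ => zero_le) (Finset.mem_univ m)).trans_lt hvfin
  have hΩl : ∀ m, L (curl v m) < ∞ := fun m =>
    (Finset.single_le_sum (fun _ _ => zero_le) (Finset.mem_univ m)).trans_lt hΩfin
  have hblock : ∀ e, HasExpKernel e → ∀ u, ZPeriodic u → L u < ∞ → N ((b * e) • u) ≤ A * L u := by
    intro e he u hu hfin
    refine (hC φ j e u he hu hfin).trans (mul_le_mul_left (ENNReal.coe_le_coe.2 ?_) _)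
    gcongr
    rw [hS, add_assoc]
    exact le_self_add
  have hderiv : ∀ k : Fin 2, ∀ u, ZPeriodic u → L u < ∞ →
      N ((b * r) • derivSymbol k.castSucc • u) ≤ A * L u := by
    intro k u hu hfin
    have hc : (((2 : ℝ) ^ j : ℝ) * Complex.I : ℂ) ≠ 0 :=
      mul_ne_zero (by exact_mod_cast (by positivity : ((2 : ℝ) ^ j) ≠ 0)) Complex.I_ne_zero
    -- The restriction to `j ≤ 0` matters here: the horizontal derivative costs `2^j ≤ 1`.
    have hc1 : ‖(((2 : ℝ) ^ j : ℝ) * Complex.I : ℂ)‖ₑ ≤ 1 := by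
      rw [← ofReal_norm, norm_mul, Complex.norm_I, mul_one, Complex.norm_real, Real.norm_eq_abs,
        abs_of_pos (by positivity), ENNReal.ofReal_le_one]
      exact zpow_le_one_of_nonpos₀ (by norm_num) hj
    rw [hb, blockSymbol_mul_derivSymbol_smul]
    refine (lpNormOn_smul_le _ _ hc _).trans ((mul_le_of_le_one_left zero_le hc1).trans ?_)
    refine (hC _ j r u hasExpKernel_deriv_vertResolvent hu hfin).trans
      (mul_le_mul_left (ENNReal.coe_le_coe.2 ?_) _)
    gcongr
    rw [hS]
    fin_cases k
    · exact le_add_right le_add_self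
    · exact le_add_self
  have hadd : ∀ x y, N (x + y) ≤ N x + N y := lpNormOn_add_le _ le_top
  have hsub : ∀ x y, N (x - y) ≤ N x + N y := lpNormOn_sub_le _ le_top
  have hΩ : ∀ m, N ((b * r) • curl v m) ≤ A * L (curl v m) := fun m =>
    hblock r hasExpKernel_deriv_vertResolvent _ (ZPeriodic.curl hv m) (hΩl m)
  have hres : N ((b * vertResolvent) • v i) ≤ A * L (v i) :=
    hblock _ hasExpKernel_vertResolvent _ (hv i) (hvl i)
  have hd0 : ∀ m, N ((b * r) • derivSymbol 0 • v m) ≤ A * L (v m) := fun m =>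
    hderiv 0 _ (hv m) (hvl m)
  have hd1 : ∀ m, N ((b * r) • derivSymbol 1 • v m) ≤ A * L (v m) := fun m =>
    hderiv 1 _ (hv m) (hvl m)
  have hΩ0 : curl v 0 = derivSymbol 1 • v 2 - derivSymbol 2 • v 1 := by
    simp only [← pderiv_eq_smul]; rfl
  have hΩ1 : curl v 1 = derivSymbol 2 • v 0 - derivSymbol 0 • v 2 := by
    simp only [← pderiv_eq_smul]; rfl
  rw [blockSpace_eq_smul, smul_eq_vertResolvent]
  refine (hadd _ _).trans ((add_le_add_left hres _).trans ?_)
  simp only [lpStrip, Fin.sum_univ_three, mul_add]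
  change _ ≤ A * L (v 0) + A * L (v 1) + A * L (v 2) +
    (A * L (curl v 0) + A * L (curl v 1) + A * L (curl v 2))
  fin_cases i
  · have e : derivSymbol 2 • v 0 = curl v 1 + derivSymbol 0 • v 2 := by rw [hΩ1]; abel
    change A * L (v 0) + N ((b * r) • derivSymbol 2 • v 0) ≤ _
    rw [e, smul_add]
    calc _ ≤ A * L (v 0) + (A * L (curl v 1) + A * L (v 2)) :=
          add_le_add_right ((hadd _ _).trans (add_le_add (hΩ 1) (hd0 2))) _
      _ ≤ A * L (v 0) + (A * L (curl v 1) + A * L (v 2)) +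
          (A * L (v 1) + A * L (curl v 0) + A * L (curl v 2)) := le_self_add
      _ = _ := by ring
  · have e : derivSymbol 2 • v 1 = derivSymbol 1 • v 2 - curl v 0 := by rw [hΩ0]; abel
    change A * L (v 1) + N ((b * r) • derivSymbol 2 • v 1) ≤ _
    rw [e, smul_sub]
    calc _ ≤ A * L (v 1) + (A * L (v 2) + A * L (curl v 0)) :=
          add_le_add_right ((hsub _ _).trans (add_le_add (hd1 2) (hΩ 0))) _
      _ ≤ A * L (v 1) + (A * L (v 2) + A * L (curl v 0)) +
          (A * L (v 0) + A * L (curl v 1) + A * L (curl v 2)) := le_self_add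
      _ = _ := by ring
  · have e : derivSymbol 2 • v 2 = -(derivSymbol 0 • v 0 + derivSymbol 1 • v 1) := by
      rw [eq_neg_iff_add_eq_zero, add_comm]
      exact divFree_iff_smul.1 hdiv
    change A * L (v 2) + N ((b * r) • derivSymbol 2 • v 2) ≤ _
    rw [e, smul_neg, smul_add, hN, lpNormOn_neg]
    calc _ ≤ A * L (v 2) + (A * L (v 0) + A * L (v 1)) :=
          add_le_add_right ((hadd _ _).trans (add_le_add (hd0 0) (hd1 1))) _
      _ ≤ A * L (v 2) + (A * L (v 0) + A * L (v 1)) +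
          (A * L (curl v 0) + A * L (curl v 1) + A * L (curl v 2)) := le_self_add
      _ = _ := by ring

theorem summable_two_zpow_Iic (N : ℤ) : Summable fun j : Set.Iic N => (2 : ℝ≥0) ^ (j : ℤ) := by
  have h : Summable fun n : ℕ => (2 : ℝ≥0) ^ N * (2⁻¹ : ℝ≥0) ^ n := by
    refine Summable.mul_left _ ?_
    rw [← NNReal.summable_coe]
    simpa using summable_geometric_two
  have hle : ∀ j : Set.Iic N, ((N - (j : ℤ)).toNat : ℤ) = N - j := fun j =>
    Int.toNat_of_nonneg (sub_nonneg.2 j.2)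
  have hinj : Function.Injective fun j : Set.Iic N => (N - (j : ℤ)).toNat := by
    intro a b hab
    have hab' : ((N - (a : ℤ)).toNat : ℤ) = (N - (b : ℤ)).toNat := congrArg Nat.cast hab
    rw [hle, hle] at hab'
    exact Subtype.ext (sub_right_injective hab')
  refine (NNReal.summable_comp_injective h hinj).congr fun j => ?_
  rw [Function.comp_apply, inv_pow, ← zpow_natCast, hle, ← zpow_neg, ← zpow_add₀ two_ne_zero]
  congr 1
  ring

/-- Without control of `∂_z u` the blocks need not be bounded functions, but their images under
`(1-∂_z²)⁻¹` are, with summable norms. Applying the continuous operator `1-∂_z²` to that series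
gives convergence in `𝓢'`. -/
theorem lowFreqSummable_of_lpNormOn_two (φ : 𝓢(Plane, ℂ)) {u : 𝓢'(Space, ℂ)} (hu : ZPeriodic u)
    (hfin : lpNormOn strip 2 u < ∞) : LowFreqSummable φ 0 u := by
  obtain ⟨C, hC⟩ := exists_lpNormOn_top_block_le
  have h := (summable_of_lpNormOn_top_le (ι := Set.Iic (0 - 1 : ℤ))
    (u := fun j => (blockSymbol φ j * vertResolvent) • u)
    (fun j => hC φ j vertResolvent u hasExpKernel_vertResolvent hu hfin) ?_).1
  · have h2 := h.mapL (fourierMultiplierCLM ℂ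
      ((1 - derivSymbol 2 ^ 2 : temperateSymbols Space) : Space → ℂ))
    refine h2.congr fun j => ?_
    rw [← symbol_smul_def, smul_smul, blockSpace_eq_smul, mul_left_comm,
      one_sub_sq_mul_vertResolvent, mul_one]
  · rw [ENNReal.tsum_mul_right]
    refine ENNReal.mul_ne_top (ENNReal.tsum_coe_ne_top_iff_summable.2 ?_) hfin.ne
    exact (summable_two_zpow_Iic _).mul_left _

theorem exists_lpStrip_lowFreq_le (φ : 𝓢(Plane, ℂ)) : ∃ C : ℝ≥0,
    ∀ v : Fin 3 → 𝓢'(Space, ℂ), (∀ i, ZPeriodic (v i)) → DivFree v →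
      lpStrip 2 v < ∞ → lpStrip 2 (curl v) < ∞ →
      lpStrip ∞ (fun i => lowFreq φ 0 (v i)) ≤ C * (lpStrip 2 v + lpStrip 2 (curl v)) := by
  obtain ⟨C, hC⟩ := exists_lpNormOn_top_lowBlock_le φ
  set T : ℝ≥0 := ∑' j : Set.Iic (0 - 1 : ℤ), C * (2 : ℝ≥0) ^ (j : ℤ) with hT
  have hs : Summable fun j : Set.Iic (0 - 1 : ℤ) => C * (2 : ℝ≥0) ^ (j : ℤ) :=
    (summable_two_zpow_Iic _).mul_left _
  refine ⟨3 * T, fun v hv hdiv hvfin hΩfin => ?_⟩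
  have e : ∑' j : Set.Iic (0 - 1 : ℤ), ((C * (2 : ℝ≥0) ^ (j : ℤ) : ℝ≥0) : ℝ≥0∞) *
      (lpStrip 2 v + lpStrip 2 (curl v)) = T * (lpStrip 2 v + lpStrip 2 (curl v)) := by
    rw [ENNReal.tsum_mul_right, ← ENNReal.coe_tsum hs]
  have key : ∀ i, lpNormOn strip ∞ (lowFreq φ 0 (v i)) ≤
      T * (lpStrip 2 v + lpStrip 2 (curl v)) := by
    intro i
    refine (lpNormOn_mono (Set.subset_univ strip) _ _).trans ?_
    rw [← e]
    refine (summable_of_lpNormOn_top_le (ι := Set.Iic (0 - 1 : ℤ))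
      (u := fun j => blockSpace φ j (v i)) (fun j => ?_) ?_).2
    · exact hC v hv hdiv hvfin hΩfin j (by have := j.2; simp only [Set.mem_Iic] at this; omega) i
    · rw [e]
      exact ENNReal.mul_ne_top ENNReal.coe_ne_top (ENNReal.add_ne_top.2 ⟨hvfin.ne, hΩfin.ne⟩)
  refine (Finset.sum_le_card_nsmul _ _ _ fun i _ => key i).trans_eq ?_
  simp [mul_assoc]

end LowFrequencies

end

end StripBesov

/-! ### Assembly of the estimates -/

theorem lemma3p6 (φ : 𝓢(Plane, ℂ)) (hφ : IsDyadicPartition φ) :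
    ∃ C : ℝ≥0, ∀ v : Fin 3 → 𝓢'(Space, ℂ), (∀ i, ZPeriodic (v i)) → DivFree v →
      besovStrip φ ∞ (gradH v) ≤ C * besovStrip φ ∞ (curl v) ∧
      (∀ j : ℤ, 0 ≤ j →
        lpStrip ∞ (fun a => blockSpace φ j (gradH v a)) ≤
          C * ENNReal.ofReal ((2 : ℝ) ^ ((j : ℝ) / 2)) *
            lpStrip ∞ (fun i => blockSpace φ j (curl v i))) ∧
      (lpStrip 2 v < ∞ → ∀ i, LowFreqSummable φ 0 (v i)) ∧
      lpStrip ∞ (fun i => lowFreq φ 0 (v i)) ≤ C * (lpStrip 2 v + lpStrip 2 (curl v)) := by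
  obtain ⟨C₁, h₁⟩ := exists_besovStrip_gradH_le
  obtain ⟨C₂, h₂⟩ := exists_lpStrip_blockSpace_gradH_le
  obtain ⟨C₃, h₃⟩ := exists_lpStrip_lowFreq_le φ
  have hC₁ : (C₁ : ℝ≥0∞) ≤ (C₁ + C₂ + C₃ + 1 : ℝ≥0) := by
    rw [ENNReal.coe_le_coe, add_assoc, add_assoc]
    exact le_self_add
  have hC₂ : (C₂ : ℝ≥0∞) ≤ (C₁ + C₂ + C₃ + 1 : ℝ≥0) := by
    rw [ENNReal.coe_le_coe, add_assoc]
    exact le_add_right le_add_self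
  have hC₃ : (C₃ : ℝ≥0∞) ≤ (C₁ + C₂ + C₃ + 1 : ℝ≥0) := by
    rw [ENNReal.coe_le_coe]
    exact le_add_right le_add_self
  refine ⟨C₁ + C₂ + C₃ + 1, fun v hv hdiv => ⟨?_, fun j hj => ?_, fun hfin i => ?_, ?_⟩⟩
  · exact (h₁ φ hφ.support_subset v hv hdiv).trans (mul_le_mul_left hC₁ _)
  · refine (h₂ φ hφ.support_subset v hv hdiv j).trans (mul_le_mul_left ?_ _)
    -- The estimate `h₂` has no factor depending on `j`; for `j ≥ 0` the factor `2^{j/2}` only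
    -- enlarges the right side.
    have h : 1 ≤ ENNReal.ofReal ((2 : ℝ) ^ ((j : ℝ) / 2)) := by
      rw [ENNReal.one_le_ofReal]
      exact Real.one_le_rpow one_le_two (by positivity)
    exact hC₂.trans (le_mul_of_one_le_right' h)
  · refine lowFreqSummable_of_lpNormOn_two φ (hv i) (lt_of_le_of_lt ?_ hfin)
    exact Finset.single_le_sum (f := fun i => lpNormOn strip 2 (v i)) (fun _ _ => zero_le)
      (Finset.mem_univ i)
  · by_cases hfin : lpStrip 2 v + lpStrip 2 (curl v) = ∞
    -- The `1` in the constant ensures that an infinite right side stays infinite after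
    -- multiplication.
    · rw [hfin, ENNReal.mul_top (by exact_mod_cast (by positivity : C₁ + C₂ + C₃ + 1 ≠ 0))]
      exact le_top
    · rw [← ne_eq, ENNReal.add_ne_top] at hfin
      exact (h₃ v hv hdiv hfin.1.lt_top hfin.2.lt_top).trans (mul_le_mul_left hC₃ _)
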